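/- Let $\sigma_3=\mathrm{diag}(1,-1)$, let $\Omega\subset\mathbb R^2$ be open and let $u,v:\Omega\to\mathbb C$ be smooth functions of $(x,t)$ satisfying the Kaup--Newell system $$\mathrm i u_t+u_{xx}-\mathrm i(u^2v)_x=0,\qquad -\mathrm i v_t+v_{xx}+\mathrm i(uv^2)_x=0 .$$ Its Lax pair is $\Phi_x=U\Phi$, $\Phi_t=V\Phi$, where, with $\mathcal Q=\begin{pmatrix}0&u\\ v&0\end{pmatrix}$, $$U=-\tfrac{\mathrm i}{\zeta^2}\sigma_3+\tfrac1\zeta \mathcal Q,\qquad V=-\tfrac{2\mathrm i}{\zeta^4}\sigma_3+\tfrac{2}{\zeta^3}\mathcal Q-\tfrac{\mathrm i}{\zeta^2}\mathcal Q^2\sigma_3+\tfrac1\zeta \mathcal Q^3-\tfrac{\mathrm i}{\zeta}\mathcal Q_x\sigma_3 ,$$ and the conjugate Lax pair, for row vectors, is $-\Psi_x=\Psi U$, $-\Psi_t=\Psi V$. Let $m_1,\dots,m_n\ge 0$ be integers and $N=\sum_i m_i$. Let $\mu_1,\dots,\mu_n,\nu_1,\dots,\nu_n$ be nonzero complex numbers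 whose squares are $2n$ distinct numbers. For each $i$ let $\Phi_i(\mu)=(\phi_i,\varphi_i)^T$ ($\mu$ near $\mu_i$) and $\Psi_i(\nu)=(\chi_i,\psi_i)$ ($\nu$ near $\nu_i$) be families of solutions on $\Omega$ of the Lax pair at $\zeta=\mu$ and of the conjugate Lax pair at $\zeta=\nu$, smooth in all variables and holomorphic in the spectral parameter. Order the pairs $(i,j)$, $1\le i\le n$, $0\le j<m_i$, lexicographically, and define recursively, for each pair, $$T_i^{[j]}(\zeta)=I+\frac{A_i^{[j]}}{\zeta-\nu_i}-\frac{\sigma_3A_i^{[j]}\sigma_3}{\zeta+\nu_i},\qquad \widetilde T_i^{[j]}(\zeta)=I+\frac{B_i^{[j]}}{\zeta-\mu_i}-\frac{\sigma_3B_i^{[j]}\sigma_3}{\zeta+\mu_i},$$ $$A_i^{[j]}=\tfrac{\nu_i^2-\mu_i^2}{2}\,\mathrm{diag}(\alpha_i^{[j]},\beta_i^{[j]})\,\Phi_i^{[j]}\Psi_i^{[j]},\qquad B_i^{[j]}=\tfrac{\mu_i^2-\nu_i^2}{2}\,\Phi_i^{[j]}\Psi_i^{[j]}\,\mathrm{diag}(\beta_i^{[j]},\alpha_i^{[j]}),$$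 $$1/\alpha_i^{[j]}=\Psi_i^{[j]}\mathrm{diag}(\nu_i,\mu_i)\Phi_i^{[j]},\qquad 1/\beta_i^{[j]}=\Psi_i^{[j]}\mathrm{diag}(\mu_i,\nu_i)\Phi_i^{[j]},$$ with the seeds $$\Phi_i^{[j]}=\sum_{l=0}^{j}\frac{\Omega_l}{(j-l)!}\frac{\partial^{j-l}\Phi_i}{\partial\mu^{j-l}}\Big|_{\mu=\mu_i},\qquad \Psi_i^{[j]}=\sum_{l=0}^{j}\frac{\partial^{j-l}\Psi_i}{\partial\nu^{j-l}}\Big|_{\nu=\nu_i}\frac{\Lambda_l}{(j-l)!}.$$ Here $\Omega_l$ (which depends on $(i,j)$) is the sum, over all choices of a number $\delta\in\{0,1,2\}$ for each pair $(k,q)$ preceding $(i,j)$ with $\sum\delta=l$, of the products of the matrices $M_k^{[q]}$, the last pair on the left; $\Lambda_l$ is the corresponding sum of the products of the $N_k^{[q]}$, the last pair on the right; and, for $\delta=0,1,2$ respectively, $$M_k^{[q]}=T_k^{[q]}(\mu_i),\quad \frac{2\mu_i I+A_k^{[q]}-\sigma_3A_k^{[q]}\sigma_3}{\mu_i^2-\nu_k^2},\quad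 \frac{I}{\mu_i^2-\nu_k^2};\qquad N_k^{[q]}=\widetilde T_k^{[q]}(\nu_i),\quad \frac{2\nu_i I+B_k^{[q]}-\sigma_3B_k^{[q]}\sigma_3}{\nu_i^2-\mu_k^2},\quad \frac{I}{\nu_i^2-\mu_k^2}.$$ Assume that the numbers $1/\alpha_i^{[j]}$ and $1/\beta_i^{[j]}$ do not vanish on $\Omega$. Put $$T_N=T_n^{[m_n-1]}\cdots T_n^{[0]}\cdots T_1^{[m_1-1]}\cdots T_1^{[0]},\qquad \widetilde T_N=\widetilde T_1^{[0]}\cdots \widetilde T_1^{[m_1-1]}\cdots \widetilde T_n^{[0]}\cdots \widetilde T_n^{[m_n-1]} .$$ Let $P$ and $Q$ be the $N\times N$ block matrices whose blocks $P^{[ij]},Q^{[ij]}$ have size $m_i\times m_j$ and entries ($1\le k\le m_i$, $1\le l\le m_j$) $$P^{[ij]}_{kl}=\frac{1}{(k-1)!(l-1)!}\frac{\partial^{k+l-2}}{\partial\nu^{k-1}\partial\mu^{l-1}}\left(\frac{\Psi_i(\nu)\sigma_3\Phi_j(\mu)}{\mu+\nu}-\frac{\Psi_i(\nu)\Phi_j(\mu)}{\mu-\nu}\right)\Big|_{\mu=\mu_j,\,\nu=\nu_i},$$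 $$Q^{[ij]}_{kl}=-\frac{1}{(k-1)!(l-1)!}\frac{\partial^{k+l-2}}{\partial\nu^{k-1}\partial\mu^{l-1}}\left(\frac{\Psi_i(\nu)\sigma_3\Phi_j(\mu)}{\mu+\nu}+\frac{\Psi_i(\nu)\Phi_j(\mu)}{\mu-\nu}\right)\Big|_{\mu=\mu_j,\,\nu=\nu_i},$$ and let $$P_1=\begin{pmatrix}P&\widehat\psi\\ \widehat\phi&0\end{pmatrix},\qquad Q_1=\begin{pmatrix}Q&\widehat\chi\\ \widehat\varphi&0\end{pmatrix},$$ where the column $\widehat\psi$ has the entries $\frac{1}{(k-1)!}\partial_\nu^{k-1}\psi_i|_{\nu=\nu_i}$, the row $\widehat\phi$ has the entries $\frac{1}{(l-1)!}\partial_\mu^{l-1}\phi_j|_{\mu=\mu_j}$, and $\widehat\chi$, $\widehat\varphi$ are formed in the same way from the $\chi_i$ and $\varphi_j$. Set $$u[N]=u-2\left(\frac{\det P_1}{\det P}\right)_x,\qquad v[N]=v-2\left(\frac{\det Q_1}{\det Q}\right)_x .$$ Then, on $\Omega$: 1. For $0\le j<m_i$ the seeds are the limits, as $\delta\to0$, $\delta\neq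 0$, $$\Phi_i^{[j]}=\lim\delta^{-j}\big(T_i^{[j-1]}\cdots T_i^{[0]}\cdots T_1^{[0]}\big)(\mu_i+\delta)\,\Phi_i(\mu_i+\delta),\qquad \Psi_i^{[j]}=\lim\delta^{-j}\,\Psi_i(\nu_i+\delta)\big(\widetilde T_1^{[0]}\cdots\widetilde T_i^{[0]}\cdots\widetilde T_i^{[j-1]}\big)(\nu_i+\delta).$$ 2. $\widetilde T_i^{[j]}$ is the inverse of $T_i^{[j]}$ and $\widetilde T_N$ is the inverse of $T_N$, for all $\zeta$ away from the poles of the matrices in question. 3. $T_N$ has zeros of order $m_i$ at $\pm\mu_i$, and $T_N^{-1}$ has zeros of order $m_i$ at $\pm\nu_i$: $\det T_N=\prod_i\big(\frac{\zeta^2-\mu_i^2}{\zeta^2-\nu_i^2}\big)^{m_i}$, $\det \widetilde T_N=\prod_i\big(\frac{\zeta^2-\nu_i^2}{\zeta^2-\mu_i^2}\big)^{m_i}$, $T_N(\zeta)\Phi_i(\zeta)=O((\zeta-\mu_i)^{m_i})$ as $\zeta\to\mu_i$, and $\Psi_i(\zeta)\widetilde T_N(\zeta)=O((\zeta-\nu_i)^{m_i})$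 as $\zeta\to\nu_i$. 4. $\det P$ and $\det Q$ do not vanish, $\det P_1/\det P$ and $\det Q_1/\det Q$ are smooth, and $(u[N],v[N])$ satisfies the Kaup--Newell system. 5. $T_N$ is a Darboux matrix from the Lax pair of $(u,v)$ to that of $(u[N],v[N])$: with $U[N],V[N]$ formed from $u[N],v[N]$, $\;(T_N)_x+T_NU=U[N]T_N$ and $(T_N)_t+T_NV=V[N]T_N$ for all $\zeta\ne0,\pm\nu_i$. Likewise $\widetilde T_N$ is a Darboux matrix for the conjugate Lax pairs: $(\widetilde T_N)_x=U\widetilde T_N-\widetilde T_NU[N]$ and $(\widetilde T_N)_t=V\widetilde T_N-\widetilde T_NV[N]$ for all $\zeta\neq0,\pm\mu_i$. 6. The entries of all $A_i^{[j]}$, $B_i^{[j]}$ are smooth, and $$u[N]=u+\sum_{i=1}^n\sum_{j=0}^{m_i-1}\big(A_i^{[j]}-\sigma_3A_i^{[j]}\sigma_3\big)_{12,x},\qquad v[N]=v-\sum_{i=1}^n\sum_{j=0}^{m_i-1}\big(B_i^{[j]}-\sigma_3B_i^{[j]}\sigma_3\big)_{21,x}.$$ -/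

import Mathlib

open scoped ContDiff

noncomputable section

namespace KaupNewell

/-! ### The Kaup-Newell system and its Lax pair

Points of the plane are pairs `p = (x, t)`. -/

/-- Partial derivative with respect to `x`. -/
def dX (f : ℝ × ℝ → ℂ) (p : ℝ × ℝ) : ℂ := deriv (fun s : ℝ => f (s, p.2)) p.1

/-- Partial derivative with respect to `t`. -/
def dT (f : ℝ × ℝ → ℂ) (p : ℝ × ℝ) : ℂ := deriv (fun s : ℝ => f (p.1, s)) p.2

/-- The pair `(u, v)` satisfies the Kaup-Newell system at every point of `Ω`. -/
def SolvesKN (u v : ℝ × ℝ → ℂ) (Ω : Set (ℝ × ℝ)) : Prop :=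
  ∀ p ∈ Ω,
    Complex.I * dT u p + dX (dX u) p - Complex.I * dX (fun q => u q ^ 2 * v q) p = 0 ∧
    -Complex.I * dT v p + dX (dX v) p + Complex.I * dX (fun q => u q * v q ^ 2) p = 0

/-- The Pauli matrix `σ₃`. -/
def sigma3 : Matrix (Fin 2) (Fin 2) ℂ := !![1, 0; 0, -1]

/-- The off-diagonal matrix with entries `a` and `b`. -/
def offDiag (a b : ℂ) : Matrix (Fin 2) (Fin 2) ℂ := !![0, a; b, 0]

/-- The matrix `U` of the spatial part of the Lax pair, at spectral parameter `ζ`. -/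
def laxU (u v : ℝ × ℝ → ℂ) (ζ : ℂ) (p : ℝ × ℝ) : Matrix (Fin 2) (Fin 2) ℂ :=
  -(Complex.I / ζ ^ 2) • sigma3 + (1 / ζ) • offDiag (u p) (v p)

/-- The matrix `V` of the temporal part of the Lax pair, at spectral parameter `ζ`. -/
def laxV (u v : ℝ × ℝ → ℂ) (ζ : ℂ) (p : ℝ × ℝ) : Matrix (Fin 2) (Fin 2) ℂ :=
  -(2 * Complex.I / ζ ^ 4) • sigma3 + (2 / ζ ^ 3) • offDiag (u p) (v p)
    - (Complex.I / ζ ^ 2) • (offDiag (u p) (v p) ^ 2 * sigma3)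
    + (1 / ζ) • offDiag (u p) (v p) ^ 3
    - (Complex.I / ζ) • (offDiag (dX u p) (dX v p) * sigma3)

/-- The column vector function `f` solves `f_x = U f`, `f_t = V f` on `Ω`. -/
def SolvesLax (u v : ℝ × ℝ → ℂ) (Ω : Set (ℝ × ℝ)) (ζ : ℂ) (f : ℝ × ℝ → Fin 2 → ℂ) : Prop :=
  ∀ p ∈ Ω,
    HasDerivAt (fun s : ℝ => f (s, p.2)) (Matrix.mulVec (laxU u v ζ p) (f p)) p.1 ∧
    HasDerivAt (fun s : ℝ => f (p.1, s)) (Matrix.mulVec (laxV u v ζ p) (f p)) p.2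

/-- The row vector function `g` solves the conjugate system `-g_x = g U`, `-g_t = g V` on `Ω`. -/
def SolvesConjLax (u v : ℝ × ℝ → ℂ) (Ω : Set (ℝ × ℝ)) (ζ : ℂ) (g : ℝ × ℝ → Fin 2 → ℂ) :
    Prop :=
  ∀ p ∈ Ω,
    HasDerivAt (fun s : ℝ => g (s, p.2)) (-Matrix.vecMul (g p) (laxU u v ζ p)) p.1 ∧
    HasDerivAt (fun s : ℝ => g (p.1, s)) (-Matrix.vecMul (g p) (laxV u v ζ p)) p.2

/-- A family of vector functions on `Ω`, depending on the spectral parameter in a neighbourhood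
`W` of `ζ₀`, is smooth in all variables and holomorphic in the spectral parameter, and each member
has the property `S`. -/
def FamilyNear (S : ℂ → (ℝ × ℝ → Fin 2 → ℂ) → Prop) (Ω : Set (ℝ × ℝ)) (ζ₀ : ℂ)
    (F : ℂ → ℝ × ℝ → Fin 2 → ℂ) : Prop :=
  ∃ W : Set ℂ, IsOpen W ∧ ζ₀ ∈ W ∧
    ContDiffOn ℝ ∞ (fun q : ℂ × (ℝ × ℝ) => F q.1 q.2) (W ×ˢ Ω) ∧
    (∀ p ∈ Ω, DifferentiableOn ℂ (fun ζ => F ζ p) W) ∧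
    ∀ ζ ∈ W, S ζ (F ζ)

/-- A holomorphic family of solutions of the Lax pair at spectral parameters near `ζ₀`. -/
def IsLaxFamily (u v : ℝ × ℝ → ℂ) (Ω : Set (ℝ × ℝ)) (ζ₀ : ℂ) (F : ℂ → ℝ × ℝ → Fin 2 → ℂ) :
    Prop :=
  FamilyNear (SolvesLax u v Ω) Ω ζ₀ F

/-- A holomorphic family of solutions of the conjugate Lax pair at parameters near `ζ₀`. -/
def IsConjLaxFamily (u v : ℝ × ℝ → ℂ) (Ω : Set (ℝ × ℝ)) (ζ₀ : ℂ)
    (G : ℂ → ℝ × ℝ → Fin 2 → ℂ) : Prop :=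
  FamilyNear (SolvesConjLax u v Ω) Ω ζ₀ G

/-- `D` is a Darboux matrix at `ζ` from the Lax pair of `(u, v)` to that of `(u', v')`:
`D_x = U' D - D U` and `D_t = V' D - D V` (entrywise derivatives), so that `D f` solves the
new Lax pair whenever `f` solves the old one. -/
def IsDarboux (u v u' v' : ℝ × ℝ → ℂ) (Ω : Set (ℝ × ℝ)) (ζ : ℂ)
    (D : ℝ × ℝ → Matrix (Fin 2) (Fin 2) ℂ) : Prop :=
  ∀ p ∈ Ω, ∀ a b : Fin 2,
    HasDerivAt (fun s : ℝ => D (s, p.2) a b)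
      ((laxU u' v' ζ p * D p - D p * laxU u v ζ p) a b) p.1 ∧
    HasDerivAt (fun s : ℝ => D (p.1, s) a b)
      ((laxV u' v' ζ p * D p - D p * laxV u v ζ p) a b) p.2

/-- `E` is a Darboux matrix at `ζ` from the conjugate Lax pair of `(u, v)` to that of `(u', v')`:
`E_x = U E - E U'` and `E_t = V E - E V'`, so that `g E` solves the new conjugate Lax pair
whenever the row vector `g` solves the old one. -/
def IsConjDarboux (u v u' v' : ℝ × ℝ → ℂ) (Ω : Set (ℝ × ℝ)) (ζ : ℂ)
    (E : ℝ × ℝ → Matrix (Fin 2) (Fin 2) ℂ) : Prop :=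
  ∀ p ∈ Ω, ∀ a b : Fin 2,
    HasDerivAt (fun s : ℝ => E (s, p.2) a b)
      ((laxU u v ζ p * E p - E p * laxU u' v' ζ p) a b) p.1 ∧
    HasDerivAt (fun s : ℝ => E (p.1, s) a b)
      ((laxV u v ζ p * E p - E p * laxV u' v' ζ p) a b) p.2

/-! ### One binary step -/

/-- The data of one binary step: its spectral parameters and the residue matrices of the
Darboux matrix and of its inverse. -/
structure Step where
  mu : ℂ
  nu : ℂ
  A : Matrix (Fin 2) (Fin 2) ℂ
  B : Matrix (Fin 2) (Fin 2) ℂ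

/-- `T(ζ) = I + A / (ζ - ν) - σ₃ A σ₃ / (ζ + ν)`. -/
def Step.T (s : Step) (ζ : ℂ) : Matrix (Fin 2) (Fin 2) ℂ :=
  1 + (1 / (ζ - s.nu)) • s.A - (1 / (ζ + s.nu)) • (sigma3 * s.A * sigma3)

/-- `I + B / (ζ - μ) - σ₃ B σ₃ / (ζ + μ)`, the formula for the inverse of `T(ζ)`. -/
def Step.Tinv (s : Step) (ζ : ℂ) : Matrix (Fin 2) (Fin 2) ℂ :=
  1 + (1 / (ζ - s.mu)) • s.B - (1 / (ζ + s.mu)) • (sigma3 * s.B * sigma3)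

/-- `g diag(ν, μ) f` for a row `g` and a column `f`: the reciprocal of `α`. -/
def alphaInv (μ ν : ℂ) (f g : Fin 2 → ℂ) : ℂ :=
  g ⬝ᵥ Matrix.mulVec (Matrix.diagonal ![ν, μ]) f

/-- `g diag(μ, ν) f` for a row `g` and a column `f`: the reciprocal of `β`. -/
def betaInv (μ ν : ℂ) (f g : Fin 2 → ℂ) : ℂ :=
  g ⬝ᵥ Matrix.mulVec (Matrix.diagonal ![μ, ν]) f

/-- The binary step with parameters `μ, ν`, column seed `f` and row seed `g`. -/
def binaryStep (μ ν : ℂ) (f g : Fin 2 → ℂ) : Step where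
  mu := μ
  nu := ν
  A := ((ν ^ 2 - μ ^ 2) / 2) •
    (Matrix.diagonal ![(alphaInv μ ν f g)⁻¹, (betaInv μ ν f g)⁻¹] * Matrix.vecMulVec f g)
  B := ((μ ^ 2 - ν ^ 2) / 2) •
    (Matrix.vecMulVec f g * Matrix.diagonal ![(betaInv μ ν f g)⁻¹, (alphaInv μ ν f g)⁻¹])

/-! ### Histories of steps

A history is a list of steps with the most recent one first. -/

/-- The product `T_k ⋯ T_1` over a history, the most recent factor on the left. -/
def prodT (L : List Step) (ζ : ℂ) : Matrix (Fin 2) (Fin 2) ℂ :=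
  (L.map fun s => s.T ζ).prod

/-- The product `T_1⁻¹ ⋯ T_k⁻¹` over a history, the most recent factor on the right. -/
def prodTinv (L : List Step) (ζ : ℂ) : Matrix (Fin 2) (Fin 2) ℂ :=
  (L.map fun s => s.Tinv ζ).reverse.prod

/-- The three matrices `M` attached to a step at the point `z`, indexed by `δ = 0, 1, 2`. -/
def Step.M (s : Step) (z : ℂ) : Fin 3 → Matrix (Fin 2) (Fin 2) ℂ :=
  ![s.T z,
    (1 / (z ^ 2 - s.nu ^ 2)) •
      ((2 * z) • (1 : Matrix (Fin 2) (Fin 2) ℂ) + s.A - sigma3 * s.A * sigma3),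
    (1 / (z ^ 2 - s.nu ^ 2)) • (1 : Matrix (Fin 2) (Fin 2) ℂ)]

/-- The three matrices `N` attached to a step at the point `z`, indexed by `δ = 0, 1, 2`. -/
def Step.N (s : Step) (z : ℂ) : Fin 3 → Matrix (Fin 2) (Fin 2) ℂ :=
  ![s.Tinv z,
    (1 / (z ^ 2 - s.mu ^ 2)) •
      ((2 * z) • (1 : Matrix (Fin 2) (Fin 2) ℂ) + s.B - sigma3 * s.B * sigma3),
    (1 / (z ^ 2 - s.mu ^ 2)) • (1 : Matrix (Fin 2) (Fin 2) ℂ)]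

/-- `Ω_l`: the sum, over all choices of a `δ ∈ {0, 1, 2}` for each step of the history with
`∑ δ = l`, of the products `M_k ⋯ M_1` (most recent factor on the left). -/
def Omega (L : List Step) (z : ℂ) (l : ℕ) : Matrix (Fin 2) (Fin 2) ℂ :=
  ∑ d : Fin L.length → Fin 3,
    if ∑ k, (d k : ℕ) = l then (List.ofFn fun k => (L.get k).M z (d k)).prod else 0

/-- `Λ_l`: the sum, over all choices of a `δ ∈ {0, 1, 2}` for each step of the history with
`∑ δ = l`, of the products `N_1 ⋯ N_k` (most recent factor on the right). -/
def Lambda (L : List Step) (z : ℂ) (l : ℕ) : Matrix (Fin 2) (Fin 2) ℂ :=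
  ∑ d : Fin L.length → Fin 3,
    if ∑ k, (d k : ℕ) = l then (List.ofFn fun k => (L.get k).N z (d k)).reverse.prod else 0

/-- The column seed of level `j` produced from the family `φ` at `z` after the history `L`:
`∑_{l ≤ j} Ω_l φ^{(j-l)}(z) / (j-l)!`. -/
def seedCol (L : List Step) (z : ℂ) (φ : ℂ → Fin 2 → ℂ) (j : ℕ) : Fin 2 → ℂ :=
  ∑ l ∈ Finset.range (j + 1),
    (1 / (Nat.factorial (j - l) : ℂ)) • Matrix.mulVec (Omega L z l) (iteratedDeriv (j - l) φ z)

/-- The row seed of level `j` produced from the family `ψ` at `z` after the history `L`: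
`∑_{l ≤ j} ψ^{(j-l)}(z) Λ_l / (j-l)!`. -/
def seedRow (L : List Step) (z : ℂ) (ψ : ℂ → Fin 2 → ℂ) (j : ℕ) : Fin 2 → ℂ :=
  ∑ l ∈ Finset.range (j + 1),
    (1 / (Nat.factorial (j - l) : ℂ)) • Matrix.vecMul (iteratedDeriv (j - l) ψ z) (Lambda L z l)

/-- Continue the history `L` by `j` steps of one block with parameters `μ, ν` and families
`φ, ψ`; the step of level `k` uses the seeds of level `k` produced after all earlier steps. -/
def addSteps (μ ν : ℂ) (φ ψ : ℂ → Fin 2 → ℂ) (L : List Step) : ℕ → List Step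
  | 0 => L
  | k + 1 =>
    binaryStep μ ν (seedCol (addSteps μ ν φ ψ L k) μ φ k) (seedRow (addSteps μ ν φ ψ L k) ν ψ k)
      :: addSteps μ ν φ ψ L k

/-! ### The generalized transformation

Everything in this part is at a fixed point `p`; `φ i` and `ψ i` are the families as functions of
the spectral parameter. -/

variable {n : ℕ} (m : Fin n → ℕ) (μ ν : Fin n → ℂ) (φ ψ : Fin n → ℂ → Fin 2 → ℂ)

/-- The history consisting of the first `i` blocks, the block `k` having `m k` steps. -/
def blocks : ℕ → List Step
  | 0 => []
  | i + 1 =>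
    if h : i < n then
      addSteps (μ ⟨i, h⟩) (ν ⟨i, h⟩) (φ ⟨i, h⟩) (ψ ⟨i, h⟩) (blocks i) (m ⟨i, h⟩)
    else blocks i

/-- The history preceding the step of level `j` in block `i`. -/
def history (i : Fin n) (j : ℕ) : List Step :=
  addSteps (μ i) (ν i) (φ i) (ψ i) (blocks m μ ν φ ψ i) j

/-- The seed `Φ_i^{[j]}`. -/
def seedPhi (i : Fin n) (j : ℕ) : Fin 2 → ℂ :=
  seedCol (history m μ ν φ ψ i j) (μ i) (φ i) j

/-- The seed `Ψ_i^{[j]}`. -/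
def seedPsi (i : Fin n) (j : ℕ) : Fin 2 → ℂ :=
  seedRow (history m μ ν φ ψ i j) (ν i) (ψ i) j

/-- The step of level `j` in block `i`; it carries `A_i^{[j]}`, `B_i^{[j]}` and `T_i^{[j]}`. -/
def gStep (i : Fin n) (j : ℕ) : Step :=
  binaryStep (μ i) (ν i) (seedPhi m μ ν φ ψ i j) (seedPsi m μ ν φ ψ i j)

/-- `T_N(ζ) = T_n^{[m_n-1]} ⋯ T_n^{[0]} ⋯ T_1^{[m_1-1]} ⋯ T_1^{[0]}`. -/
def gdt (ζ : ℂ) : Matrix (Fin 2) (Fin 2) ℂ := prodT (blocks m μ ν φ ψ n) ζ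

/-- `T_1^{[0]-1} ⋯ T_1^{[m_1-1]-1} ⋯ T_n^{[0]-1} ⋯ T_n^{[m_n-1]-1}` at `ζ`. -/
def gdtInv (ζ : ℂ) : Matrix (Fin 2) (Fin 2) ℂ := prodTinv (blocks m μ ν φ ψ n) ζ

/-! ### The determinants -/

/-- `1 / (k! l!) ∂_a^k ∂_b^l K(a, b)` at `a = ν₀`, `b = μ₀`. -/
def mixedTaylor (K : ℂ → ℂ → ℂ) (ν₀ μ₀ : ℂ) (k l : ℕ) : ℂ :=
  1 / ((Nat.factorial k : ℂ) * (Nat.factorial l : ℂ)) *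
    iteratedDeriv k (fun a => iteratedDeriv l (fun b => K a b) μ₀) ν₀

/-- The kernel `Ψ(ν) σ₃ Φ(μ) / (μ + ν) - Ψ(ν) Φ(μ) / (μ - ν)`. -/
def kerP (g f : ℂ → Fin 2 → ℂ) (a b : ℂ) : ℂ :=
  (g a ⬝ᵥ Matrix.mulVec sigma3 (f b)) / (b + a) - (g a ⬝ᵥ f b) / (b - a)

/-- The kernel `-(Ψ(ν) σ₃ Φ(μ) / (μ + ν) + Ψ(ν) Φ(μ) / (μ - ν))`. -/
def kerQ (g f : ℂ → Fin 2 → ℂ) (a b : ℂ) : ℂ :=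
  -((g a ⬝ᵥ Matrix.mulVec sigma3 (f b)) / (b + a) + (g a ⬝ᵥ f b) / (b - a))

/-- The `N × N` block matrix `P`; its block `(i, j)` has size `m i × m j`. -/
def matP : Matrix (Σ i, Fin (m i)) (Σ i, Fin (m i)) ℂ :=
  Matrix.of fun r c =>
    mixedTaylor (kerP (ψ r.1) (φ c.1)) (ν r.1) (μ c.1) (r.2 : ℕ) (c.2 : ℕ)

/-- The `N × N` block matrix `Q`; its block `(i, j)` has size `m i × m j`. -/
def matQ : Matrix (Σ i, Fin (m i)) (Σ i, Fin (m i)) ℂ :=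
  Matrix.of fun r c =>
    mixedTaylor (kerQ (ψ r.1) (φ c.1)) (ν r.1) (μ c.1) (r.2 : ℕ) (c.2 : ℕ)

/-- The column of normalized derivatives of the component `a` of the `ψ i` at `ν i`. -/
def hatCol (a : Fin 2) : Matrix (Σ i, Fin (m i)) Unit ℂ :=
  Matrix.of fun r _ =>
    1 / (Nat.factorial (r.2 : ℕ) : ℂ) * iteratedDeriv (r.2 : ℕ) (fun z => ψ r.1 z a) (ν r.1)

/-- The row of normalized derivatives of the component `a` of the `φ i` at `μ i`. -/
def hatRow (a : Fin 2) : Matrix Unit (Σ i, Fin (m i)) ℂ :=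
  Matrix.of fun _ c =>
    1 / (Nat.factorial (c.2 : ℕ) : ℂ) * iteratedDeriv (c.2 : ℕ) (fun z => φ c.1 z a) (μ c.1)

/-- `P` bordered by the second components of the rows `Ψ_i` and the first components of the
columns `Φ_i`. -/
def matP1 : Matrix ((Σ i, Fin (m i)) ⊕ Unit) ((Σ i, Fin (m i)) ⊕ Unit) ℂ :=
  Matrix.fromBlocks (matP m μ ν φ ψ) (hatCol m ν ψ 1) (hatRow m μ φ 0) 0

/-- `Q` bordered by the first components of the rows `Ψ_i` and the second components of the
columns `Φ_i`. -/
def matQ1 : Matrix ((Σ i, Fin (m i)) ⊕ Unit) ((Σ i, Fin (m i)) ⊕ Unit) ℂ :=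
  Matrix.fromBlocks (matQ m μ ν φ ψ) (hatCol m ν ψ 0) (hatRow m μ φ 1) 0

/-- The quotient of determinants `P₁ / P`. -/
def ratioP : ℂ := (matP1 m μ ν φ ψ).det / (matP m μ ν φ ψ).det

/-- The quotient of determinants `Q₁ / Q`. -/
def ratioQ : ℂ := (matQ1 m μ ν φ ψ).det / (matQ m μ ν φ ψ).det

/-! ### The new fields -/

/-- The families of vector functions `F i` at the point `p`, as functions of the spectral
parameter. -/
def atPt (F : Fin n → ℂ → ℝ × ℝ → Fin 2 → ℂ) (p : ℝ × ℝ) : Fin n → ℂ → Fin 2 → ℂ :=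
  fun i ζ => F i ζ p

/-- `u[N] = u[0] - 2 (P₁ / P)_x`. -/
def newU (Φ Ψ : Fin n → ℂ → ℝ × ℝ → Fin 2 → ℂ) (u : ℝ × ℝ → ℂ) (p : ℝ × ℝ) : ℂ :=
  u p - 2 * dX (fun q => ratioP m μ ν (atPt Φ q) (atPt Ψ q)) p

/-- `v[N] = v[0] - 2 (Q₁ / Q)_x`. -/
def newV (Φ Ψ : Fin n → ℂ → ℝ × ℝ → Fin 2 → ℂ) (v : ℝ × ℝ → ℂ) (p : ℝ × ℝ) : ℂ :=
  v p - 2 * dX (fun q => ratioQ m μ ν (atPt Φ q) (atPt Ψ q)) p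

end KaupNewell

end

noncomputable section

namespace KaupNewell

open Filter Topology

/-! ### Taylor coefficients and leading coefficients -/

/-! Everything rests on one binary step. Over the common denominator ζ² - ν², `T` is the polynomial
matrix [[ζ² + P, ζβ], [ζγ, ζ² + R]] with β = 2A₁₂, γ = 2A₂₁ and determinant (ζ² - μ²)(ζ² - ν²)
(`binaryStep_det_numT`). Hence its adjugate yields the inverse, and T(μ) annihilates the column
seed. If the column solves the Lax pair at μ and the row the conjugate pair at ν, then `T` is a
Darboux matrix to the fields u + β_x, v + γ_x: comparing powers of ζ leaves finitely many identities
(`StepRelations`), established in `binaryStep_relations`. Among them, β_t and γ_t are the increments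
of the fluxes in the conservation laws u_t = (u²v + iu_x)_x and v_t = (uv² - iv_x)_x. The new fields
therefore solve the system as soon as ∂_x and ∂_t are interchanged.

Repeated parameters are treated through orders of vanishing. The transformed family (T ⋯ T)(ζ)Φ_i(ζ)
vanishes at μ_i to the number of steps already made in block i, and the next seed is its leading
coefficient; since the next factor kills that coefficient, the order grows by one (`hasLead_prodT`).
The leading coefficient of a holomorphic family of solutions again solves the limiting linear system
(`lead_family`), so each seed solves the Lax pair of the current fields and the one-step result
applies along the whole chain (`ChainDarboux.cons`).

The determinants come from Gaussian elimination. A step changes the kernels of P and Q by a rank-one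
term (`vecKer_step`). Summing over all steps, and discarding a remainder that vanishes to order m_j
at μ_j, factors P as L D⁻¹ U with triangular L, U and nonzero pivots (`mixedTaylor_kernel`). The
borders factor in the same way, so the Schur complement gives det P₁ / det P = -∑ A₁₂, and -∑ A₂₁
for Q (`det_bordered_kernel`).

Statements on rows follow from those on columns by transposing and exchanging μ with ν
(`binaryStep_swap`). -/

/-- The Taylor coefficient of order `k` of `f` at `z`. -/
def taylorCoeff {E : Type*} [NormedAddCommGroup E] [NormedSpace ℂ E] (k : ℕ) (f : ℂ → E) (z : ℂ) :
    E :=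
  (1 / (Nat.factorial k : ℂ)) • iteratedDeriv k f z

/-- Near `z` the function `F` is `(ζ - z) ^ k` times an analytic function with value `c` at `z`. -/
def HasLead {E : Type*} [NormedAddCommGroup E] [NormedSpace ℂ E] (k : ℕ) (F : ℂ → E) (z : ℂ)
    (c : E) : Prop :=
  ∃ h : ℂ → E, AnalyticAt ℂ h z ∧ (∀ᶠ ζ in 𝓝 z, F ζ = (ζ - z) ^ k • h ζ) ∧ h z = c

section Lead

variable {E : Type*} [NormedAddCommGroup E] [NormedSpace ℂ E] {k : ℕ} {F G : ℂ → E} {z : ℂ} {c : E}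

theorem taylorCoeff_congr (h : F =ᶠ[𝓝 z] G) (k : ℕ) : taylorCoeff k F z = taylorCoeff k G z := by
  rw [taylorCoeff, taylorCoeff, h.iteratedDeriv_eq]

theorem HasLead.congr (hF : HasLead k F z c) (h : F =ᶠ[𝓝 z] G) : HasLead k G z c := by
  obtain ⟨φ, h1, h2, h3⟩ := hF
  exact ⟨φ, h1, by filter_upwards [h2, h] with ζ a b; rw [← b, a], h3⟩

theorem HasLead.analyticAt (hF : HasLead k F z c) : AnalyticAt ℂ F z := by
  obtain ⟨φ, h1, h2, -⟩ := hF
  refine AnalyticAt.congr (f := fun ζ => (ζ - z) ^ k • φ ζ) (by fun_prop) ?_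
  filter_upwards [h2] with ζ hζ using hζ.symm

theorem hasLead_zero (hF : AnalyticAt ℂ F z) : HasLead 0 F z (F z) :=
  ⟨F, hF, by simp, rfl⟩

theorem HasLead.tendsto (hF : HasLead k F z c) :
    Tendsto (fun δ : ℂ => (1 / δ ^ k) • F (z + δ)) (𝓝[≠] 0) (𝓝 c) := by
  obtain ⟨φ, h1, h2, rfl⟩ := hF
  have hc : Tendsto (fun δ : ℂ => z + δ) (𝓝 0) (𝓝 z) := by
    have : Continuous fun δ : ℂ => z + δ := by fun_prop
    simpa using this.tendsto 0
  have ht : Tendsto (fun δ : ℂ => φ (z + δ)) (𝓝[≠] 0) (𝓝 (φ z)) :=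
    (h1.continuousAt.tendsto.comp hc).mono_left nhdsWithin_le_nhds
  refine ht.congr' ?_
  filter_upwards [(hc.eventually h2).filter_mono nhdsWithin_le_nhds, self_mem_nhdsWithin]
    with δ hδ h0
  have : δ ≠ 0 := h0
  rw [hδ, smul_smul]
  simp [this]

theorem HasLead.isBigO (hF : HasLead k F z c) : F =O[𝓝 z] fun ζ => (ζ - z) ^ k := by
  obtain ⟨φ, h1, h2, -⟩ := hF
  have h4 : (fun ζ => (ζ - z) ^ k • φ ζ) =O[𝓝 z] fun ζ => (ζ - z) ^ k • (1 : ℂ) :=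
    (Asymptotics.isBigO_refl _ _).smul (h1.continuousAt.isBigO_one ℂ)
  refine (EventuallyEq.trans_isBigO h2 h4).congr_right ?_
  simp

/-- The value `c` in `HasLead` may be zero, so `k` only bounds the order of vanishing from below;
when `c = 0` a further factor ζ - z splits off. This is how the order grows along a block. -/
theorem HasLead.succ [CompleteSpace E] (hF : HasLead k F z 0) : ∃ c, HasLead (k + 1) F z c := by
  obtain ⟨φ, h1, h2, h3⟩ := hF
  have h4 : ((1 : ℕ) : ℕ∞) ≤ analyticOrderAt φ z := by
    have := (analyticOrderAt_ne_zero (f := φ) (z₀ := z)).2 ⟨h1, h3⟩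
    exact_mod_cast Order.one_le_iff_pos.2 (pos_iff_ne_zero.2 this)
  obtain ⟨g, hg, hg2⟩ := (natCast_le_analyticOrderAt h1).1 h4
  refine ⟨g z, g, hg, ?_, rfl⟩
  filter_upwards [h2, hg2] with ζ a b
  rw [a, b, smul_smul, pow_one, pow_succ]

theorem HasLead.smul {f : ℂ → ℂ} (hf : AnalyticAt ℂ f z) (hF : HasLead k F z c) :
    HasLead k (fun ζ => f ζ • F ζ) z (f z • c) := by
  obtain ⟨φ, h1, h2, h3⟩ := hF
  refine ⟨fun ζ => f ζ • φ ζ, by fun_prop, ?_, by simp [h3]⟩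
  filter_upwards [h2] with ζ hζ
  rw [hζ, smul_comm]

end Lead

theorem HasLead.apply {k : ℕ} {F : ℂ → Fin 2 → ℂ} {z : ℂ} {c : Fin 2 → ℂ} (hF : HasLead k F z c)
    (a : Fin 2) : HasLead k (fun ζ => F ζ a) z (c a) := by
  obtain ⟨φ, h1, h2, h3⟩ := hF
  refine ⟨fun ζ => φ ζ a, analyticAt_pi_iff.1 h1 a, ?_, congrFun h3 a⟩
  filter_upwards [h2] with ζ hζ
  rw [hζ, Pi.smul_apply]

theorem HasLead.mulVec {k : ℕ} {F : ℂ → Fin 2 → ℂ} {z : ℂ} {c : Fin 2 → ℂ}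
    {M : ℂ → Matrix (Fin 2) (Fin 2) ℂ} (hM : ∀ a b, AnalyticAt ℂ (fun ζ => M ζ a b) z)
    (hF : HasLead k F z c) : HasLead k (fun ζ => (M ζ).mulVec (F ζ)) z ((M z).mulVec c) := by
  obtain ⟨φ, h1, h2, h3⟩ := hF
  refine ⟨fun ζ => (M ζ).mulVec (φ ζ), ?_, ?_, congrArg (M z).mulVec h3⟩
  · refine analyticAt_pi_iff.2 fun a => ?_
    simp only [Matrix.mulVec, dotProduct]
    exact Finset.analyticAt_fun_sum _ fun b _ => (hM a b).mul (analyticAt_pi_iff.1 h1 b)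
  · filter_upwards [h2] with ζ hζ
    rw [hζ, Matrix.mulVec_smul]

theorem iteratedDeriv_pi_apply {φ : ℂ → Fin 2 → ℂ} {z : ℂ} (hφ : AnalyticAt ℂ φ z) (k : ℕ)
    (a : Fin 2) : iteratedDeriv k φ z a = iteratedDeriv k (fun ζ => φ ζ a) z := by
  induction k generalizing z with
  | zero => simp
  | succ k ih =>
    rw [iteratedDeriv_succ, iteratedDeriv_succ]
    have hd : DifferentiableAt ℂ (iteratedDeriv k φ) z := by
      rw [iteratedDeriv_eq_iterate]
      exact (hφ.iterated_deriv k).differentiableAt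
    have h1 : HasDerivAt (fun ζ => iteratedDeriv k φ ζ a) (deriv (iteratedDeriv k φ) z a) z :=
      hasDerivAt_pi.1 hd.hasDerivAt a
    rw [← h1.deriv]
    refine EventuallyEq.deriv_eq ?_
    filter_upwards [hφ.eventually_analyticAt] with ζ hζ using ih hζ

theorem taylorCoeff_apply {φ : ℂ → Fin 2 → ℂ} {z : ℂ} (hφ : AnalyticAt ℂ φ z) (k : ℕ)
    (a : Fin 2) : taylorCoeff k φ z a = taylorCoeff k (fun ζ => φ ζ a) z := by
  simp [taylorCoeff, iteratedDeriv_pi_apply hφ]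

theorem taylorCoeff_mul {f g : ℂ → ℂ} {z : ℂ} (hf : AnalyticAt ℂ f z) (hg : AnalyticAt ℂ g z)
    (n : ℕ) : taylorCoeff n (fun ζ => f ζ * g ζ) z =
      ∑ i ∈ Finset.range (n + 1), taylorCoeff i f z * taylorCoeff (n - i) g z := by
  have := iteratedDeriv_fun_mul (n := n) hf.contDiffAt hg.contDiffAt
  rw [taylorCoeff, this, Finset.smul_sum]
  refine Finset.sum_congr rfl fun i hi => ?_
  have hi' : i ≤ n := by simpa [Nat.lt_succ_iff] using hi
  have h1 := Nat.choose_mul_factorial_mul_factorial hi'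
  have h2 : ((n.choose i : ℂ) * i.factorial * (n - i).factorial) = n.factorial := by
    exact_mod_cast h1
  have ha : (i.factorial : ℂ) ≠ 0 := by exact_mod_cast i.factorial_ne_zero
  have hb : ((n - i).factorial : ℂ) ≠ 0 := by exact_mod_cast (n - i).factorial_ne_zero
  have hc : (n.factorial : ℂ) ≠ 0 := by exact_mod_cast n.factorial_ne_zero
  simp only [taylorCoeff, smul_eq_mul]
  field_simp
  linear_combination (iteratedDeriv i f z * iteratedDeriv (n - i) g z) * h2

theorem taylorCoeff_pow_sub (k i : ℕ) (z : ℂ) :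
    taylorCoeff i (fun ζ => (ζ - z) ^ k) z = if i = k then 1 else 0 := by
  have h := congrFun (iteratedDeriv_comp_sub_const i (fun ζ : ℂ => ζ ^ k) z) z
  rw [taylorCoeff]
  rw [h, sub_self, iteratedDeriv_fun_pow_zero]
  split_ifs with hik
  · subst hik
    simp [Nat.factorial_ne_zero]
  · simp

theorem taylorCoeff_eq_of_hasLead {k : ℕ} {F : ℂ → ℂ} {z c : ℂ} (hF : HasLead k F z c) :
    taylorCoeff k F z = c := by
  obtain ⟨φ, h1, h2, h3⟩ := hF
  rw [taylorCoeff_congr (G := fun ζ => (ζ - z) ^ k * φ ζ) h2, taylorCoeff_mul (by fun_prop) h1]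
  simp only [taylorCoeff_pow_sub]
  simp [taylorCoeff, h3]

theorem taylorCoeff_eq_zero_of_hasLead {k l : ℕ} (hl : l < k) {F : ℂ → ℂ} {z c : ℂ}
    (hF : HasLead k F z c) : taylorCoeff l F z = 0 := by
  obtain ⟨φ, h1, h2, h3⟩ := hF
  rw [taylorCoeff_congr (G := fun ζ => (ζ - z) ^ k * φ ζ) h2, taylorCoeff_mul (by fun_prop) h1]
  refine Finset.sum_eq_zero fun i hi => ?_
  have : i ≠ k := by
    have := Finset.mem_range.1 hi
    omega
  simp [taylorCoeff_pow_sub, this]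

theorem taylorCoeff_vec_eq_of_hasLead {k : ℕ} {F : ℂ → Fin 2 → ℂ} {z : ℂ} {c : Fin 2 → ℂ}
    (hF : HasLead k F z c) : taylorCoeff k F z = c := by
  ext a
  rw [taylorCoeff_apply hF.analyticAt, taylorCoeff_eq_of_hasLead (hF.apply a)]

theorem taylorCoeff_sum {ι : Type*} (s : Finset ι) {f : ι → ℂ → ℂ} {z : ℂ}
    (hf : ∀ i ∈ s, AnalyticAt ℂ (f i) z) (k : ℕ) :
    taylorCoeff k (fun ζ => ∑ i ∈ s, f i ζ) z = ∑ i ∈ s, taylorCoeff k (f i) z := by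
  simp only [taylorCoeff]
  rw [iteratedDeriv_fun_sum fun i hi => (hf i hi).contDiffAt, Finset.smul_sum]

theorem taylorCoeff_const_mul (a : ℂ) (f : ℂ → ℂ) (z : ℂ) (k : ℕ) :
    taylorCoeff k (fun ζ => a * f ζ) z = a * taylorCoeff k f z := by
  simp only [taylorCoeff, iteratedDeriv_const_mul_field, smul_eq_mul]
  ring

theorem taylorCoeff_add {f g : ℂ → ℂ} {z : ℂ} (hf : AnalyticAt ℂ f z) (hg : AnalyticAt ℂ g z)
    (k : ℕ) :
    taylorCoeff k (fun ζ => f ζ + g ζ) z = taylorCoeff k f z + taylorCoeff k g z := by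
  simp only [taylorCoeff]
  rw [← smul_add, ← iteratedDeriv_add hf.contDiffAt hg.contDiffAt]
  rfl

theorem taylorCoeff_mulVec {M : ℂ → Matrix (Fin 2) (Fin 2) ℂ} {φ : ℂ → Fin 2 → ℂ} {z : ℂ}
    (hM : ∀ a b, AnalyticAt ℂ (fun ζ => M ζ a b) z) (hφ : AnalyticAt ℂ φ z)
    {c : ℕ → Matrix (Fin 2) (Fin 2) ℂ}
    (hc : ∀ i a b, taylorCoeff i (fun ζ => M ζ a b) z = c i a b) (n : ℕ) :
    taylorCoeff n (fun ζ => (M ζ).mulVec (φ ζ)) z =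
      ∑ i ∈ Finset.range (n + 1), (c i).mulVec (taylorCoeff (n - i) φ z) := by
  have hφ' := fun a => analyticAt_pi_iff.1 hφ a
  have hMφ : AnalyticAt ℂ (fun ζ => (M ζ).mulVec (φ ζ)) z :=
    ((hasLead_zero hφ).mulVec hM).analyticAt
  ext a
  rw [taylorCoeff_apply hMφ]
  simp only [Matrix.mulVec, dotProduct]
  rw [taylorCoeff_sum (f := fun b ζ => M ζ a b * φ ζ b) _ fun b _ => (hM a b).mul (hφ' b)]
  simp only [Finset.sum_apply, Matrix.mulVec, dotProduct]
  rw [Finset.sum_comm]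
  refine Finset.sum_congr rfl fun b _ => ?_
  rw [taylorCoeff_mul (hM a b) (hφ' b)]
  refine Finset.sum_congr rfl fun i _ => ?_
  rw [hc, taylorCoeff_apply hφ]

/-! ### The seeds as leading coefficients -/

theorem sigma3_conj (A : Matrix (Fin 2) (Fin 2) ℂ) :
    sigma3 * A * sigma3 = !![A 0 0, -A 0 1; -A 1 0, A 1 1] := by
  ext i j
  fin_cases i <;> fin_cases j <;>
    simp [sigma3, Matrix.mul_apply, Matrix.vecMul, dotProduct, Fin.sum_univ_two]

/-- Conjugation by σ₃ flips the sign of the off-diagonal entries, so the two poles combine into a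
numerator whose diagonal is even and whose off-diagonal part is odd in ζ. -/
theorem Step.T_eq (s : Step) {ζ : ℂ} (h : ζ ^ 2 ≠ s.nu ^ 2) :
    s.T ζ = (1 / (ζ ^ 2 - s.nu ^ 2)) •
      !![ζ ^ 2 + (2 * s.nu * s.A 0 0 - s.nu ^ 2), ζ * (2 * s.A 0 1);
        ζ * (2 * s.A 1 0), ζ ^ 2 + (2 * s.nu * s.A 1 1 - s.nu ^ 2)] := by
  have h0 : ζ ^ 2 - s.nu ^ 2 ≠ 0 := sub_ne_zero.2 h
  have h12 : (ζ - s.nu) * (ζ + s.nu) ≠ 0 := by convert h0 using 1; ring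
  have h1 := left_ne_zero_of_mul h12
  have h2 := right_ne_zero_of_mul h12
  have e : ζ ^ 2 - s.nu ^ 2 = (ζ - s.nu) * (ζ + s.nu) := by ring
  rw [Step.T, sigma3_conj, e]
  ext i j
  fin_cases i <;> fin_cases j <;> simp <;> field_simp <;> ring

/-- The numerator of `T(ζ)`, normalized at `z`, as a polynomial in `ζ - z`. -/
def Step.polyT (s : Step) (z ζ : ℂ) : Matrix (Fin 2) (Fin 2) ℂ :=
  ∑ d : Fin 3, (ζ - z) ^ (d : ℕ) • s.M z d

/-- The matrices `M` are the Taylor coefficients at z of the numerator of `T`, divided by the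
constant z² - ν². The numerator is quadratic in ζ, which is why δ runs over 0, 1, 2 only. -/
theorem Step.polyT_eq (s : Step) {z ζ : ℂ} (hz : z ^ 2 ≠ s.nu ^ 2) (h : ζ ^ 2 ≠ s.nu ^ 2) :
    s.polyT z ζ = ((ζ ^ 2 - s.nu ^ 2) / (z ^ 2 - s.nu ^ 2)) • s.T ζ := by
  have h0 : ζ ^ 2 - s.nu ^ 2 ≠ 0 := sub_ne_zero.2 h
  have h1 : z ^ 2 - s.nu ^ 2 ≠ 0 := sub_ne_zero.2 hz
  rw [Step.polyT, Fin.sum_univ_three]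
  simp only [Step.M, Matrix.cons_val_zero, Matrix.cons_val_one, Matrix.cons_val]
  rw [s.T_eq h, s.T_eq hz, sigma3_conj]
  ext i j
  fin_cases i <;> fin_cases j <;> simp <;> field_simp <;> ring

/-- The product of the normalized numerators over a history. -/
def polyProd (L : List Step) (z ζ : ℂ) : Matrix (Fin 2) (Fin 2) ℂ :=
  (L.map fun s => s.polyT z ζ).prod

/-- The ratio between the normalized numerator and the product `T_k ⋯ T_1`. -/
def polyNorm (L : List Step) (z ζ : ℂ) : ℂ :=
  (L.map fun s => (ζ ^ 2 - s.nu ^ 2) / (z ^ 2 - s.nu ^ 2)).prod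

theorem prodT_cons (s : Step) (L : List Step) (ζ : ℂ) :
    prodT (s :: L) ζ = s.T ζ * prodT L ζ := by
  simp [prodT]

theorem prodTinv_cons (s : Step) (L : List Step) (ζ : ℂ) :
    prodTinv (s :: L) ζ = prodTinv L ζ * s.Tinv ζ := by
  simp [prodTinv]

theorem polyProd_eq {L : List Step} {z ζ : ℂ} (hz : ∀ s ∈ L, z ^ 2 ≠ s.nu ^ 2)
    (h : ∀ s ∈ L, ζ ^ 2 ≠ s.nu ^ 2) : polyProd L z ζ = polyNorm L z ζ • prodT L ζ := by
  induction L with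
  | nil => simp [polyProd, polyNorm, prodT]
  | cons s L ih =>
    have ih' := ih (fun t ht => hz t (by simp [ht])) (fun t ht => h t (by simp [ht]))
    rw [prodT_cons]
    simp only [polyProd, polyNorm, List.map_cons, List.prod_cons] at ih' ⊢
    rw [ih', s.polyT_eq (hz s (by simp)) (h s (by simp)), smul_mul_smul_comm]

theorem polyNorm_self {L : List Step} {z : ℂ} (hz : ∀ s ∈ L, z ^ 2 ≠ s.nu ^ 2) :
    polyNorm L z z = 1 := by
  refine List.prod_eq_one fun x hx => ?_
  obtain ⟨s, hs, rfl⟩ := List.mem_map.1 hx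
  exact div_self (sub_ne_zero.2 (hz s hs))

theorem analyticAt_polyNorm (L : List Step) (z w : ℂ) : AnalyticAt ℂ (polyNorm L z) w := by
  induction L with
  | nil => exact analyticAt_const (v := (1 : ℂ))
  | cons s L ih =>
    have : polyNorm (s :: L) z =
        fun ζ => (ζ ^ 2 - s.nu ^ 2) / (z ^ 2 - s.nu ^ 2) * polyNorm L z ζ := by
      funext ζ; simp [polyNorm]
    rw [this]
    fun_prop

theorem Omega_nil (z : ℂ) (l : ℕ) : Omega [] z l = if l = 0 then 1 else 0 := by
  simp [Omega, eq_comm]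

/-- Separating the choice of δ for the newest step turns the sum over all choices into a Cauchy
product, the rule obeyed by Taylor coefficients of a product. -/
theorem Omega_cons (s : Step) (L : List Step) (z : ℂ) (l : ℕ) :
    Omega (s :: L) z l = ∑ i ∈ Finset.range (l + 1),
      (∑ d : Fin 3, if i = (d : ℕ) then s.M z d else 0) * Omega L z (l - i) := by
  have hR : ∀ i ∈ Finset.range (l + 1),
      (∑ d : Fin 3, if i = (d : ℕ) then s.M z d else 0) * Omega L z (l - i) =
      ∑ d : Fin 3, if i = (d : ℕ) then s.M z d * Omega L z (l - d) else 0 := by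
    intro i _
    rw [Finset.sum_mul]
    refine Finset.sum_congr rfl fun d _ => ?_
    split_ifs with h
    · rw [h]
    · simp
  rw [Finset.sum_congr rfl hR, Finset.sum_comm]
  simp only [Finset.sum_ite_eq', Finset.mem_range]
  have hO : Omega (s :: L) z l = ∑ d : Fin (L.length + 1) → Fin 3,
      if ∑ k, (d k : ℕ) = l then (List.ofFn fun k => ((s :: L).get k).M z (d k)).prod else 0 := rfl
  rw [hO, ← (Fin.consEquiv (n := L.length) fun _ => Fin 3).sum_comp, Fintype.sum_prod_type]
  simp only [Omega]
  refine Finset.sum_congr rfl fun d _ => ?_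
  split_ifs with hd
  · rw [Finset.mul_sum]
    refine Finset.sum_congr rfl fun e _ => ?_
    simp only [Fin.consEquiv_apply, List.length_cons, Fin.sum_univ_succ, Fin.cons_zero,
      Fin.cons_succ, List.ofFn_succ, List.prod_cons]
    have : ((d : ℕ) + ∑ k, (e k : ℕ) = l) ↔ (∑ k, (e k : ℕ) = l - d) := by omega
    by_cases h : ∑ k, (e k : ℕ) = l - d
    · rw [if_pos h, if_pos (this.2 h)]
      rfl
    · rw [if_neg h, if_neg (fun h' => h (this.1 h')), mul_zero]
  · refine Finset.sum_eq_zero fun e _ => if_neg ?_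
    simp only [Fin.consEquiv_apply, Fin.sum_univ_succ, Fin.cons_zero]
    omega

theorem analyticAt_polyT (s : Step) (z w : ℂ) (a b : Fin 2) :
    AnalyticAt ℂ (fun ζ => s.polyT z ζ a b) w := by
  simp only [Step.polyT, Matrix.sum_apply, Matrix.smul_apply]
  fun_prop

theorem analyticAt_matrix_mul {M N : ℂ → Matrix (Fin 2) (Fin 2) ℂ} {w : ℂ}
    (hM : ∀ a b, AnalyticAt ℂ (fun ζ => M ζ a b) w)
    (hN : ∀ a b, AnalyticAt ℂ (fun ζ => N ζ a b) w) (a b : Fin 2) :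
    AnalyticAt ℂ (fun ζ => (M ζ * N ζ) a b) w := by
  simp only [Matrix.mul_apply]
  exact Finset.analyticAt_fun_sum _ fun c _ => (hM a c).mul (hN c b)

theorem analyticAt_polyProd (L : List Step) (z w : ℂ) (a b : Fin 2) :
    AnalyticAt ℂ (fun ζ => polyProd L z ζ a b) w := by
  induction L generalizing a b with
  | nil => simpa [polyProd] using analyticAt_const
  | cons s L ih =>
    simp only [polyProd, List.map_cons, List.prod_cons]
    exact analyticAt_matrix_mul (analyticAt_polyT s z w) ih a b

theorem taylorCoeff_polyT (s : Step) (z : ℂ) (i : ℕ) (a b : Fin 2) :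
    taylorCoeff i (fun ζ => s.polyT z ζ a b) z =
      (∑ d : Fin 3, if i = (d : ℕ) then s.M z d else 0) a b := by
  simp only [Step.polyT, Matrix.sum_apply, Matrix.smul_apply, smul_eq_mul]
  rw [taylorCoeff_sum (f := fun (d : Fin 3) ζ => (ζ - z) ^ (d : ℕ) * s.M z d a b) _
    (fun d _ => by fun_prop)]
  refine Finset.sum_congr rfl fun d _ => ?_
  simp only [mul_comm _ (s.M z d a b)]
  rw [taylorCoeff_const_mul, taylorCoeff_pow_sub]
  split_ifs <;> simp

/-- Both sides satisfy the same Cauchy recursion along the history, by `Omega_cons` and the Leibniz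
rule. -/
theorem taylorCoeff_polyProd (L : List Step) (z : ℂ) (i : ℕ) (a b : Fin 2) :
    taylorCoeff i (fun ζ => polyProd L z ζ a b) z = Omega L z i a b := by
  induction L generalizing i a b with
  | nil =>
    have := taylorCoeff_pow_sub 0 i z
    rw [Omega_nil]
    simp only [polyProd, List.map_nil, List.prod_nil]
    simp only [pow_zero] at this
    have h2 := taylorCoeff_const_mul ((1 : Matrix (Fin 2) (Fin 2) ℂ) a b) (fun _ => 1) z i
    simp only [mul_one] at h2
    rw [h2, this]
    split_ifs <;> simp
  | cons s L ih =>
    have hL := fun c d => analyticAt_polyProd L z z c d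
    have hs := fun c d => analyticAt_polyT s z z c d
    have e : (fun ζ => polyProd (s :: L) z ζ a b) =
        fun ζ => ∑ c, s.polyT z ζ a c * polyProd L z ζ c b := by
      funext ζ
      simp only [polyProd, List.map_cons, List.prod_cons, Matrix.mul_apply]
    rw [e, taylorCoeff_sum (f := fun c ζ => s.polyT z ζ a c * polyProd L z ζ c b) _
      fun c _ => (hs a c).mul (hL c b), Omega_cons, Matrix.sum_apply]
    simp only [Matrix.mul_apply]
    rw [Finset.sum_comm]
    refine Finset.sum_congr rfl fun c _ => ?_
    rw [taylorCoeff_mul (hs a c) (hL c b)]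
    refine Finset.sum_congr rfl fun j _ => ?_
    rw [taylorCoeff_polyT, ih]

theorem seedCol_eq_taylorCoeff (L : List Step) {z : ℂ} {φ : ℂ → Fin 2 → ℂ}
    (hφ : AnalyticAt ℂ φ z) (j : ℕ) :
    seedCol L z φ j = taylorCoeff j (fun ζ => (polyProd L z ζ).mulVec (φ ζ)) z := by
  rw [taylorCoeff_mulVec (analyticAt_polyProd L z z) hφ (taylorCoeff_polyProd L z)]
  simp [seedCol, taylorCoeff, Matrix.mulVec_smul]

theorem eventually_sq_ne {L : List Step} {z : ℂ} (hz : ∀ s ∈ L, z ^ 2 ≠ s.nu ^ 2) :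
    ∀ᶠ ζ in 𝓝 z, ∀ s ∈ L, ζ ^ 2 ≠ s.nu ^ 2 := by
  induction L with
  | nil => simp
  | cons s L ih =>
    have h1 : ∀ᶠ ζ in 𝓝 z, ζ ^ 2 ≠ s.nu ^ 2 :=
      ((continuous_pow 2).continuousAt).eventually_ne (hz s (by simp))
    filter_upwards [h1, ih fun t ht => hz t (by simp [ht])] with ζ a b
    simpa using ⟨a, b⟩

/-- The seed is a Taylor coefficient of the normalized product `polyProd`, not of `prodT`. The two
differ by the scalar factor `polyNorm`, which equals 1 at z; since all coefficients below order j
vanish, the coefficient of order j sees only that value. -/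
theorem seedCol_of_hasLead {L : List Step} {z : ℂ} {φ : ℂ → Fin 2 → ℂ} {j : ℕ} {c : Fin 2 → ℂ}
    (hz : ∀ s ∈ L, z ^ 2 ≠ s.nu ^ 2) (hφ : AnalyticAt ℂ φ z)
    (hc : HasLead j (fun ζ => (prodT L ζ).mulVec (φ ζ)) z c) : seedCol L z φ j = c := by
  rw [seedCol_eq_taylorCoeff L hφ]
  have h1 := hc.smul (analyticAt_polyNorm L z z)
  rw [polyNorm_self hz, one_smul] at h1
  refine taylorCoeff_vec_eq_of_hasLead (h1.congr ?_)
  filter_upwards [eventually_sq_ne hz] with ζ hζ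
  rw [polyProd_eq hz hζ, Matrix.smul_mulVec]

/-! ### Duality between columns and rows -/

/-- The dual step, for which the roles of rows and columns are exchanged. -/
def Step.swap (s : Step) : Step := ⟨s.nu, s.mu, s.B.transpose, s.A.transpose⟩

theorem sigma3_transpose : sigma3.transpose = sigma3 := by
  ext i j
  fin_cases i <;> fin_cases j <;> simp [sigma3]

theorem Step.swap_T (s : Step) (ζ : ℂ) : s.swap.T ζ = (s.Tinv ζ).transpose := by
  simp [Step.T, Step.Tinv, Step.swap, sigma3_transpose, Matrix.mul_assoc]

theorem Step.swap_M (s : Step) (z : ℂ) (d : Fin 3) : s.swap.M z d = (s.N z d).transpose := by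
  fin_cases d
  · simpa [Step.M, Step.N] using s.swap_T z
  · simp [Step.M, Step.N, Step.swap, sigma3_transpose, Matrix.mul_assoc]
  · simp [Step.M, Step.N, Step.swap]

theorem prodT_swap (L : List Step) (ζ : ℂ) :
    prodT (L.map Step.swap) ζ = (prodTinv L ζ).transpose := by
  induction L with
  | nil => simp [prodT, prodTinv]
  | cons s L ih => rw [List.map_cons, prodT_cons, prodTinv_cons, Matrix.transpose_mul, ih, s.swap_T]

theorem Omega_swap (L : List Step) (z : ℂ) (l : ℕ) :
    Omega (L.map Step.swap) z l = (Lambda L z l).transpose := by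
  have hlen : (L.map Step.swap).length = L.length := by simp
  -- The swapped history is replaced by an arbitrary list of the same length with corresponding
  -- entries, so that the two index types are identified by `Fin.cast` without rewriting inside
  -- dependent types.
  have key : ∀ (L' : List Step) (h : L'.length = L.length)
      (_ : ∀ k : Fin L'.length, L'.get k = (L.get (Fin.cast h k)).swap),
      Omega L' z l = (Lambda L z l).transpose := by
    intro L' h hk
    rw [Omega, Lambda, Matrix.transpose_sum]
    rw [← (Equiv.arrowCongr (finCongr h) (Equiv.refl (Fin 3))).symm.sum_comp]
    refine Finset.sum_congr rfl fun d _ => ?_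
    have hs : ∑ k : Fin L'.length, (((Equiv.arrowCongr (finCongr h) (Equiv.refl (Fin 3))).symm d k :
        Fin 3) : ℕ) = ∑ k, (d k : ℕ) :=
      (finCongr h).sum_comp fun k => (d k : ℕ)
    rw [hs]
    split_ifs
    · rw [Matrix.transpose_list_prod, List.map_reverse, List.reverse_reverse, List.map_ofFn]
      congr 1
      rw [List.ofFn_congr h]
      congr 1
      funext k
      rw [hk, Step.swap_M]
      rfl
    · simp
  exact key _ hlen fun k => by simp

theorem seedCol_swap (L : List Step) (z : ℂ) (ψ : ℂ → Fin 2 → ℂ) (j : ℕ) :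
    seedCol (L.map Step.swap) z ψ j = seedRow L z ψ j := by
  simp only [seedCol, seedRow, Omega_swap, Matrix.mulVec_transpose]

theorem alphaInv_swap (μ ν : ℂ) (f g : Fin 2 → ℂ) : alphaInv ν μ g f = betaInv μ ν f g := by
  simp [alphaInv, betaInv, Matrix.mulVec, dotProduct, Matrix.diagonal]
  ring

/-- Transposition exchanges row and column, hence μ with ν and α with β. The definition of B is made
so that this gives exactly the residue A of the dual step. -/
theorem binaryStep_swap (μ ν : ℂ) (f g : Fin 2 → ℂ) :
    (binaryStep μ ν f g).swap = binaryStep ν μ g f := by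
  have h : betaInv ν μ g f = alphaInv μ ν f g := (alphaInv_swap ν μ g f).symm
  have h' : alphaInv ν μ g f = betaInv μ ν f g := alphaInv_swap μ ν f g
  simp only [binaryStep, Step.swap, h', h,
    Matrix.transpose_smul, Matrix.transpose_mul, Matrix.diagonal_transpose,
    Matrix.transpose_vecMulVec]

theorem addSteps_swap (μ ν : ℂ) (φ ψ : ℂ → Fin 2 → ℂ) (L : List Step) (k : ℕ) :
    (addSteps μ ν φ ψ L k).map Step.swap = addSteps ν μ ψ φ (L.map Step.swap) k := by
  induction k with
  | zero => rfl
  | succ k ih =>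
    have hinv : ∀ L : List Step, (L.map Step.swap).map Step.swap = L := by
      intro L; simp [Function.comp_def, Step.swap]
    simp only [addSteps, List.map_cons, binaryStep_swap, ← ih, seedCol_swap]
    rw [← seedCol_swap ((addSteps μ ν φ ψ L k).map Step.swap), hinv]

/-! ### Algebra of one binary step -/

section StepAlgebra

variable {K : Type*} [Field K] {f1 f2 g1 g2 u v m n ux vx D1 D2 : K}

/-- This algebra is free of the imaginary unit: u and v stand for -i times the fields, and primed
seeds for derivatives divided by i. Exchanging the two components while reversing the sign of i
gives the identity for the other field, so each lemma of this section is used twice. -/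
theorem step_field_algebraic [CharZero K] (hm : m ≠ 0) (hn : n ≠ 0) (h1 : D1 ≠ 0) (h2 : D2 ≠ 0)
    (hD1 : D1 = n * g1 * f1 + m * g2 * f2) (hD2 : D2 = m * g1 * f1 + n * g2 * f2)
    {f1' f2' g1' g2' u' P R β : K}
    (hf1 : f1' = -f1 / m ^ 2 + u * f2 / m) (hf2 : f2' = f2 / m ^ 2 + v * f1 / m)
    (hg1 : g1' = g1 / n ^ 2 - v * g2 / n) (hg2 : g2' = -g2 / n ^ 2 - u * g1 / n)
    (hβ : β = (n ^ 2 - m ^ 2) * (f1 * g2) / D1)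
    (hP : P = -(m * n) * D2 / D1) (hR : R = -(m * n) * D1 / D2)
    (hu' : u' = u + (n ^ 2 - m ^ 2) * ((f1' * g2 + f1 * g2') * D1
      - f1 * g2 * (n * (g1' * f1 + g1 * f1') + m * (g2' * f2 + g2 * f2'))) / D1 ^ 2) :
    u' * R = u * P + 2 * β := by
  rw [hu', hβ, hP, hR, hf1, hf2, hg1, hg2]
  field_simp
  subst hD1 hD2
  ring

theorem step_diag_x [CharZero K] (hm : m ≠ 0) (hn : n ≠ 0) (h1 : D1 ≠ 0) (h2 : D2 ≠ 0)
    (hD1 : D1 = n * g1 * f1 + m * g2 * f2) (hD2 : D2 = m * g1 * f1 + n * g2 * f2)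
    {f1' f2' g1' g2' u' P R β γ : K}
    (hf1 : f1' = -f1 / m ^ 2 + u * f2 / m) (hf2 : f2' = f2 / m ^ 2 + v * f1 / m)
    (hg1 : g1' = g1 / n ^ 2 - v * g2 / n) (hg2 : g2' = -g2 / n ^ 2 - u * g1 / n)
    (hβ : β = (n ^ 2 - m ^ 2) * (f1 * g2) / D1) (hγ : γ = (n ^ 2 - m ^ 2) * (f2 * g1) / D2)
    (hP : P = -(m * n) * D2 / D1) (hR : R = -(m * n) * D1 / D2)
    (hu' : u' * R = u * P + 2 * β) :
    -(m * n) * ((m * (g1' * f1 + g1 * f1') + n * (g2' * f2 + g2 * f2')) * D1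
      - D2 * (n * (g1' * f1 + g1 * f1') + m * (g2' * f2 + g2 * f2'))) / D1 ^ 2
      = u' * γ - β * v := by
  have hR0 : R ≠ 0 := by
    rw [hR]; exact div_ne_zero (mul_ne_zero (neg_ne_zero.2 (mul_ne_zero hm hn)) h1) h2
  -- Since R is nonzero, `hu'` determines the new field without derivatives, and the claim becomes a
  -- rational identity in f, g, u, v.
  have e1 : u' = (u * P + 2 * β) / R := by rw [← hu']; field_simp
  rw [e1, hβ, hγ, hP, hR, hf1, hf2, hg1, hg2]
  field_simp
  subst hD1 hD2
  ring

/-- Here `w'` and `q'` stand for the scaled product of the new fields and the scaled new flux. They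
are not expanded: `hu'`, `hw'`, `hq'` determine `u'`, `w'`, `q'` successively, because P and R are
nonzero, so no derivative of a new field enters the final rational identity. -/
theorem step_offDiag_t [CharZero K] (hm : m ≠ 0) (hn : n ≠ 0) (h1 : D1 ≠ 0) (h2 : D2 ≠ 0)
    (hD1 : D1 = n * g1 * f1 + m * g2 * f2) (hD2 : D2 = m * g1 * f1 + n * g2 * f2)
    {f1' f2' g1' g2' u' w' q' P R β γ : K}
    (hf1 : f1' = (-2 / m ^ 4 + u * v / m ^ 2) * f1
      + (2 * u / m ^ 3 - (u ^ 2 * v + ux) / m) * f2)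
    (hf2 : f2' = -(-2 / m ^ 4 + u * v / m ^ 2) * f2
      + (2 * v / m ^ 3 - (u * v ^ 2 - vx) / m) * f1)
    (hg1 : g1' = -(-2 / n ^ 4 + u * v / n ^ 2) * g1
      - (2 * v / n ^ 3 - (u * v ^ 2 - vx) / n) * g2)
    (hg2 : g2' = (-2 / n ^ 4 + u * v / n ^ 2) * g2
      - (2 * u / n ^ 3 - (u ^ 2 * v + ux) / n) * g1)
    (hβ : β = (n ^ 2 - m ^ 2) * (f1 * g2) / D1) (hγ : γ = (n ^ 2 - m ^ 2) * (f2 * g1) / D2)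
    (hP : P = -(m * n) * D2 / D1) (hR : R = -(m * n) * D1 / D2)
    (hu' : u' * R = u * P + 2 * β)
    (hw' : (w' - u * v) * P + 2 * u' * γ - 2 * β * v = 0)
    (hq' : (u * v + w') * β + 2 * (u' - u) - q' * R + (u ^ 2 * v + ux) * P = 0) :
    (n ^ 2 - m ^ 2) * ((f1' * g2 + f1 * g2') * D1
      - f1 * g2 * (n * (g1' * f1 + g1 * f1') + m * (g2' * f2 + g2 * f2'))) / D1 ^ 2
      = (u ^ 2 * v + ux) - q' := by
  have hR0 : R ≠ 0 := by
    rw [hR]; exact div_ne_zero (mul_ne_zero (neg_ne_zero.2 (mul_ne_zero hm hn)) h1) h2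
  have hP0 : P ≠ 0 := by
    rw [hP]; exact div_ne_zero (mul_ne_zero (neg_ne_zero.2 (mul_ne_zero hm hn)) h2) h1
  have e1 : u' = (u * P + 2 * β) / R := by rw [← hu']; field_simp
  have e2 : w' = u * v - (2 * u' * γ - 2 * β * v) / P := by
    field_simp; linear_combination hw'
  have e3 : q' = ((u * v + w') * β + 2 * (u' - u) + (u ^ 2 * v + ux) * P) / R := by
    field_simp; linear_combination -hq'
  rw [e3, e2, e1, hβ, hγ, hP, hR, hf1, hf2, hg1, hg2]
  field_simp
  subst hD1 hD2
  ring

theorem step_diag_t [CharZero K] (hm : m ≠ 0) (hn : n ≠ 0) (h1 : D1 ≠ 0) (h2 : D2 ≠ 0)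
    (hD1 : D1 = n * g1 * f1 + m * g2 * f2) (hD2 : D2 = m * g1 * f1 + n * g2 * f2)
    {f1' f2' g1' g2' u' w' q' P R β γ : K}
    (hf1 : f1' = (-2 / m ^ 4 + u * v / m ^ 2) * f1
      + (2 * u / m ^ 3 - (u ^ 2 * v + ux) / m) * f2)
    (hf2 : f2' = -(-2 / m ^ 4 + u * v / m ^ 2) * f2
      + (2 * v / m ^ 3 - (u * v ^ 2 - vx) / m) * f1)
    (hg1 : g1' = -(-2 / n ^ 4 + u * v / n ^ 2) * g1
      - (2 * v / n ^ 3 - (u * v ^ 2 - vx) / n) * g2)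
    (hg2 : g2' = (-2 / n ^ 4 + u * v / n ^ 2) * g2
      - (2 * u / n ^ 3 - (u ^ 2 * v + ux) / n) * g1)
    (hβ : β = (n ^ 2 - m ^ 2) * (f1 * g2) / D1) (hγ : γ = (n ^ 2 - m ^ 2) * (f2 * g1) / D2)
    (hP : P = -(m * n) * D2 / D1) (hR : R = -(m * n) * D1 / D2)
    (hu' : u' * R = u * P + 2 * β)
    (hw' : (w' - u * v) * P + 2 * u' * γ - 2 * β * v = 0)
    (hq' : (u * v + w') * β + 2 * (u' - u) - q' * R + (u ^ 2 * v + ux) * P = 0) :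
    -(m * n) * ((m * (g1' * f1 + g1 * f1') + n * (g2' * f2 + g2 * f2')) * D1
      - D2 * (n * (g1' * f1 + g1 * f1') + m * (g2' * f2 + g2 * f2'))) / D1 ^ 2
      = (w' - u * v) - q' * γ + β * (u * v ^ 2 - vx) := by
  have hR0 : R ≠ 0 := by
    rw [hR]; exact div_ne_zero (mul_ne_zero (neg_ne_zero.2 (mul_ne_zero hm hn)) h1) h2
  have hP0 : P ≠ 0 := by
    rw [hP]; exact div_ne_zero (mul_ne_zero (neg_ne_zero.2 (mul_ne_zero hm hn)) h2) h1
  have e1 : u' = (u * P + 2 * β) / R := by rw [← hu']; field_simp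
  have e2 : w' = u * v - (2 * u' * γ - 2 * β * v) / P := by
    field_simp; linear_combination hw'
  have e3 : q' = ((u * v + w') * β + 2 * (u' - u) + (u ^ 2 * v + ux) * P) / R := by
    field_simp; linear_combination -hq'
  rw [e3, e2, e1, hβ, hγ, hP, hR, hf1, hf2, hg1, hg2]
  field_simp
  subst hD1 hD2
  ring

/-- Relations between the diagonal and the off-diagonal coefficients of a binary step. -/
theorem step_diag_relations (h1 : D1 ≠ 0) (h2 : D2 ≠ 0)
    (hD1 : D1 = n * g1 * f1 + m * g2 * f2) (hD2 : D2 = m * g1 * f1 + n * g2 * f2)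
    {P R β γ : K}
    (hβ : β = (n ^ 2 - m ^ 2) * (f1 * g2) / D1) (hγ : γ = (n ^ 2 - m ^ 2) * (f2 * g1) / D2)
    (hP : P = -(m * n) * D2 / D1) (hR : R = -(m * n) * D1 / D2) :
    P * R = m ^ 2 * n ^ 2 ∧ P + R - β * γ = -(m ^ 2 + n ^ 2) := by
  rw [hβ, hγ, hP, hR]
  constructor
  · field_simp
  · field_simp
    subst hD1 hD2
    ring

end StepAlgebra

/-! ### Pointwise properties of one binary step -/

/-- The numerator of `T(ζ)`, that is `(ζ² - ν²) T(ζ)`. -/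
def Step.numT (s : Step) (ζ : ℂ) : Matrix (Fin 2) (Fin 2) ℂ :=
  !![ζ ^ 2 + (2 * s.nu * s.A 0 0 - s.nu ^ 2), ζ * (2 * s.A 0 1);
    ζ * (2 * s.A 1 0), ζ ^ 2 + (2 * s.nu * s.A 1 1 - s.nu ^ 2)]

theorem Step.T_eq_numT (s : Step) {ζ : ℂ} (h : ζ ^ 2 ≠ s.nu ^ 2) :
    s.T ζ = (1 / (ζ ^ 2 - s.nu ^ 2)) • s.numT ζ := s.T_eq h

theorem alphaInv_eq (μ ν : ℂ) (f g : Fin 2 → ℂ) :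
    alphaInv μ ν f g = ν * g 0 * f 0 + μ * g 1 * f 1 := by
  simp [alphaInv, Matrix.mulVec, dotProduct, Matrix.diagonal]
  ring

theorem betaInv_eq (μ ν : ℂ) (f g : Fin 2 → ℂ) :
    betaInv μ ν f g = μ * g 0 * f 0 + ν * g 1 * f 1 := by
  simp [betaInv, Matrix.mulVec, dotProduct, Matrix.diagonal]
  ring

section OneStep

variable {μ ν : ℂ} {f g : Fin 2 → ℂ}

theorem binaryStep_A01 :
    2 * (binaryStep μ ν f g).A 0 1 = (ν ^ 2 - μ ^ 2) * (f 0 * g 1) / alphaInv μ ν f g := by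
  simp [binaryStep, Matrix.vecMulVec_apply, Matrix.diagonal_mul]
  ring

theorem binaryStep_A10 :
    2 * (binaryStep μ ν f g).A 1 0 = (ν ^ 2 - μ ^ 2) * (f 1 * g 0) / betaInv μ ν f g := by
  simp [binaryStep, Matrix.vecMulVec_apply, Matrix.diagonal_mul]
  ring

/-- The numerator combines as (ν² - μ²)g₁f₁ - ν/α, which equals -μ/β up to the names of the
components. The diagonal coefficients P and R are thus inverse ratios of 1/α and 1/β times -μν, and
PR = μ²ν². -/
theorem binaryStep_A00 (h1 : alphaInv μ ν f g ≠ 0) :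
    2 * ν * (binaryStep μ ν f g).A 0 0 - ν ^ 2 =
      -(μ * ν) * betaInv μ ν f g / alphaInv μ ν f g := by
  have : 2 * ν * (binaryStep μ ν f g).A 0 0 =
      ν * (ν ^ 2 - μ ^ 2) * (f 0 * g 0) / alphaInv μ ν f g := by
    simp [binaryStep, Matrix.vecMulVec_apply, Matrix.diagonal_mul]
    ring
  rw [this]
  field_simp
  rw [alphaInv_eq, betaInv_eq]
  ring

theorem binaryStep_A11 (h2 : betaInv μ ν f g ≠ 0) :
    2 * ν * (binaryStep μ ν f g).A 1 1 - ν ^ 2 =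
      -(μ * ν) * alphaInv μ ν f g / betaInv μ ν f g := by
  have : 2 * ν * (binaryStep μ ν f g).A 1 1 =
      ν * (ν ^ 2 - μ ^ 2) * (f 1 * g 1) / betaInv μ ν f g := by
    simp [binaryStep, Matrix.vecMulVec_apply, Matrix.diagonal_mul]
    ring
  rw [this]
  field_simp
  rw [alphaInv_eq, betaInv_eq]
  ring

theorem binaryStep_B10 : (binaryStep μ ν f g).B 1 0 = -(binaryStep μ ν f g).A 1 0 := by
  simp [binaryStep, Matrix.vecMulVec_apply, Matrix.diagonal_mul, Matrix.mul_diagonal]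
  ring

/-- By duality `Tinv` is the transposed `T` of the swapped step, for which the closed forms of the
coefficients are known; exchanging α with β interchanges P and R and reverses the signs of β and γ,
as in the adjugate. -/
theorem binaryStep_Tinv_eq (h1 : alphaInv μ ν f g ≠ 0) (h2 : betaInv μ ν f g ≠ 0) {ζ : ℂ}
    (h : ζ ^ 2 ≠ μ ^ 2) :
    (binaryStep μ ν f g).Tinv ζ =
      (1 / (ζ ^ 2 - μ ^ 2)) • ((binaryStep μ ν f g).numT ζ).adjugate := by
  have h3 := (binaryStep μ ν f g).swap_T ζ
  have h4 : (binaryStep μ ν f g).Tinv ζ = ((binaryStep ν μ g f).T ζ).transpose := by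
    rw [← binaryStep_swap μ ν f g, h3, Matrix.transpose_transpose]
  have ha : alphaInv ν μ g f = betaInv μ ν f g := alphaInv_swap μ ν f g
  have hb : betaInv ν μ g f = alphaInv μ ν f g := (alphaInv_swap ν μ g f).symm
  have e00 := binaryStep_A00 (μ := ν) (ν := μ) (f := g) (g := f) (by rwa [ha])
  have e11 := binaryStep_A11 (μ := ν) (ν := μ) (f := g) (g := f) (by rwa [hb])
  have e01 := binaryStep_A01 (μ := ν) (ν := μ) (f := g) (g := f)
  have e10 := binaryStep_A10 (μ := ν) (ν := μ) (f := g) (g := f)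
  rw [h4, Step.T_eq_numT _ h, Matrix.transpose_smul]
  change (1 / (ζ ^ 2 - μ ^ 2)) • _ = _
  congr 1
  rw [Matrix.adjugate_fin_two]
  have hnu : (binaryStep ν μ g f).nu = μ := rfl
  have hnu' : (binaryStep μ ν f g).nu = ν := rfl
  simp only [Step.numT, hnu, hnu']
  rw [e00, e11, e01, e10, binaryStep_A00 h1, binaryStep_A11 h2, binaryStep_A01, binaryStep_A10,
    ha, hb]
  ext i j
  fin_cases i <;> fin_cases j <;> simp <;> ring

theorem binaryStep_det_numT (h1 : alphaInv μ ν f g ≠ 0) (h2 : betaInv μ ν f g ≠ 0) (ζ : ℂ) :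
    ((binaryStep μ ν f g).numT ζ).det = (ζ ^ 2 - μ ^ 2) * (ζ ^ 2 - ν ^ 2) := by
  have hnu' : (binaryStep μ ν f g).nu = ν := rfl
  obtain ⟨e1, e2⟩ := step_diag_relations h1 h2 (alphaInv_eq μ ν f g) (betaInv_eq μ ν f g)
    binaryStep_A01 binaryStep_A10 (binaryStep_A00 h1) (binaryStep_A11 h2)
  rw [Matrix.det_fin_two]
  simp only [Step.numT, hnu', Matrix.of_apply, Matrix.cons_val_zero, Matrix.cons_val_one,
    Matrix.cons_val', Matrix.cons_val_fin_one]
  -- The relations `e1` and `e2` compare the coefficients of ζ⁰ and ζ² in the determinant.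
  linear_combination e1 + ζ ^ 2 * e2

theorem binaryStep_det (h1 : alphaInv μ ν f g ≠ 0) (h2 : betaInv μ ν f g ≠ 0) {ζ : ℂ}
    (h : ζ ^ 2 ≠ ν ^ 2) :
    ((binaryStep μ ν f g).T ζ).det = (ζ ^ 2 - μ ^ 2) / (ζ ^ 2 - ν ^ 2) := by
  have hz := sub_ne_zero.2 h
  rw [Step.T_eq_numT _ h, Matrix.det_smul, binaryStep_det_numT h1 h2]
  change (1 / (ζ ^ 2 - ν ^ 2)) ^ _ * _ = _
  rw [Fintype.card_fin]
  field_simp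

theorem binaryStep_T_mul_Tinv (h1 : alphaInv μ ν f g ≠ 0) (h2 : betaInv μ ν f g ≠ 0) {ζ : ℂ}
    (h : ζ ^ 2 ≠ μ ^ 2) (h' : ζ ^ 2 ≠ ν ^ 2) :
    (binaryStep μ ν f g).T ζ * (binaryStep μ ν f g).Tinv ζ = 1 := by
  have hz := sub_ne_zero.2 h
  have hz' := sub_ne_zero.2 h'
  rw [Step.T_eq_numT _ h', binaryStep_Tinv_eq h1 h2 h, smul_mul_smul_comm, Matrix.mul_adjugate,
    binaryStep_det_numT h1 h2, smul_smul]
  change (1 / (ζ ^ 2 - ν ^ 2) * _ * _) • (1 : Matrix (Fin 2) (Fin 2) ℂ) = 1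
  have : 1 / (ζ ^ 2 - ν ^ 2) * (1 / (ζ ^ 2 - μ ^ 2)) * ((ζ ^ 2 - μ ^ 2) * (ζ ^ 2 - ν ^ 2)) = 1 := by
    field_simp
  rw [this, one_smul]

/-- Each component of the numerator applied to f cancels by the definitions of `alphaInv` and
`betaInv`. This annihilation raises the order of vanishing at repeated steps. -/
theorem binaryStep_T_mulVec_self (h1 : alphaInv μ ν f g ≠ 0) (h2 : betaInv μ ν f g ≠ 0)
    (h : μ ^ 2 ≠ ν ^ 2) : ((binaryStep μ ν f g).T μ).mulVec f = 0 := by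
  have hnu' : (binaryStep μ ν f g).nu = ν := rfl
  rw [Step.T_eq_numT _ h, Matrix.smul_mulVec]
  have : ((binaryStep μ ν f g).numT μ).mulVec f = 0 := by
    simp only [Step.numT, hnu']
    rw [binaryStep_A00 h1, binaryStep_A11 h2, binaryStep_A01, binaryStep_A10]
    ext i
    fin_cases i
    · simp only [Matrix.mulVec, dotProduct, Fin.sum_univ_two]
      simp
      field_simp
      rw [alphaInv_eq, betaInv_eq]
      ring
    · simp only [Matrix.mulVec, dotProduct, Fin.sum_univ_two]
      simp
      field_simp
      rw [alphaInv_eq, betaInv_eq]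
      ring
  rw [this, smul_zero]

end OneStep

/-! ### The transformation of the kernels -/

/-- The kernel on vectors: `kerP` for `ε = 1` and `kerQ` for `ε = -1`. -/
def vecKer (ε : ℂ) (x y : Fin 2 → ℂ) (a b : ℂ) : ℂ :=
  ε * (x 0 * y 0 - x 1 * y 1) / (b + a) - (x 0 * y 0 + x 1 * y 1) / (b - a)

theorem kerP_eq (g f : ℂ → Fin 2 → ℂ) (a b : ℂ) : kerP g f a b = vecKer 1 (g a) (f b) a b := by
  simp [kerP, vecKer, sigma3, dotProduct, Matrix.mulVec, Fin.sum_univ_two]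
  ring

theorem kerQ_eq (g f : ℂ → Fin 2 → ℂ) (a b : ℂ) : kerQ g f a b = vecKer (-1) (g a) (f b) a b := by
  simp [kerQ, vecKer, sigma3, dotProduct, Matrix.mulVec, Fin.sum_univ_two]
  ring

theorem sub_add_ne_zero_of_sq_ne {a b : ℂ} (h : b ^ 2 ≠ a ^ 2) : b - a ≠ 0 ∧ b + a ≠ 0 := by
  have h12 : (b - a) * (b + a) ≠ 0 := by
    convert sub_ne_zero.2 h using 1; ring
  exact ⟨left_ne_zero_of_mul h12, right_ne_zero_of_mul h12⟩

theorem vecKer_one (x y : Fin 2 → ℂ) {a b : ℂ} (h : b ^ 2 ≠ a ^ 2) :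
    vecKer 1 x y a b = -2 * (a * (x 0 * y 0) + b * (x 1 * y 1)) / (b ^ 2 - a ^ 2) := by
  obtain ⟨h1, h2⟩ := sub_add_ne_zero_of_sq_ne h
  have e : b ^ 2 - a ^ 2 = (b - a) * (b + a) := by ring
  rw [vecKer, e]
  field_simp
  ring

theorem vecKer_neg_one (x y : Fin 2 → ℂ) {a b : ℂ} (h : b ^ 2 ≠ a ^ 2) :
    vecKer (-1) x y a b = -2 * (b * (x 0 * y 0) + a * (x 1 * y 1)) / (b ^ 2 - a ^ 2) := by
  obtain ⟨h1, h2⟩ := sub_add_ne_zero_of_sq_ne h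
  have e : b ^ 2 - a ^ 2 = (b - a) * (b + a) := by ring
  rw [vecKer, e]
  field_simp
  ring

section KernelStep

variable {μ ν a b : ℂ} {f g : Fin 2 → ℂ}

theorem vecKer_seed_one (hμν : μ ^ 2 ≠ ν ^ 2) :
    vecKer 1 g f ν μ = 2 * alphaInv μ ν f g / (ν ^ 2 - μ ^ 2) := by
  have h1 := sub_ne_zero.2 hμν
  have h2 := sub_ne_zero.2 hμν.symm
  rw [vecKer_one _ _ hμν, alphaInv_eq]
  field_simp
  ring

theorem vecKer_seed_neg_one (hμν : μ ^ 2 ≠ ν ^ 2) :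
    vecKer (-1) g f ν μ = 2 * betaInv μ ν f g / (ν ^ 2 - μ ^ 2) := by
  have h1 := sub_ne_zero.2 hμν
  have h2 := sub_ne_zero.2 hμν.symm
  rw [vecKer_neg_one _ _ hμν, betaInv_eq]
  field_simp
  ring

/-- A step acts on a column by subtracting a multiple of the seed, with a quotient of kernels as
coefficient. The first component involves the kernel with ε = 1, the second that with ε = -1. On
rows it is the opposite, which explains which components border P and which border Q. -/
theorem binaryStep_T_mulVec_zero (h1 : alphaInv μ ν f g ≠ 0)
    (hμν : μ ^ 2 ≠ ν ^ 2) (hb : b ^ 2 ≠ ν ^ 2) (y : Fin 2 → ℂ) :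
    ((binaryStep μ ν f g).T b).mulVec y 0 =
      y 0 - f 0 * vecKer 1 g y ν b / vecKer 1 g f ν μ := by
  have h3 := sub_ne_zero.2 hμν.symm
  have h4 := sub_ne_zero.2 hb
  have hnu' : (binaryStep μ ν f g).nu = ν := rfl
  rw [Step.T_eq_numT _ hb, Matrix.smul_mulVec, vecKer_seed_one hμν, vecKer_one _ _ hb]
  simp only [Step.numT, hnu']
  rw [binaryStep_A00 h1, binaryStep_A01]
  simp only [Pi.smul_apply, Matrix.mulVec, dotProduct, Fin.sum_univ_two]
  simp
  field_simp
  rw [alphaInv_eq, betaInv_eq]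
  ring

theorem binaryStep_T_mulVec_one (h2 : betaInv μ ν f g ≠ 0)
    (hμν : μ ^ 2 ≠ ν ^ 2) (hb : b ^ 2 ≠ ν ^ 2) (y : Fin 2 → ℂ) :
    ((binaryStep μ ν f g).T b).mulVec y 1 =
      y 1 - f 1 * vecKer (-1) g y ν b / vecKer (-1) g f ν μ := by
  have h3 := sub_ne_zero.2 hμν.symm
  have h4 := sub_ne_zero.2 hb
  have hnu' : (binaryStep μ ν f g).nu = ν := rfl
  rw [Step.T_eq_numT _ hb, Matrix.smul_mulVec, vecKer_seed_neg_one hμν, vecKer_neg_one _ _ hb]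
  simp only [Step.numT, hnu']
  rw [binaryStep_A11 h2, binaryStep_A10]
  simp only [Pi.smul_apply, Matrix.mulVec, dotProduct, Fin.sum_univ_two]
  simp
  field_simp
  rw [alphaInv_eq, betaInv_eq]
  ring

theorem vecMul_Tinv_eq (x : Fin 2 → ℂ) :
    Matrix.vecMul x ((binaryStep μ ν f g).Tinv a) =
      ((binaryStep ν μ g f).T a).mulVec x := by
  rw [← binaryStep_swap μ ν f g, Step.swap_T, Matrix.mulVec_transpose]

/-- Exchanging rows with columns changes the sign of μ - ν but not of μ + ν, so up to sign the two
kernels are interchanged. -/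
theorem vecKer_swap_one (x y : Fin 2 → ℂ) (a b : ℂ) : vecKer 1 y x b a = -vecKer (-1) x y a b := by
  simp only [vecKer, add_comm a b, ← neg_sub b a, div_neg]
  ring

theorem vecKer_swap_neg_one (x y : Fin 2 → ℂ) (a b : ℂ) :
    vecKer (-1) y x b a = -vecKer 1 x y a b := by
  simp only [vecKer, add_comm a b, ← neg_sub b a, div_neg]
  ring

theorem binaryStep_vecMul_Tinv_one (h1 : alphaInv μ ν f g ≠ 0)
    (hμν : μ ^ 2 ≠ ν ^ 2) (ha : a ^ 2 ≠ μ ^ 2) (x : Fin 2 → ℂ) :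
    Matrix.vecMul x ((binaryStep μ ν f g).Tinv a) 1 =
      x 1 - g 1 * vecKer 1 x f a μ / vecKer 1 g f ν μ := by
  rw [vecMul_Tinv_eq, binaryStep_T_mulVec_one (by rwa [← alphaInv_swap]) hμν.symm ha,
    vecKer_swap_neg_one, vecKer_swap_neg_one, mul_neg, neg_div_neg_eq]

theorem binaryStep_vecMul_Tinv_zero (h2 : betaInv μ ν f g ≠ 0)
    (hμν : μ ^ 2 ≠ ν ^ 2) (ha : a ^ 2 ≠ μ ^ 2) (x : Fin 2 → ℂ) :
    Matrix.vecMul x ((binaryStep μ ν f g).Tinv a) 0 =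
      x 0 - g 0 * vecKer (-1) x f a μ / vecKer (-1) g f ν μ := by
  rw [vecMul_Tinv_eq, binaryStep_T_mulVec_zero (by rwa [alphaInv_swap]) hμν.symm ha,
    vecKer_swap_one, vecKer_swap_one, mul_neg, neg_div_neg_eq]

/-- The kernel of the transformed vectors is the Schur complement with respect to the entry of the
two seeds. This is one step of Gaussian elimination, with the kernel of the seeds as pivot. -/
theorem vecKer_step_one (h1 : alphaInv μ ν f g ≠ 0) (h2 : betaInv μ ν f g ≠ 0)
    (hμν : μ ^ 2 ≠ ν ^ 2) (ha : a ^ 2 ≠ μ ^ 2) (hb : b ^ 2 ≠ ν ^ 2) (hab : b ^ 2 ≠ a ^ 2)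
    (x y : Fin 2 → ℂ) :
    vecKer 1 (Matrix.vecMul x ((binaryStep μ ν f g).Tinv a))
        (((binaryStep μ ν f g).T b).mulVec y) a b =
      vecKer 1 x y a b - vecKer 1 x f a μ * vecKer 1 g y ν b / vecKer 1 g f ν μ := by
  have h3 := sub_ne_zero.2 hμν.symm
  have h4 := sub_ne_zero.2 hb
  have h5 := sub_ne_zero.2 ha.symm
  have h6 := sub_ne_zero.2 hab
  rw [vecKer_one _ _ hab, vecKer_one _ _ hab, binaryStep_T_mulVec_zero h1 hμν hb,
    binaryStep_T_mulVec_one h2 hμν hb, binaryStep_vecMul_Tinv_zero h2 hμν ha,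
    binaryStep_vecMul_Tinv_one h1 hμν ha, vecKer_seed_one hμν, vecKer_seed_neg_one hμν,
    vecKer_one _ _ hb, vecKer_one _ _ ha.symm, vecKer_neg_one _ _ hb, vecKer_neg_one _ _ ha.symm]
  field_simp
  rw [alphaInv_eq, betaInv_eq]
  ring

theorem vecKer_step_neg_one (h1 : alphaInv μ ν f g ≠ 0) (h2 : betaInv μ ν f g ≠ 0)
    (hμν : μ ^ 2 ≠ ν ^ 2) (ha : a ^ 2 ≠ μ ^ 2) (hb : b ^ 2 ≠ ν ^ 2) (hab : b ^ 2 ≠ a ^ 2)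
    (x y : Fin 2 → ℂ) :
    vecKer (-1) (Matrix.vecMul x ((binaryStep μ ν f g).Tinv a))
        (((binaryStep μ ν f g).T b).mulVec y) a b =
      vecKer (-1) x y a b - vecKer (-1) x f a μ * vecKer (-1) g y ν b / vecKer (-1) g f ν μ := by
  have h3 := sub_ne_zero.2 hμν.symm
  have h4 := sub_ne_zero.2 hb
  have h5 := sub_ne_zero.2 ha.symm
  have h6 := sub_ne_zero.2 hab
  rw [vecKer_neg_one _ _ hab, vecKer_neg_one _ _ hab, binaryStep_T_mulVec_zero h1 hμν hb,
    binaryStep_T_mulVec_one h2 hμν hb, binaryStep_vecMul_Tinv_zero h2 hμν ha,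
    binaryStep_vecMul_Tinv_one h1 hμν ha, vecKer_seed_one hμν, vecKer_seed_neg_one hμν,
    vecKer_one _ _ hb, vecKer_one _ _ ha.symm, vecKer_neg_one _ _ hb, vecKer_neg_one _ _ ha.symm]
  field_simp
  rw [alphaInv_eq, betaInv_eq]
  ring

end KernelStep

/-! ### Induction along the history -/

section Induction

variable {n : ℕ} (m : Fin n → ℕ)

/-- The number of steps of each block done before the step of level `j` in block `i`. -/
def levels (i : Fin n) (j : ℕ) (k : Fin n) : ℕ := if k < i then m k else if k = i then j else 0

/-- The number of steps of each block done after `i` complete blocks. -/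
def blockLevels (i : ℕ) (k : Fin n) : ℕ := if (k : ℕ) < i then m k else 0

theorem levels_self (i : Fin n) (j : ℕ) : levels m i j i = j := by simp [levels]

theorem levels_of_lt {i k : Fin n} (h : k < i) (j : ℕ) : levels m i j k = m k := by
  simp [levels, h]

theorem levels_succ (i : Fin n) (j : ℕ) : levels m i (j + 1) = levels m i j + Pi.single i 1 := by
  funext k
  by_cases h : k = i
  · subst h; simp [levels]
  · simp [levels, h]

theorem levels_zero (i : Fin n) : levels m i 0 = blockLevels m i := by
  funext k
  simp [levels, blockLevels]

theorem levels_last (i : Fin n) : levels m i (m i) = blockLevels m (i + 1) := by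
  funext k
  simp only [levels, blockLevels]
  rcases lt_trichotomy k i with h | h | h
  · simp [h, Nat.lt_succ_of_lt (Fin.lt_def.1 h)]
  · simp [h]
  · have h1 : ¬ ((k : ℕ) < i + 1) := by have := Fin.lt_def.1 h; omega
    simp [h.not_gt, h.ne', h1]

theorem blockLevels_zero : blockLevels m 0 = 0 := by
  funext k; simp [blockLevels]

theorem blockLevels_last : blockLevels m n = m := by
  funext k; simp [blockLevels]

/-- Lexicographic induction over the steps, in which the vector counting completed steps per block
is carried along. The type `X` is left free so that it covers both histories at a fixed point and
histories depending on the point. -/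
theorem levels_induction {X : Type*} (B : ℕ → X) (H : Fin n → ℕ → X)
    (h0 : ∀ i : Fin n, H i 0 = B i) (h1 : ∀ i : Fin n, B (i + 1) = H i (m i))
    (motive : X → (Fin n → ℕ) → Prop) (nil : motive (B 0) 0)
    (step : ∀ i j, j < m i → motive (H i j) (levels m i j) →
      motive (H i (j + 1)) (levels m i j + Pi.single i 1)) :
    (∀ i j, j ≤ m i → motive (H i j) (levels m i j)) ∧ motive (B n) m := by
  have inner : ∀ i : Fin n, motive (B i) (blockLevels m i) →
      ∀ j, j ≤ m i → motive (H i j) (levels m i j) := by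
    intro i hi j
    induction j with
    | zero => intro _; rw [h0, levels_zero]; exact hi
    | succ j ih =>
      intro hj
      rw [levels_succ]
      exact step i j hj (ih (Nat.le_of_succ_le hj))
  have outer : ∀ i : ℕ, i ≤ n → motive (B i) (blockLevels m i) := by
    intro i
    induction i with
    | zero => intro _; rw [blockLevels_zero]; exact nil
    | succ i ih =>
      intro hi
      have h := inner ⟨i, hi⟩ (ih (Nat.le_of_succ_le hi)) _ le_rfl
      rw [levels_last, ← h1 ⟨i, hi⟩] at h
      exact h
  refine ⟨fun i j hj => inner i (outer i i.2.le) j hj, ?_⟩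
  have := outer n le_rfl
  rwa [blockLevels_last] at this

theorem prod_pow_add_single {x : Fin n → ℂ} (e : Fin n → ℕ) (i : Fin n) :
    ∏ k, x k ^ (e + (Pi.single i 1 : Fin n → ℕ)) k = x i * ∏ k, x k ^ e k := by
  simp only [Pi.add_apply, pow_add, Finset.prod_mul_distrib]
  rw [mul_comm]
  congr 1
  rw [Finset.prod_eq_single i]
  · simp
  · intro k _ hk; simp [hk]
  · simp

theorem sum_range_add_single {M : Type*} [AddCommMonoid M] (x : Fin n → ℕ → M) (e : Fin n → ℕ)
    (i : Fin n) :
    ∑ k, ∑ l ∈ Finset.range ((e + (Pi.single i 1 : Fin n → ℕ)) k), x k l =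
      (∑ k, ∑ l ∈ Finset.range (e k), x k l) + x i (e i) := by
  have h : ∀ k, ∑ l ∈ Finset.range ((e + (Pi.single i 1 : Fin n → ℕ)) k), x k l =
      (∑ l ∈ Finset.range (e k), x k l) + if k = i then x i (e i) else 0 := by
    intro k
    by_cases hk : k = i
    · subst hk
      simp [Finset.sum_range_succ]
    · simp [hk]
  rw [Finset.sum_congr rfl fun k _ => h k, Finset.sum_add_distrib]
  simp

end Induction

/-! ### Pointwise properties of the histories -/

theorem analyticAt_Step_T (s : Step) {z : ℂ} (hz : z ^ 2 ≠ s.nu ^ 2) (a b : Fin 2) :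
    AnalyticAt ℂ (fun ζ => s.T ζ a b) z := by
  obtain ⟨h1, h2⟩ := sub_add_ne_zero_of_sq_ne hz
  simp only [Step.T, Matrix.add_apply, Matrix.sub_apply, Matrix.smul_apply, smul_eq_mul]
  fun_prop (disch := assumption)

theorem analyticAt_prodT {L : List Step} {z : ℂ} (hz : ∀ s ∈ L, z ^ 2 ≠ s.nu ^ 2) (a b : Fin 2) :
    AnalyticAt ℂ (fun ζ => prodT L ζ a b) z := by
  induction L generalizing a b with
  | nil => exact analyticAt_const (v := (1 : Matrix (Fin 2) (Fin 2) ℂ) a b)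
  | cons s L ih =>
    simp only [prodT_cons]
    exact analyticAt_matrix_mul (analyticAt_Step_T s (hz s (by simp)))
      (fun a b => ih (fun t ht => hz t (by simp [ht])) a b) a b

section Pointwise

variable {n : ℕ} {m : Fin n → ℕ} {μ ν : Fin n → ℂ} {φ ψ : Fin n → ℂ → Fin 2 → ℂ}

theorem history_zero (i : Fin n) : history m μ ν φ ψ i 0 = blocks m μ ν φ ψ i := rfl

theorem blocks_succ (i : Fin n) : blocks m μ ν φ ψ (i + 1) = history m μ ν φ ψ i (m i) := by
  rw [blocks, dif_pos i.2]
  rfl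

theorem history_succ (i : Fin n) (j : ℕ) :
    history m μ ν φ ψ i (j + 1) = gStep m μ ν φ ψ i j :: history m μ ν φ ψ i j := rfl

theorem history_induction (motive : List Step → (Fin n → ℕ) → Prop) (nil : motive [] 0)
    (step : ∀ i j, j < m i → motive (history m μ ν φ ψ i j) (levels m i j) →
      motive (gStep m μ ν φ ψ i j :: history m μ ν φ ψ i j) (levels m i j + Pi.single i 1)) :
    (∀ i j, j ≤ m i → motive (history m μ ν φ ψ i j) (levels m i j)) ∧
      motive (blocks m μ ν φ ψ n) m :=
  levels_induction m (blocks m μ ν φ ψ) (history m μ ν φ ψ) history_zero blocks_succ motive nil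
    step

/-- All steps of the list use one of the pairs of spectral parameters. -/
def ParamsIn (μ ν : Fin n → ℂ) (L : List Step) : Prop :=
  ∀ s ∈ L, ∃ k, s.mu = μ k ∧ s.nu = ν k

theorem history_paramsIn :
    (∀ i j, j ≤ m i → ParamsIn μ ν (history m μ ν φ ψ i j)) ∧ ParamsIn μ ν (blocks m μ ν φ ψ n) := by
  refine history_induction (fun L _ => ParamsIn μ ν L) (by simp [ParamsIn]) ?_
  intro i j _ ih s hs
  rcases List.mem_cons.1 hs with rfl | hs
  · exact ⟨i, rfl, rfl⟩
  · exact ih s hs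

theorem ParamsIn.sq_ne {L : List Step} (h : ParamsIn μ ν L) {z : ℂ} (hz : ∀ k, z ^ 2 ≠ ν k ^ 2) :
    ∀ s ∈ L, z ^ 2 ≠ s.nu ^ 2 := by
  intro s hs
  obtain ⟨k, -, hk⟩ := h s hs
  rw [hk]; exact hz k

theorem ParamsIn.swap {L : List Step} (h : ParamsIn μ ν L) :
    ParamsIn ν μ (L.map Step.swap) := by
  intro s hs
  obtain ⟨t, ht, rfl⟩ := List.mem_map.1 hs
  obtain ⟨k, h1, h2⟩ := h t ht
  exact ⟨k, h2, h1⟩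

theorem blocks_swap (i : ℕ) :
    (blocks m μ ν φ ψ i).map Step.swap = blocks m ν μ ψ φ i := by
  induction i with
  | zero => rfl
  | succ i ih =>
    by_cases h : i < n
    · simp only [blocks, dif_pos h, addSteps_swap, ih]
    · simp only [blocks, dif_neg h, ih]

theorem history_swap (i : Fin n) (j : ℕ) :
    (history m μ ν φ ψ i j).map Step.swap = history m ν μ ψ φ i j := by
  rw [history, addSteps_swap, blocks_swap, history]

theorem seedPsi_eq_swap (i : Fin n) (j : ℕ) :
    seedPsi m μ ν φ ψ i j = seedPhi m ν μ ψ φ i j := by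
  rw [seedPsi, seedPhi, ← seedCol_swap, history_swap]

theorem vecMul_prodTinv (x : Fin 2 → ℂ) (L : List Step) (ζ : ℂ) :
    Matrix.vecMul x (prodTinv L ζ) = (prodT (L.map Step.swap) ζ).mulVec x := by
  rw [prodT_swap, Matrix.mulVec_transpose]

/-- The coefficients of all steps exist. -/
def NonDeg (m : Fin n → ℕ) (μ ν : Fin n → ℂ) (φ ψ : Fin n → ℂ → Fin 2 → ℂ) : Prop :=
  ∀ i, ∀ j < m i,
    alphaInv (μ i) (ν i) (seedPhi m μ ν φ ψ i j) (seedPsi m μ ν φ ψ i j) ≠ 0 ∧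
    betaInv (μ i) (ν i) (seedPhi m μ ν φ ψ i j) (seedPsi m μ ν φ ψ i j) ≠ 0

theorem NonDeg.swap (h : NonDeg m μ ν φ ψ) : NonDeg m ν μ ψ φ := by
  intro i j hj
  have e1 : seedPsi m ν μ ψ φ i j = seedPhi m μ ν φ ψ i j := seedPsi_eq_swap i j
  have e2 : seedPhi m ν μ ψ φ i j = seedPsi m μ ν φ ψ i j := (seedPsi_eq_swap i j).symm
  rw [e1, e2, alphaInv_swap, ← alphaInv_swap (ν i) (μ i)]
  exact (h i j hj).symm

/-- Every factor is analytic at μ_k because its poles have squares ν_i², so orders of vanishing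
never drop. They rise by one exactly in the count of the block to which the step belongs. -/
theorem hasLead_prodT (hμν : ∀ i k, μ i ^ 2 ≠ ν k ^ 2) (hφ : ∀ i, AnalyticAt ℂ (φ i) (μ i))
    (hnd : NonDeg m μ ν φ ψ) :
    (∀ i j, j ≤ m i → ∀ k, ∃ c, HasLead (levels m i j k)
        (fun ζ => (prodT (history m μ ν φ ψ i j) ζ).mulVec (φ k ζ)) (μ k) c) ∧
      ∀ k, ∃ c, HasLead (m k)
        (fun ζ => (prodT (blocks m μ ν φ ψ n) ζ).mulVec (φ k ζ)) (μ k) c := by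
  refine history_induction (fun L e => ∀ k, ∃ c, HasLead (e k)
    (fun ζ => (prodT L ζ).mulVec (φ k ζ)) (μ k) c) ?_ ?_
  · intro k
    refine ⟨_, (hasLead_zero (hφ k)).congr ?_⟩
    simp [prodT, EventuallyEq]
  · intro i j hj ih k
    obtain ⟨c, hc⟩ := ih k
    have hT := analyticAt_Step_T (gStep m μ ν φ ψ i j) (hμν k i)
    have h2 := hc.mulVec hT
    have e : (fun ζ => ((gStep m μ ν φ ψ i j).T ζ).mulVec
        ((prodT (history m μ ν φ ψ i j) ζ).mulVec (φ k ζ))) =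
        fun ζ => (prodT (gStep m μ ν φ ψ i j :: history m μ ν φ ψ i j) ζ).mulVec (φ k ζ) := by
      funext ζ
      rw [prodT_cons, Matrix.mulVec_mulVec]
    rw [e] at h2
    -- In the block of the step, the leading coefficient is the seed itself, which T(μ_k)
    -- annihilates; in every other block the order is merely preserved.
    by_cases hk : k = i
    · subst hk
      have hz := (history_paramsIn (m := m) (μ := μ) (ν := ν) (φ := φ) (ψ := ψ)).1 k j hj.le |>.sq_ne (hμν k)
      have hs : seedPhi m μ ν φ ψ k j = c :=
        seedCol_of_hasLead hz (hφ k) (by rwa [levels_self] at hc)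
      obtain ⟨d1, d2⟩ := hnd k j hj
      have h0 : ((gStep m μ ν φ ψ k j).T (μ k)).mulVec c = 0 := by
        rw [← hs]
        exact binaryStep_T_mulVec_self d1 d2 (hμν k k)
      rw [h0] at h2
      simpa using h2.succ
    · exact ⟨_, by simpa [hk] using h2⟩

theorem hasLead_seedPhi (hμν : ∀ i k, μ i ^ 2 ≠ ν k ^ 2) (hφ : ∀ i, AnalyticAt ℂ (φ i) (μ i))
    (hnd : NonDeg m μ ν φ ψ) (i : Fin n) {j : ℕ} (hj : j < m i) :
    HasLead j (fun ζ => (prodT (history m μ ν φ ψ i j) ζ).mulVec (φ i ζ)) (μ i)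
      (seedPhi m μ ν φ ψ i j) := by
  obtain ⟨c, hc⟩ := (hasLead_prodT hμν hφ hnd).1 i j hj.le i
  rw [levels_self] at hc
  have hz := (history_paramsIn (m := m) (μ := μ) (ν := ν) (φ := φ) (ψ := ψ)).1 i j hj.le |>.sq_ne (hμν i)
  rwa [seedPhi, seedCol_of_hasLead hz (hφ i) hc]

theorem hasLead_prodTinv (hμν : ∀ i k, μ i ^ 2 ≠ ν k ^ 2) (hψ : ∀ i, AnalyticAt ℂ (ψ i) (ν i))
    (hnd : NonDeg m μ ν φ ψ) :
    (∀ i j, j ≤ m i → ∀ k, ∃ c, HasLead (levels m i j k)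
        (fun ζ => Matrix.vecMul (ψ k ζ) (prodTinv (history m μ ν φ ψ i j) ζ)) (ν k) c) ∧
      ∀ k, ∃ c, HasLead (m k)
        (fun ζ => Matrix.vecMul (ψ k ζ) (prodTinv (blocks m μ ν φ ψ n) ζ)) (ν k) c := by
  simp only [vecMul_prodTinv, history_swap, blocks_swap]
  exact hasLead_prodT (fun i k => (hμν k i).symm) hψ hnd.swap

theorem hasLead_seedPsi (hμν : ∀ i k, μ i ^ 2 ≠ ν k ^ 2) (hψ : ∀ i, AnalyticAt ℂ (ψ i) (ν i))
    (hnd : NonDeg m μ ν φ ψ) (i : Fin n) {j : ℕ} (hj : j < m i) :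
    HasLead j (fun ζ => Matrix.vecMul (ψ i ζ) (prodTinv (history m μ ν φ ψ i j) ζ)) (ν i)
      (seedPsi m μ ν φ ψ i j) := by
  simp only [vecMul_prodTinv, history_swap, seedPsi_eq_swap]
  exact hasLead_seedPhi (fun i k => (hμν k i).symm) hψ hnd.swap i hj

theorem prodT_mul_prodTinv (hnd : NonDeg m μ ν φ ψ) {ζ : ℂ} (h1 : ∀ i, ζ ^ 2 ≠ μ i ^ 2)
    (h2 : ∀ i, ζ ^ 2 ≠ ν i ^ 2) :
    prodT (blocks m μ ν φ ψ n) ζ * prodTinv (blocks m μ ν φ ψ n) ζ = 1 := by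
  refine (history_induction (fun L _ => prodT L ζ * prodTinv L ζ = 1) (by simp [prodT, prodTinv])
    ?_).2
  intro i j hj ih
  obtain ⟨d1, d2⟩ := hnd i j hj
  have h : (gStep m μ ν φ ψ i j).T ζ * (gStep m μ ν φ ψ i j).Tinv ζ = 1 :=
    binaryStep_T_mul_Tinv d1 d2 (h1 i) (h2 i)
  rw [prodT_cons, prodTinv_cons, Matrix.mul_assoc, ← Matrix.mul_assoc _ _ (Step.Tinv _ _), ih,
    Matrix.one_mul, h]

theorem det_prodT (hnd : NonDeg m μ ν φ ψ) {ζ : ℂ} (h2 : ∀ i, ζ ^ 2 ≠ ν i ^ 2) :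
    (prodT (blocks m μ ν φ ψ n) ζ).det =
      ∏ i, ((ζ ^ 2 - μ i ^ 2) / (ζ ^ 2 - ν i ^ 2)) ^ m i := by
  refine (history_induction (fun L e => (prodT L ζ).det =
    ∏ i, ((ζ ^ 2 - μ i ^ 2) / (ζ ^ 2 - ν i ^ 2)) ^ e i) (by simp [prodT]) ?_).2
  intro i j hj ih
  obtain ⟨d1, d2⟩ := hnd i j hj
  have h : ((gStep m μ ν φ ψ i j).T ζ).det = _ := binaryStep_det d1 d2 (h2 i)
  rw [prodT_cons, Matrix.det_mul, ih, h, prod_pow_add_single]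

theorem det_prodTinv (hnd : NonDeg m μ ν φ ψ) {ζ : ℂ} (h2 : ∀ i, ζ ^ 2 ≠ μ i ^ 2) :
    (prodTinv (blocks m μ ν φ ψ n) ζ).det =
      ∏ i, ((ζ ^ 2 - ν i ^ 2) / (ζ ^ 2 - μ i ^ 2)) ^ m i := by
  rw [← Matrix.det_transpose, ← prodT_swap, blocks_swap]
  exact det_prodT hnd.swap h2

end Pointwise

/-! ### Elimination in the determinants -/

/-- The order on the indices is pulled back along `key`, which makes the matrix upper triangular. -/
theorem det_eq_prod_diag {ι κ : Type*} [Fintype ι] [DecidableEq ι] [LinearOrder κ] (key : ι → κ)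
    (hkey : Function.Injective key) (M : Matrix ι ι ℂ)
    (hM : ∀ i j, key j < key i → M i j = 0) : M.det = ∏ i, M i i := by
  let _ : LinearOrder ι := LinearOrder.lift' key hkey
  have h := Matrix.det_of_isUpperTriangular (M := M) (fun i j hij => hM i j hij)
  convert h

/-- Both triangular factors have the pivots on their diagonals, hence the inverse pivots in the
middle. The borders are x = L D⁻¹ z and y = w D⁻¹ U, so the Schur complement -y P⁻¹ x collapses to
-w D⁻¹ z. -/
theorem det_bordered {ι : Type*} [Fintype ι] [DecidableEq ι] {P L U : Matrix ι ι ℂ} {d : ι → ℂ}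
    (hd : ∀ i, d i ≠ 0) (hP : P = L * Matrix.diagonal (fun i => (d i)⁻¹) * U)
    (hL : L.det = ∏ i, d i) (hU : U.det = ∏ i, d i)
    {x : Matrix ι Unit ℂ} {y : Matrix Unit ι ℂ} {w z : ι → ℂ}
    (hx : ∀ i, x i () = ∑ s, L i s * (d s)⁻¹ * z s)
    (hy : ∀ i, y () i = ∑ s, w s * (d s)⁻¹ * U s i) :
    P.det ≠ 0 ∧ (Matrix.fromBlocks P x y 0).det / P.det = -∑ s, w s * z s / d s := by
  have hprod : ∏ i, d i ≠ 0 := Finset.prod_ne_zero_iff.2 fun i _ => hd i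
  have hdet : P.det ≠ 0 := by
    rw [hP, Matrix.det_mul, Matrix.det_mul, Matrix.det_diagonal, hL, hU]
    exact mul_ne_zero (mul_ne_zero hprod (Finset.prod_ne_zero_iff.2 fun i _ => inv_ne_zero (hd i)))
      hprod
  refine ⟨hdet, ?_⟩
  have hUu : IsUnit U.det := by rw [hU]; exact hprod.isUnit
  have hPu : IsUnit P.det := hdet.isUnit
  let _ := P.invertibleOfIsUnitDet hPu
  set zc : Matrix ι Unit ℂ := Matrix.of fun s _ => z s with hzc
  set wr : Matrix Unit ι ℂ := Matrix.of fun _ s => w s with hwr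
  have hx' : x = L * Matrix.diagonal (fun i => (d i)⁻¹) * zc := by
    ext i j
    rw [Matrix.mul_apply]
    simp only [Matrix.mul_diagonal]
    exact hx i
  have hy' : y = wr * Matrix.diagonal (fun i => (d i)⁻¹) * U := by
    ext i j
    rw [Matrix.mul_apply]
    simp only [Matrix.mul_diagonal]
    exact hy j
  have h1 : P * (U⁻¹ * zc) = x := by
    rw [hP, hx', Matrix.mul_assoc _ U, ← Matrix.mul_assoc U, Matrix.mul_nonsing_inv _ hUu,
      Matrix.one_mul]
  have h2 : ⅟P * x = U⁻¹ * zc := by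
    rw [← h1, ← Matrix.mul_assoc, invOf_mul_self, Matrix.one_mul]
  have h3 : y * ⅟P * x = wr * Matrix.diagonal (fun i => (d i)⁻¹) * zc := by
    rw [Matrix.mul_assoc, h2, hy', Matrix.mul_assoc _ U, ← Matrix.mul_assoc U,
      Matrix.mul_nonsing_inv _ hUu, Matrix.one_mul]
  rw [Matrix.det_fromBlocks₁₁, h3, mul_div_cancel_left₀ _ hdet, Matrix.det_unique, zero_sub,
    Matrix.neg_apply, Matrix.mul_apply]
  simp only [Matrix.mul_diagonal, hzc, hwr, Matrix.of_apply]
  congr 1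
  exact Finset.sum_congr rfl fun s _ => by ring

theorem HasLead.vecKer_right {k : ℕ} {F : ℂ → Fin 2 → ℂ} {z a : ℂ} {c : Fin 2 → ℂ} (ε : ℂ)
    (x : Fin 2 → ℂ) (h : z ^ 2 ≠ a ^ 2) (hF : HasLead k F z c) :
    HasLead k (fun b => vecKer ε x (F b) a b) z (vecKer ε x c a z) := by
  obtain ⟨φ, h1, h2, h3⟩ := hF
  obtain ⟨ha, hb⟩ := sub_add_ne_zero_of_sq_ne h
  have h4 := fun i => analyticAt_pi_iff.1 h1 i
  refine ⟨fun b => vecKer ε x (φ b) a b, ?_, ?_, congrArg (fun y => vecKer ε x y a z) h3⟩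
  · simp only [vecKer]
    have h40 := h4 0
    have h41 := h4 1
    fun_prop (disch := assumption)
  · filter_upwards [h2] with b hb
    rw [hb]
    simp only [vecKer, Pi.smul_apply, smul_eq_mul]
    ring

theorem HasLead.vecKer_left {k : ℕ} {F : ℂ → Fin 2 → ℂ} {z b : ℂ} {c : Fin 2 → ℂ} (ε : ℂ)
    (y : Fin 2 → ℂ) (h : b ^ 2 ≠ z ^ 2) (hF : HasLead k F z c) :
    HasLead k (fun a => vecKer ε (F a) y a b) z (vecKer ε c y z b) := by
  obtain ⟨φ, h1, h2, h3⟩ := hF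
  obtain ⟨ha, hb⟩ := sub_add_ne_zero_of_sq_ne h
  have h4 := fun i => analyticAt_pi_iff.1 h1 i
  refine ⟨fun a => vecKer ε (φ a) y a b, ?_, ?_, congrArg (fun x => vecKer ε x y z b) h3⟩
  · simp only [vecKer]
    have h40 := h4 0
    have h41 := h4 1
    fun_prop (disch := assumption)
  · filter_upwards [h2] with a ha
    rw [ha]
    simp only [vecKer, Pi.smul_apply, smul_eq_mul]
    ring

theorem mixedTaylor_eq (K : ℂ → ℂ → ℂ) (ν₀ μ₀ : ℂ) (k l : ℕ) :
    mixedTaylor K ν₀ μ₀ k l =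
      taylorCoeff k (fun a => taylorCoeff l (fun b => K a b) μ₀) ν₀ := by
  simp only [mixedTaylor, taylorCoeff, smul_eq_mul, iteratedDeriv_const_mul_field]
  rw [← mul_assoc]
  congr 1
  field_simp

/-! ### Triangular factorization of the kernel matrices and of their borders. -/

section Elimination

variable {n : ℕ} (m : Fin n → ℕ) (μ ν : Fin n → ℂ) (φ ψ : Fin n → ℂ → Fin 2 → ℂ) (ε : ℂ)

/-- The pivot of the step of level `j` in block `i`. -/
def pivot (i : Fin n) (j : ℕ) : ℂ :=
  vecKer ε (seedPsi m μ ν φ ψ i j) (seedPhi m μ ν φ ψ i j) (ν i) (μ i)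

/-- The kernel of the row seed of a step with the transformed columns. -/
def upperFun (i : Fin n) (j : ℕ) (k : Fin n) (b : ℂ) : ℂ :=
  vecKer ε (seedPsi m μ ν φ ψ i j) ((prodT (history m μ ν φ ψ i j) b).mulVec (φ k b)) (ν i) b

/-- The kernel of the transformed rows with the column seed of a step. -/
def lowerFun (i : Fin n) (j : ℕ) (k : Fin n) (a : ℂ) : ℂ :=
  vecKer ε (Matrix.vecMul (ψ k a) (prodTinv (history m μ ν φ ψ i j) a)) (seedPhi m μ ν φ ψ i j) a
    (μ i)

variable {m μ ν φ ψ ε}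

theorem vecKer_step (hε : ε = 1 ∨ ε = -1) {μ₀ ν₀ a b : ℂ} {f g : Fin 2 → ℂ}
    (h1 : alphaInv μ₀ ν₀ f g ≠ 0) (h2 : betaInv μ₀ ν₀ f g ≠ 0)
    (hμν : μ₀ ^ 2 ≠ ν₀ ^ 2) (ha : a ^ 2 ≠ μ₀ ^ 2) (hb : b ^ 2 ≠ ν₀ ^ 2) (hab : b ^ 2 ≠ a ^ 2)
    (x y : Fin 2 → ℂ) :
    vecKer ε (Matrix.vecMul x ((binaryStep μ₀ ν₀ f g).Tinv a))
        (((binaryStep μ₀ ν₀ f g).T b).mulVec y) a b =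
      vecKer ε x y a b - vecKer ε x f a μ₀ * vecKer ε g y ν₀ b / vecKer ε g f ν₀ μ₀ := by
  rcases hε with rfl | rfl
  · exact vecKer_step_one h1 h2 hμν ha hb hab x y
  · exact vecKer_step_neg_one h1 h2 hμν ha hb hab x y

/-- Iterating the rank-one update `vecKer_step` writes the original kernel as the sum of all
subtracted terms plus the kernel of the fully transformed vectors, which plays the role of a
remainder. -/
theorem kernel_telescope (hε : ε = 1 ∨ ε = -1) (hμν : ∀ i k, μ i ^ 2 ≠ ν k ^ 2)
    (hnd : NonDeg m μ ν φ ψ) (r c : Fin n) {a b : ℂ} (ha : ∀ i, a ^ 2 ≠ μ i ^ 2)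
    (hb : ∀ i, b ^ 2 ≠ ν i ^ 2) (hab : b ^ 2 ≠ a ^ 2) :
    vecKer ε (ψ r a) (φ c b) a b =
      (∑ i, ∑ j ∈ Finset.range (m i), lowerFun m μ ν φ ψ ε i j r a * upperFun m μ ν φ ψ ε i j c b /
        pivot m μ ν φ ψ ε i j) +
      vecKer ε (Matrix.vecMul (ψ r a) (prodTinv (blocks m μ ν φ ψ n) a))
        ((prodT (blocks m μ ν φ ψ n) b).mulVec (φ c b)) a b := by
  refine (history_induction (fun L e => vecKer ε (ψ r a) (φ c b) a b =
    (∑ i, ∑ j ∈ Finset.range (e i), lowerFun m μ ν φ ψ ε i j r a * upperFun m μ ν φ ψ ε i j c b /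
      pivot m μ ν φ ψ ε i j) +
    vecKer ε (Matrix.vecMul (ψ r a) (prodTinv L a)) ((prodT L b).mulVec (φ c b)) a b) ?_ ?_).2
  · simp [prodT, prodTinv]
  · intro i j hj ih
    obtain ⟨d1, d2⟩ := hnd i j hj
    rw [sum_range_add_single (fun i j => lowerFun m μ ν φ ψ ε i j r a *
      upperFun m μ ν φ ψ ε i j c b / pivot m μ ν φ ψ ε i j), levels_self, prodT_cons, prodTinv_cons,
      ← Matrix.vecMul_vecMul, ← Matrix.mulVec_mulVec, gStep,
      vecKer_step hε d1 d2 (hμν i i) (ha i) (hb i) hab, ih]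
    simp only [lowerFun, upperFun, pivot]
    ring

/-- The components used to border the matrices. -/
def colIndex (ε : ℂ) : Fin 2 := if ε = 1 then 0 else 1

/-- The action of a step on the bordering component uses the same kernel quotients as the
elimination of the kernel, so the border is eliminated by the same row operations as the matrix. -/
theorem column_telescope (hε : ε = 1 ∨ ε = -1) (hμν : ∀ i k, μ i ^ 2 ≠ ν k ^ 2)
    (hnd : NonDeg m μ ν φ ψ) (c : Fin n) {b : ℂ} (hb : ∀ i, b ^ 2 ≠ ν i ^ 2) :
    φ c b (colIndex ε) =
      (∑ i, ∑ j ∈ Finset.range (m i), seedPhi m μ ν φ ψ i j (colIndex ε) *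
        upperFun m μ ν φ ψ ε i j c b / pivot m μ ν φ ψ ε i j) +
      (prodT (blocks m μ ν φ ψ n) b).mulVec (φ c b) (colIndex ε) := by
  refine (history_induction (fun L e => φ c b (colIndex ε) =
    (∑ i, ∑ j ∈ Finset.range (e i), seedPhi m μ ν φ ψ i j (colIndex ε) *
      upperFun m μ ν φ ψ ε i j c b / pivot m μ ν φ ψ ε i j) +
    (prodT L b).mulVec (φ c b) (colIndex ε)) ?_ ?_).2
  · simp [prodT]
  · intro i j hj ih
    obtain ⟨d1, d2⟩ := hnd i j hj
    rw [sum_range_add_single (fun i j => seedPhi m μ ν φ ψ i j (colIndex ε) *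
      upperFun m μ ν φ ψ ε i j c b / pivot m μ ν φ ψ ε i j), levels_self, prodT_cons,
      ← Matrix.mulVec_mulVec, gStep, ih]
    have hne : (-1 : ℂ) ≠ 1 := by norm_num
    rcases hε with rfl | rfl
    · simp only [colIndex, if_true]
      rw [binaryStep_T_mulVec_zero d1 (hμν i i) (hb i)]
      simp only [upperFun, pivot]
      ring
    · simp only [colIndex, if_neg hne]
      rw [binaryStep_T_mulVec_one d2 (hμν i i) (hb i)]
      simp only [upperFun, pivot]
      ring

theorem row_telescope (hε : ε = 1 ∨ ε = -1) (hμν : ∀ i k, μ i ^ 2 ≠ ν k ^ 2)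
    (hnd : NonDeg m μ ν φ ψ) (r : Fin n) {a : ℂ} (ha : ∀ i, a ^ 2 ≠ μ i ^ 2) :
    ψ r a (1 - colIndex ε) =
      (∑ i, ∑ j ∈ Finset.range (m i), seedPsi m μ ν φ ψ i j (1 - colIndex ε) *
        lowerFun m μ ν φ ψ ε i j r a / pivot m μ ν φ ψ ε i j) +
      Matrix.vecMul (ψ r a) (prodTinv (blocks m μ ν φ ψ n) a) (1 - colIndex ε) := by
  refine (history_induction (fun L e => ψ r a (1 - colIndex ε) =
    (∑ i, ∑ j ∈ Finset.range (e i), seedPsi m μ ν φ ψ i j (1 - colIndex ε) *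
      lowerFun m μ ν φ ψ ε i j r a / pivot m μ ν φ ψ ε i j) +
    Matrix.vecMul (ψ r a) (prodTinv L a) (1 - colIndex ε)) ?_ ?_).2
  · simp [prodTinv]
  · intro i j hj ih
    obtain ⟨d1, d2⟩ := hnd i j hj
    rw [sum_range_add_single (fun i j => seedPsi m μ ν φ ψ i j (1 - colIndex ε) *
      lowerFun m μ ν φ ψ ε i j r a / pivot m μ ν φ ψ ε i j), levels_self, prodTinv_cons,
      ← Matrix.vecMul_vecMul, gStep, ih]
    have hne : (-1 : ℂ) ≠ 1 := by norm_num
    rcases hε with rfl | rfl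
    · simp only [colIndex, if_true, sub_zero]
      rw [binaryStep_vecMul_Tinv_one d1 (hμν i i) (ha i)]
      simp only [lowerFun, pivot]
      ring
    · simp only [colIndex, if_neg hne, sub_self]
      rw [binaryStep_vecMul_Tinv_zero d2 (hμν i i) (ha i)]
      simp only [lowerFun, pivot]
      ring

theorem pivot_ne_zero (hε : ε = 1 ∨ ε = -1) (hμν : ∀ i k, μ i ^ 2 ≠ ν k ^ 2)
    (hnd : NonDeg m μ ν φ ψ) (i : Fin n) {j : ℕ} (hj : j < m i) : pivot m μ ν φ ψ ε i j ≠ 0 := by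
  obtain ⟨d1, d2⟩ := hnd i j hj
  have h := sub_ne_zero.2 (hμν i i).symm
  rcases hε with rfl | rfl
  · rw [pivot, vecKer_seed_one (hμν i i)]
    exact div_ne_zero (mul_ne_zero two_ne_zero d1) h
  · rw [pivot, vecKer_seed_neg_one (hμν i i)]
    exact div_ne_zero (mul_ne_zero two_ne_zero d2) h

/-- The position of an index in the lexicographic order. -/
def lexKey (r : Σ i, Fin (m i)) : Fin n ×ₗ ℕ := toLex (r.1, (r.2 : ℕ))

theorem lexKey_injective : Function.Injective (lexKey (m := m)) := by
  rintro ⟨i, j⟩ ⟨i', j'⟩ h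
  have h' : (i, (j : ℕ)) = (i', (j' : ℕ)) := toLex.injective h
  obtain ⟨rfl, h2⟩ := Prod.mk.inj h'
  obtain rfl := Fin.ext h2
  rfl

/-- An index preceding s lies either in a block already complete at s or at an earlier level of the
same block. In both cases its Taylor order is below the order of vanishing reached at s, which is
the source of triangularity. -/
theorem lt_levels_of_lexKey_lt {r s : Σ i, Fin (m i)} (h : lexKey r < lexKey s) :
    (r.2 : ℕ) < levels m s.1 s.2 r.1 := by
  rcases Prod.Lex.lt_iff.1 h with h | ⟨h1, h2⟩
  · have h' : r.1 < s.1 := h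
    rw [levels_of_lt m h']
    exact r.2.2
  · have h1' : r.1 = s.1 := h1
    have h3 : levels m s.1 s.2 r.1 = s.2 := by simp [levels, h1']
    rw [h3]
    exact h2

theorem sum_sigma_fin (F : Fin n → ℕ → ℂ) :
    ∑ s : (Σ i, Fin (m i)), F s.1 s.2 = ∑ i, ∑ j ∈ Finset.range (m i), F i j := by
  rw [Fintype.sum_sigma]
  exact Finset.sum_congr rfl fun i _ => (Finset.sum_range (fun j => F i j)).symm

theorem hasLead_upperFun (hμν : ∀ i k, μ i ^ 2 ≠ ν k ^ 2)
    (hφ : ∀ i, AnalyticAt ℂ (φ i) (μ i)) (hnd : NonDeg m μ ν φ ψ) (s : Σ i, Fin (m i))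
    (k : Fin n) :
    ∃ c, HasLead (levels m s.1 s.2 k) (upperFun m μ ν φ ψ ε s.1 s.2 k) (μ k) c := by
  obtain ⟨c, hc⟩ := (hasLead_prodT hμν hφ hnd).1 s.1 s.2 s.2.2.le k
  exact ⟨_, hc.vecKer_right ε _ (hμν k s.1)⟩

theorem hasLead_lowerFun (hμν : ∀ i k, μ i ^ 2 ≠ ν k ^ 2)
    (hψ : ∀ i, AnalyticAt ℂ (ψ i) (ν i)) (hnd : NonDeg m μ ν φ ψ) (s : Σ i, Fin (m i))
    (k : Fin n) :
    ∃ c, HasLead (levels m s.1 s.2 k) (lowerFun m μ ν φ ψ ε s.1 s.2 k) (ν k) c := by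
  obtain ⟨c, hc⟩ := (hasLead_prodTinv hμν hψ hnd).1 s.1 s.2 s.2.2.le k
  exact ⟨_, hc.vecKer_left ε _ (hμν s.1 k)⟩

theorem analyticAt_upperFun (hμν : ∀ i k, μ i ^ 2 ≠ ν k ^ 2)
    (hφ : ∀ i, AnalyticAt ℂ (φ i) (μ i)) (hnd : NonDeg m μ ν φ ψ) (s : Σ i, Fin (m i))
    (k : Fin n) : AnalyticAt ℂ (upperFun m μ ν φ ψ ε s.1 s.2 k) (μ k) :=
  (hasLead_upperFun hμν hφ hnd s k).choose_spec.analyticAt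

theorem analyticAt_lowerFun (hμν : ∀ i k, μ i ^ 2 ≠ ν k ^ 2)
    (hψ : ∀ i, AnalyticAt ℂ (ψ i) (ν i)) (hnd : NonDeg m μ ν φ ψ) (s : Σ i, Fin (m i))
    (k : Fin n) : AnalyticAt ℂ (lowerFun m μ ν φ ψ ε s.1 s.2 k) (ν k) :=
  (hasLead_lowerFun hμν hψ hnd s k).choose_spec.analyticAt

variable (m μ ν φ ψ ε) in
/-- The upper triangular factor. -/
def upperMat : Matrix (Σ i, Fin (m i)) (Σ i, Fin (m i)) ℂ :=
  Matrix.of fun s c => taylorCoeff c.2 (upperFun m μ ν φ ψ ε s.1 s.2 c.1) (μ c.1)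

variable (m μ ν φ ψ ε) in
/-- The lower triangular factor. -/
def lowerMat : Matrix (Σ i, Fin (m i)) (Σ i, Fin (m i)) ℂ :=
  Matrix.of fun r s => taylorCoeff r.2 (lowerFun m μ ν φ ψ ε s.1 s.2 r.1) (ν r.1)

/-- Entries below the diagonal are Taylor coefficients of order lower than the zero of `upperFun`.
On the diagonal the order is exactly that of the leading term, whose value is the kernel of the two
seeds, the pivot. -/
theorem det_upperMat (hμν : ∀ i k, μ i ^ 2 ≠ ν k ^ 2)
    (hφ : ∀ i, AnalyticAt ℂ (φ i) (μ i)) (hnd : NonDeg m μ ν φ ψ) :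
    (upperMat m μ ν φ ψ ε).det = ∏ s : (Σ i, Fin (m i)), pivot m μ ν φ ψ ε s.1 s.2 := by
  rw [det_eq_prod_diag lexKey lexKey_injective]
  · refine Finset.prod_congr rfl fun s _ => ?_
    exact taylorCoeff_eq_of_hasLead
      ((hasLead_seedPhi hμν hφ hnd s.1 s.2.2).vecKer_right ε _ (hμν s.1 s.1))
  · intro s c hsc
    obtain ⟨e, he⟩ := hasLead_upperFun (ε := ε) hμν hφ hnd s c.1
    exact taylorCoeff_eq_zero_of_hasLead (lt_levels_of_lexKey_lt hsc) he

theorem det_lowerMat (hμν : ∀ i k, μ i ^ 2 ≠ ν k ^ 2)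
    (hψ : ∀ i, AnalyticAt ℂ (ψ i) (ν i)) (hnd : NonDeg m μ ν φ ψ) :
    (lowerMat m μ ν φ ψ ε).det = ∏ s : (Σ i, Fin (m i)), pivot m μ ν φ ψ ε s.1 s.2 := by
  rw [← Matrix.det_transpose, det_eq_prod_diag lexKey lexKey_injective]
  · refine Finset.prod_congr rfl fun s _ => ?_
    exact taylorCoeff_eq_of_hasLead
      ((hasLead_seedPsi hμν hψ hnd s.1 s.2.2).vecKer_left ε _ (hμν s.1 s.1))
  · intro s r hsr
    obtain ⟨e, he⟩ := hasLead_lowerFun (ε := ε) hμν hψ hnd s r.1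
    exact taylorCoeff_eq_zero_of_hasLead (lt_levels_of_lexKey_lt hsr) he

theorem taylorCoeff_eq_sum_of_hasLead {ι : Type*} [Fintype ι] {k l : ℕ} (hl : l < k) {F R : ℂ → ℂ}
    {z e : ℂ} (hR : HasLead k R z e) (x : ι → ℂ) (f : ι → ℂ → ℂ)
    (hf : ∀ s, AnalyticAt ℂ (f s) z) (h : F =ᶠ[𝓝 z] fun ζ => (∑ s, x s * f s ζ) + R ζ) :
    taylorCoeff l F z = ∑ s, x s * taylorCoeff l (f s) z := by
  have hxf := fun s => (analyticAt_const (v := x s)).mul (hf s)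
  have hs : AnalyticAt ℂ (fun ζ => ∑ s, x s * f s ζ) z :=
    Finset.analyticAt_fun_sum _ fun s _ => hxf s
  rw [taylorCoeff_congr h, taylorCoeff_add hs hR.analyticAt,
    taylorCoeff_eq_zero_of_hasLead hl hR, add_zero,
    taylorCoeff_sum (f := fun s ζ => x s * f s ζ) _ fun s _ => hxf s]
  exact Finset.sum_congr rfl fun s _ => taylorCoeff_const_mul _ _ _ _

theorem taylorCoeff_sum_mul_upperFun (hμν : ∀ i k, μ i ^ 2 ≠ ν k ^ 2)
    (hφ : ∀ i, AnalyticAt ℂ (φ i) (μ i)) (hnd : NonDeg m μ ν φ ψ) (c : Σ i, Fin (m i))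
    {F R : ℂ → ℂ} {e : ℂ} (x : Fin n → ℕ → ℂ) (hR : HasLead (m c.1) R (μ c.1) e)
    (h : ∀ᶠ b in 𝓝 (μ c.1), F b = (∑ i, ∑ j ∈ Finset.range (m i),
      x i j * upperFun m μ ν φ ψ ε i j c.1 b / pivot m μ ν φ ψ ε i j) + R b) :
    taylorCoeff c.2 F (μ c.1) = ∑ s : (Σ i, Fin (m i)),
      x s.1 s.2 * (pivot m μ ν φ ψ ε s.1 s.2)⁻¹ * upperMat m μ ν φ ψ ε s c := by
  have hu := fun s => analyticAt_upperFun (ε := ε) hμν hφ hnd s c.1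
  have key : F =ᶠ[𝓝 (μ c.1)] fun b => (∑ s : (Σ i, Fin (m i)),
      x s.1 s.2 * (pivot m μ ν φ ψ ε s.1 s.2)⁻¹ * upperFun m μ ν φ ψ ε s.1 s.2 c.1 b) + R b := by
    filter_upwards [h] with b hb
    rw [hb, ← sum_sigma_fin]
    congr 1
    exact Finset.sum_congr rfl fun s _ => by ring
  exact taylorCoeff_eq_sum_of_hasLead c.2.2 hR
    (fun s : (Σ i, Fin (m i)) => x s.1 s.2 * (pivot m μ ν φ ψ ε s.1 s.2)⁻¹)
    (fun s => upperFun m μ ν φ ψ ε s.1 s.2 c.1) hu key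

theorem taylorCoeff_sum_mul_lowerFun (hμν : ∀ i k, μ i ^ 2 ≠ ν k ^ 2)
    (hψ : ∀ i, AnalyticAt ℂ (ψ i) (ν i)) (hnd : NonDeg m μ ν φ ψ) (r : Σ i, Fin (m i))
    {F R : ℂ → ℂ} {e : ℂ} (x : Fin n → ℕ → ℂ) (hR : HasLead (m r.1) R (ν r.1) e)
    (h : ∀ᶠ a in 𝓝 (ν r.1), F a = (∑ i, ∑ j ∈ Finset.range (m i),
      x i j * lowerFun m μ ν φ ψ ε i j r.1 a / pivot m μ ν φ ψ ε i j) + R a) :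
    taylorCoeff r.2 F (ν r.1) = ∑ s : (Σ i, Fin (m i)),
      lowerMat m μ ν φ ψ ε r s * (pivot m μ ν φ ψ ε s.1 s.2)⁻¹ * x s.1 s.2 := by
  have hu := fun s => analyticAt_lowerFun (ε := ε) hμν hψ hnd s r.1
  have key : F =ᶠ[𝓝 (ν r.1)] fun a => (∑ s : (Σ i, Fin (m i)),
      x s.1 s.2 * (pivot m μ ν φ ψ ε s.1 s.2)⁻¹ * lowerFun m μ ν φ ψ ε s.1 s.2 r.1 a) + R a := by
    filter_upwards [h] with a ha
    rw [ha, ← sum_sigma_fin]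
    congr 1
    exact Finset.sum_congr rfl fun s _ => by ring
  refine (taylorCoeff_eq_sum_of_hasLead r.2.2 hR
    (fun s : (Σ i, Fin (m i)) => x s.1 s.2 * (pivot m μ ν φ ψ ε s.1 s.2)⁻¹)
    (fun s => lowerFun m μ ν φ ψ ε s.1 s.2 r.1) hu key).trans ?_
  refine Finset.sum_congr rfl fun s _ => ?_
  rw [lowerMat, Matrix.of_apply]
  ring

theorem eventually_sq_ne_params {z : ℂ} {w : Fin n → ℂ} (h : ∀ i, z ^ 2 ≠ w i ^ 2) :
    ∀ᶠ ζ in 𝓝 z, ∀ i, ζ ^ 2 ≠ w i ^ 2 :=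
  eventually_all.2 fun i => ((continuous_pow 2).continuousAt).eventually_ne (h i)

/-- Entrywise form of L D⁻¹ U: the telescoped kernel is expanded in b for fixed a, then in a, and
each rank-one term separates the two variables. -/
theorem mixedTaylor_kernel (hε : ε = 1 ∨ ε = -1) (hμν : ∀ i k, μ i ^ 2 ≠ ν k ^ 2)
    (hφ : ∀ i, AnalyticAt ℂ (φ i) (μ i)) (hψ : ∀ i, AnalyticAt ℂ (ψ i) (ν i))
    (hnd : NonDeg m μ ν φ ψ) (r c : Σ i, Fin (m i)) :
    mixedTaylor (fun a b => vecKer ε (ψ r.1 a) (φ c.1 b) a b) (ν r.1) (μ c.1) r.2 c.2 =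
      ∑ s : (Σ i, Fin (m i)), lowerMat m μ ν φ ψ ε r s * (pivot m μ ν φ ψ ε s.1 s.2)⁻¹ *
        upperMat m μ ν φ ψ ε s c := by
  rw [mixedTaylor_eq]
  have inner : ∀ᶠ a in 𝓝 (ν r.1),
      taylorCoeff c.2 (fun b => vecKer ε (ψ r.1 a) (φ c.1 b) a b) (μ c.1) =
        ∑ s : (Σ i, Fin (m i)), ((pivot m μ ν φ ψ ε s.1 s.2)⁻¹ * upperMat m μ ν φ ψ ε s c) *
          lowerFun m μ ν φ ψ ε s.1 s.2 r.1 a := by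
    filter_upwards [eventually_sq_ne_params fun i => (hμν i r.1).symm] with a ha
    -- For each fixed a the remainder has a zero of order `m c.1` in b, above `c.2`, so it drops out
    -- of the inner coefficient already; its behaviour in a plays no role.
    obtain ⟨e, he⟩ := (hasLead_prodT hμν hφ hnd).2 c.1
    have hz := he.vecKer_right ε
      (Matrix.vecMul (ψ r.1 a) (prodTinv (blocks m μ ν φ ψ n) a)) (ha c.1).symm
    rw [taylorCoeff_sum_mul_upperFun (ε := ε) hμν hφ hnd c
      (fun i j => lowerFun m μ ν φ ψ ε i j r.1 a) hz]
    · exact Finset.sum_congr rfl fun s _ => by ring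
    · filter_upwards [eventually_sq_ne_params (hμν c.1),
        ((continuous_pow 2).continuousAt).eventually_ne (ha c.1).symm] with b hb hab
      exact kernel_telescope hε hμν hnd r.1 c.1 ha hb hab
  have hl := fun s => analyticAt_lowerFun (ε := ε) hμν hψ hnd s r.1
  rw [taylorCoeff_congr inner, taylorCoeff_sum (f := fun (s : Σ i, Fin (m i)) a =>
    ((pivot m μ ν φ ψ ε s.1 s.2)⁻¹ * upperMat m μ ν φ ψ ε s c) *
      lowerFun m μ ν φ ψ ε s.1 s.2 r.1 a) _ fun s _ => analyticAt_const.mul (hl s)]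
  refine Finset.sum_congr rfl fun s _ => (taylorCoeff_const_mul _ _ _ _).trans ?_
  rw [lowerMat, Matrix.of_apply]
  ring

theorem det_bordered_kernel (hε : ε = 1 ∨ ε = -1) (hμν : ∀ i k, μ i ^ 2 ≠ ν k ^ 2)
    (hφ : ∀ i, AnalyticAt ℂ (φ i) (μ i)) (hψ : ∀ i, AnalyticAt ℂ (ψ i) (ν i))
    (hnd : NonDeg m μ ν φ ψ) {P : Matrix (Σ i, Fin (m i)) (Σ i, Fin (m i)) ℂ}
    (hP : ∀ r c, P r c =
      mixedTaylor (fun a b => vecKer ε (ψ r.1 a) (φ c.1 b) a b) (ν r.1) (μ c.1) r.2 c.2) :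
    P.det ≠ 0 ∧
      (Matrix.fromBlocks P (hatCol m ν ψ (1 - colIndex ε)) (hatRow m μ φ (colIndex ε)) 0).det /
        P.det = -∑ i, ∑ j ∈ Finset.range (m i), seedPhi m μ ν φ ψ i j (colIndex ε) *
          seedPsi m μ ν φ ψ i j (1 - colIndex ε) / pivot m μ ν φ ψ ε i j := by
  have hPm : P = lowerMat m μ ν φ ψ ε *
      Matrix.diagonal (fun s : (Σ i, Fin (m i)) => (pivot m μ ν φ ψ ε s.1 s.2)⁻¹) *
      upperMat m μ ν φ ψ ε := by
    ext r c
    rw [hP, mixedTaylor_kernel hε hμν hφ hψ hnd, Matrix.mul_apply]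
    simp only [Matrix.mul_diagonal]
  have hx : ∀ r, hatCol m ν ψ (1 - colIndex ε) r () = ∑ s, lowerMat m μ ν φ ψ ε r s *
      (pivot m μ ν φ ψ ε s.1 s.2)⁻¹ * seedPsi m μ ν φ ψ s.1 s.2 (1 - colIndex ε) := by
    intro r
    obtain ⟨e, he⟩ := (hasLead_prodTinv hμν hψ hnd).2 r.1
    refine taylorCoeff_sum_mul_lowerFun hμν hψ hnd r (F := fun a => ψ r.1 a (1 - colIndex ε))
      (fun i j => seedPsi m μ ν φ ψ i j (1 - colIndex ε)) (he.apply (1 - colIndex ε)) ?_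
    filter_upwards [eventually_sq_ne_params fun i => (hμν i r.1).symm] with a ha
    exact row_telescope hε hμν hnd r.1 ha
  have hy : ∀ c, hatRow m μ φ (colIndex ε) () c = ∑ s : (Σ i, Fin (m i)),
      seedPhi m μ ν φ ψ s.1 s.2 (colIndex ε) * (pivot m μ ν φ ψ ε s.1 s.2)⁻¹ *
        upperMat m μ ν φ ψ ε s c := by
    intro c
    obtain ⟨e, he⟩ := (hasLead_prodT hμν hφ hnd).2 c.1
    refine taylorCoeff_sum_mul_upperFun hμν hφ hnd c (F := fun b => φ c.1 b (colIndex ε))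
      (fun i j => seedPhi m μ ν φ ψ i j (colIndex ε)) (he.apply (colIndex ε)) ?_
    filter_upwards [eventually_sq_ne_params (hμν c.1)] with b hb
    exact column_telescope hε hμν hnd c.1 hb
  obtain ⟨h1, h2⟩ := det_bordered (d := fun s : (Σ i, Fin (m i)) => pivot m μ ν φ ψ ε s.1 s.2)
    (w := fun s => seedPhi m μ ν φ ψ s.1 s.2 (colIndex ε))
    (z := fun s => seedPsi m μ ν φ ψ s.1 s.2 (1 - colIndex ε)) (fun s => pivot_ne_zero hε hμν hnd s.1 s.2.2) hPm
    (det_lowerMat hμν hψ hnd) (det_upperMat hμν hφ hnd) hx hy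
  exact ⟨h1, h2.trans (congrArg Neg.neg (sum_sigma_fin fun i j =>
    seedPhi m μ ν φ ψ i j (colIndex ε) * seedPsi m μ ν φ ψ i j (1 - colIndex ε) /
      pivot m μ ν φ ψ ε i j))⟩

/-- The pivot for ε = 1 is 2 / (α(ν² - μ²)), so the quotient of seed components by the pivot is
precisely A₁₂. -/
theorem det_matP_ne_zero_and_ratioP (hμν : ∀ i k, μ i ^ 2 ≠ ν k ^ 2)
    (hφ : ∀ i, AnalyticAt ℂ (φ i) (μ i)) (hψ : ∀ i, AnalyticAt ℂ (ψ i) (ν i))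
    (hnd : NonDeg m μ ν φ ψ) :
    (matP m μ ν φ ψ).det ≠ 0 ∧ ratioP m μ ν φ ψ =
      -∑ i, ∑ j ∈ Finset.range (m i), (gStep m μ ν φ ψ i j).A 0 1 := by
  have h := det_bordered_kernel (Or.inl rfl) hμν hφ hψ hnd (P := matP m μ ν φ ψ) fun r c => by
    simp only [matP, Matrix.of_apply]
    congr 1
    funext a b
    rw [kerP_eq]
  simp only [colIndex, if_true, sub_zero] at h
  refine ⟨h.1, h.2.trans ?_⟩
  congr 1
  refine Finset.sum_congr rfl fun i _ => Finset.sum_congr rfl fun j _ => ?_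
  have e := binaryStep_A01 (μ := μ i) (ν := ν i) (f := seedPhi m μ ν φ ψ i j)
    (g := seedPsi m μ ν φ ψ i j)
  rw [pivot, vecKer_seed_one (hμν i i), gStep, ← mul_right_inj' (two_ne_zero (α := ℂ)), e]
  rw [div_div_eq_mul_div, mul_div_assoc', mul_comm (2 : ℂ) (alphaInv _ _ _ _), ← div_div,
    mul_div_assoc]
  ring

theorem det_matQ_ne_zero_and_ratioQ (hμν : ∀ i k, μ i ^ 2 ≠ ν k ^ 2)
    (hφ : ∀ i, AnalyticAt ℂ (φ i) (μ i)) (hψ : ∀ i, AnalyticAt ℂ (ψ i) (ν i))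
    (hnd : NonDeg m μ ν φ ψ) :
    (matQ m μ ν φ ψ).det ≠ 0 ∧ ratioQ m μ ν φ ψ =
      -∑ i, ∑ j ∈ Finset.range (m i), (gStep m μ ν φ ψ i j).A 1 0 := by
  have h := det_bordered_kernel (Or.inr rfl) hμν hφ hψ hnd (P := matQ m μ ν φ ψ) fun r c => by
    simp only [matQ, Matrix.of_apply]
    congr 1
    funext a b
    rw [kerQ_eq]
  have hne : (-1 : ℂ) ≠ 1 := by norm_num
  simp only [colIndex, if_neg hne, sub_self] at h
  refine ⟨h.1, h.2.trans ?_⟩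
  congr 1
  refine Finset.sum_congr rfl fun i _ => Finset.sum_congr rfl fun j _ => ?_
  have e := binaryStep_A10 (μ := μ i) (ν := ν i) (f := seedPhi m μ ν φ ψ i j)
    (g := seedPsi m μ ν φ ψ i j)
  rw [pivot, vecKer_seed_neg_one (hμν i i), gStep, ← mul_right_inj' (two_ne_zero (α := ℂ)), e]
  rw [div_div_eq_mul_div, mul_div_assoc', mul_comm (2 : ℂ) (betaInv _ _ _ _), ← div_div,
    mul_div_assoc]
  ring

end Elimination

open Set

/-! ### Partial derivatives -/

section Partial

variable {Ω : Set (ℝ × ℝ)} {f g : ℝ × ℝ → ℂ} {p : ℝ × ℝ}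

theorem hasDerivAt_slice_fst {E : Type*} [NormedAddCommGroup E] [NormedSpace ℝ E] {f : ℝ × ℝ → E}
    {f' : ℝ × ℝ →L[ℝ] E} (hf : HasFDerivAt f f' p) :
    HasDerivAt (fun s : ℝ => f (s, p.2)) (f' (1, 0)) p.1 := by
  have h : HasDerivAt (fun s : ℝ => (s, p.2)) ((1 : ℝ), (0 : ℝ)) p.1 :=
    (hasDerivAt_id p.1).prodMk (hasDerivAt_const p.1 p.2)
  exact HasFDerivAt.comp_hasDerivAt (l := f) (f := fun s : ℝ => (s, p.2)) p.1 hf h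

theorem hasDerivAt_slice_snd {E : Type*} [NormedAddCommGroup E] [NormedSpace ℝ E] {f : ℝ × ℝ → E}
    {f' : ℝ × ℝ →L[ℝ] E} (hf : HasFDerivAt f f' p) :
    HasDerivAt (fun s : ℝ => f (p.1, s)) (f' (0, 1)) p.2 := by
  have h : HasDerivAt (fun s : ℝ => (p.1, s)) ((0 : ℝ), (1 : ℝ)) p.2 :=
    (hasDerivAt_const p.2 p.1).prodMk (hasDerivAt_id p.2)
  exact HasFDerivAt.comp_hasDerivAt (l := f) (f := fun s : ℝ => (p.1, s)) p.2 hf h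

theorem differentiableAt_of_contDiffOn {E F : Type*} [NormedAddCommGroup E] [NormedSpace ℝ E]
    [NormedAddCommGroup F] [NormedSpace ℝ F] {f : E → F} {s : Set E} {x : E}
    (hf : ContDiffOn ℝ ∞ f s) (hs : IsOpen s) (hx : x ∈ s) : DifferentiableAt ℝ f x :=
  (hf.contDiffAt (hs.mem_nhds hx)).differentiableAt (by simp)

theorem dX_eq_fderiv (hf : DifferentiableAt ℝ f p) : dX f p = fderiv ℝ f p (1, 0) :=
  (hasDerivAt_slice_fst hf.hasFDerivAt).deriv

theorem dT_eq_fderiv (hf : DifferentiableAt ℝ f p) : dT f p = fderiv ℝ f p (0, 1) :=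
  (hasDerivAt_slice_snd hf.hasFDerivAt).deriv

theorem hasDerivAt_dX (hΩ : IsOpen Ω) (hf : ContDiffOn ℝ ∞ f Ω) (hp : p ∈ Ω) :
    HasDerivAt (fun s : ℝ => f (s, p.2)) (dX f p) p.1 := by
  have h := differentiableAt_of_contDiffOn hf hΩ hp
  rw [dX_eq_fderiv h]
  exact hasDerivAt_slice_fst h.hasFDerivAt

theorem hasDerivAt_dT (hΩ : IsOpen Ω) (hf : ContDiffOn ℝ ∞ f Ω) (hp : p ∈ Ω) :
    HasDerivAt (fun s : ℝ => f (p.1, s)) (dT f p) p.2 := by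
  have h := differentiableAt_of_contDiffOn hf hΩ hp
  rw [dT_eq_fderiv h]
  exact hasDerivAt_slice_snd h.hasFDerivAt

theorem contDiffOn_fderiv_apply {E F : Type*} [NormedAddCommGroup E] [NormedSpace ℝ E]
    [NormedAddCommGroup F] [NormedSpace ℝ F] {f : E → F} {s : Set E}
    (hf : ContDiffOn ℝ ∞ f s) (hs : IsOpen s) (v : E) :
    ContDiffOn ℝ ∞ (fun x => fderiv ℝ f x v) s :=
  (hf.fderiv_of_isOpen hs (m := ∞) (by simp)).clm_apply contDiffOn_const

theorem contDiffOn_dX (hΩ : IsOpen Ω) (hf : ContDiffOn ℝ ∞ f Ω) : ContDiffOn ℝ ∞ (dX f) Ω :=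
  (contDiffOn_fderiv_apply hf hΩ (1, 0)).congr fun _ hp =>
    dX_eq_fderiv (differentiableAt_of_contDiffOn hf hΩ hp)

theorem eventually_slice_fst (hΩ : IsOpen Ω) (hp : p ∈ Ω) : ∀ᶠ s in 𝓝 p.1, (s, p.2) ∈ Ω := by
  have h : ContinuousAt (fun s : ℝ => (s, p.2)) p.1 := by fun_prop
  exact h.eventually (hΩ.mem_nhds hp)

theorem eventually_slice_snd (hΩ : IsOpen Ω) (hp : p ∈ Ω) : ∀ᶠ s in 𝓝 p.2, (p.1, s) ∈ Ω := by
  have h : ContinuousAt (fun s : ℝ => (p.1, s)) p.2 := by fun_prop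
  exact h.eventually (hΩ.mem_nhds hp)

theorem dX_congr (hΩ : IsOpen Ω) (h : ∀ q ∈ Ω, f q = g q) (hp : p ∈ Ω) : dX f p = dX g p := by
  refine EventuallyEq.deriv_eq ?_
  filter_upwards [eventually_slice_fst hΩ hp] with s hs using h _ hs

theorem dT_congr (hΩ : IsOpen Ω) (h : ∀ q ∈ Ω, f q = g q) (hp : p ∈ Ω) : dT f p = dT g p := by
  refine EventuallyEq.deriv_eq ?_
  filter_upwards [eventually_slice_snd hΩ hp] with s hs using h _ hs

theorem fderiv_fderiv_comm {E F : Type*} [NormedAddCommGroup E] [NormedSpace ℝ E]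
    [NormedAddCommGroup F] [NormedSpace ℝ F] {f : E → F} {s : Set E} {x : E}
    (hf : ContDiffOn ℝ ∞ f s) (hs : IsOpen s) (hx : x ∈ s) (v w : E) :
    fderiv ℝ (fun y => fderiv ℝ f y v) x w = fderiv ℝ (fun y => fderiv ℝ f y w) x v := by
  have h1 : DifferentiableAt ℝ (fderiv ℝ f) x :=
    differentiableAt_of_contDiffOn (hf.fderiv_of_isOpen hs (m := ∞) (by simp)) hs hx
  have h2 : ∀ u : E, fderiv ℝ (fun y => fderiv ℝ f y u) x = (fderiv ℝ (fderiv ℝ f) x).flip u := by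
    intro u
    rw [fderiv_clm_apply h1 (differentiableAt_const u)]
    ext y
    simp
  rw [h2, h2]
  have h3 : IsSymmSndFDerivAt ℝ f x :=
    (hf.contDiffAt (hs.mem_nhds hx)).isSymmSndFDerivAt
      (by rw [minSmoothness_of_isRCLikeNormedField]; exact WithTop.coe_le_coe.2 (le_top : (2 : ℕ∞) ≤ ⊤))
  exact h3 w v

theorem dT_dX_comm (hΩ : IsOpen Ω) (hf : ContDiffOn ℝ ∞ f Ω) (hp : p ∈ Ω) :
    dT (dX f) p = dX (dT f) p := by
  have hd := fun q hq => differentiableAt_of_contDiffOn (x := q) hf hΩ hq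
  rw [dT_congr hΩ (fun q hq => dX_eq_fderiv (hd q hq)) hp,
    dX_congr hΩ (fun q hq => dT_eq_fderiv (hd q hq)) hp,
    dT_eq_fderiv (differentiableAt_of_contDiffOn (contDiffOn_fderiv_apply hf hΩ _) hΩ hp),
    dX_eq_fderiv (differentiableAt_of_contDiffOn (contDiffOn_fderiv_apply hf hΩ _) hΩ hp)]
  exact fderiv_fderiv_comm hf hΩ hp _ _

end Partial

/-! ### Families depending holomorphically on a parameter -/

section Family

variable {W : Set ℂ} {Ω : Set (ℝ × ℝ)} {F : ℂ → ℝ × ℝ → ℂ}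

/-- For a holomorphic function the complex derivative is the real derivative in the direction 1.
Derivatives in the spectral parameter thus become directional derivatives of a jointly smooth
function, and symmetry of second derivatives applies to them. -/
theorem deriv_eq_fderiv_uncurry (hW : IsOpen W) (hΩ : IsOpen Ω)
    (hF : ContDiffOn ℝ ∞ (fun q : ℂ × (ℝ × ℝ) => F q.1 q.2) (W ×ˢ Ω))
    (hol : ∀ p ∈ Ω, DifferentiableOn ℂ (fun ζ => F ζ p) W) {ζ : ℂ} (hζ : ζ ∈ W) {p : ℝ × ℝ}
    (hp : p ∈ Ω) : deriv (fun ζ => F ζ p) ζ =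
      fderiv ℝ (fun q : ℂ × (ℝ × ℝ) => F q.1 q.2) (ζ, p) (1, 0) := by
  have h1 : DifferentiableAt ℝ (fun q : ℂ × (ℝ × ℝ) => F q.1 q.2) (ζ, p) :=
    differentiableAt_of_contDiffOn hF (hW.prod hΩ) ⟨hζ, hp⟩
  have h2 : HasDerivAt (fun ζ => F ζ p) (deriv (fun ζ => F ζ p) ζ) ζ :=
    ((hol p hp).differentiableAt (hW.mem_nhds hζ)).hasDerivAt
  have h3 : HasDerivAt (fun s : ℝ => ζ + (s : ℂ)) 1 0 := by
    simpa using (Complex.ofRealCLM.hasDerivAt (x := (0 : ℝ))).const_add ζ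
  have h4 : HasDerivAt (fun s : ℝ => F (ζ + s) p) (deriv (fun ζ => F ζ p) ζ) 0 := by
    have h2' : HasDerivAt (fun ζ => F ζ p) (deriv (fun ζ => F ζ p) ζ) (ζ + ((0 : ℝ) : ℂ)) := by
      simpa using h2
    have := HasDerivAt.scomp (0 : ℝ) h2' h3
    simpa [Function.comp_def] using this
  have h5 : HasDerivAt (fun s : ℝ => ((ζ + (s : ℂ), p) : ℂ × (ℝ × ℝ))) (1, 0) 0 :=
    h3.prodMk (hasDerivAt_const _ _)
  have h1' : HasFDerivAt (fun q : ℂ × (ℝ × ℝ) => F q.1 q.2)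
      (fderiv ℝ (fun q : ℂ × (ℝ × ℝ) => F q.1 q.2) (ζ, p)) (ζ + ((0 : ℝ) : ℂ), p) := by
    simpa using h1.hasFDerivAt
  have h6 := HasFDerivAt.comp_hasDerivAt (l := fun q : ℂ × (ℝ × ℝ) => F q.1 q.2)
    (f := fun s : ℝ => ((ζ + (s : ℂ), p) : ℂ × (ℝ × ℝ))) 0 h1' h5
  exact h4.unique h6

theorem family_deriv (hW : IsOpen W) (hΩ : IsOpen Ω)
    (hF : ContDiffOn ℝ ∞ (fun q : ℂ × (ℝ × ℝ) => F q.1 q.2) (W ×ˢ Ω))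
    (hol : ∀ p ∈ Ω, DifferentiableOn ℂ (fun ζ => F ζ p) W) :
    ContDiffOn ℝ ∞ (fun q : ℂ × (ℝ × ℝ) => deriv (fun ζ => F ζ q.2) q.1) (W ×ˢ Ω) ∧
      ∀ p ∈ Ω, DifferentiableOn ℂ (fun ζ => deriv (fun ζ => F ζ p) ζ) W :=
  ⟨(contDiffOn_fderiv_apply hF (hW.prod hΩ) (1, 0)).congr fun _ hq =>
      deriv_eq_fderiv_uncurry hW hΩ hF hol hq.1 hq.2,
    fun p hp => (hol p hp).deriv hW⟩

theorem family_iteratedDeriv (hW : IsOpen W) (hΩ : IsOpen Ω)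
    (hF : ContDiffOn ℝ ∞ (fun q : ℂ × (ℝ × ℝ) => F q.1 q.2) (W ×ˢ Ω))
    (hol : ∀ p ∈ Ω, DifferentiableOn ℂ (fun ζ => F ζ p) W) (k : ℕ) :
    ContDiffOn ℝ ∞ (fun q : ℂ × (ℝ × ℝ) => iteratedDeriv k (fun ζ => F ζ q.2) q.1) (W ×ˢ Ω) := by
  induction k generalizing F with
  | zero => simpa using hF
  | succ k ih =>
    obtain ⟨h1, h2⟩ := family_deriv hW hΩ hF hol
    simp only [iteratedDeriv_succ']
    exact ih h1 h2

/-- The induction replaces `F` by its derivative in ζ. The hypothesis `hX`, holomorphy of the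
spatial derivative, must be transported as well, and this uses the case of a single ζ-derivative. -/
theorem fderiv_iteratedDeriv_comm (hW : IsOpen W) (hΩ : IsOpen Ω)
    (hF : ContDiffOn ℝ ∞ (fun q : ℂ × (ℝ × ℝ) => F q.1 q.2) (W ×ˢ Ω))
    (hol : ∀ p ∈ Ω, DifferentiableOn ℂ (fun ζ => F ζ p) W) (e : ℝ × ℝ)
    (hX : ∀ p ∈ Ω, DifferentiableOn ℂ
      (fun ζ => fderiv ℝ (fun q : ℂ × (ℝ × ℝ) => F q.1 q.2) (ζ, p) (0, e)) W) (k : ℕ) {ζ : ℂ}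
    (hζ : ζ ∈ W) {p : ℝ × ℝ} (hp : p ∈ Ω) :
    fderiv ℝ (fun q : ℂ × (ℝ × ℝ) => iteratedDeriv k (fun ζ => F ζ q.2) q.1) (ζ, p) (0, e) =
      iteratedDeriv k
        (fun ζ => fderiv ℝ (fun q : ℂ × (ℝ × ℝ) => F q.1 q.2) (ζ, p) (0, e)) ζ := by
  induction k generalizing F with
  | zero => simp
  | succ k ih =>
    obtain ⟨h1, h2⟩ := family_deriv hW hΩ hF hol
    have hXs := contDiffOn_fderiv_apply hF (hW.prod hΩ) (0, e)
    have key : ∀ p ∈ Ω, ∀ ζ ∈ W,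
        fderiv ℝ (fun q : ℂ × (ℝ × ℝ) => deriv (fun ζ => F ζ q.2) q.1) (ζ, p) (0, e) =
          deriv (fun ζ => fderiv ℝ (fun q : ℂ × (ℝ × ℝ) => F q.1 q.2) (ζ, p) (0, e)) ζ := by
      intro p hp ζ hζ
      have hmem : (ζ, p) ∈ W ×ˢ Ω := ⟨hζ, hp⟩
      have e1 : (fun q : ℂ × (ℝ × ℝ) => deriv (fun ζ => F ζ q.2) q.1) =ᶠ[𝓝 (ζ, p)]
          fun q => fderiv ℝ (fun q : ℂ × (ℝ × ℝ) => F q.1 q.2) q (1, 0) := by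
        filter_upwards [(hW.prod hΩ).mem_nhds hmem] with q hq
        exact deriv_eq_fderiv_uncurry hW hΩ hF hol hq.1 hq.2
      rw [e1.fderiv_eq, fderiv_fderiv_comm hF (hW.prod hΩ) hmem]
      exact (deriv_eq_fderiv_uncurry (F := fun ζ p =>
        fderiv ℝ (fun q : ℂ × (ℝ × ℝ) => F q.1 q.2) (ζ, p) (0, e)) hW hΩ hXs hX hζ hp).symm
    have hX' : ∀ p ∈ Ω, DifferentiableOn ℂ (fun ζ =>
        fderiv ℝ (fun q : ℂ × (ℝ × ℝ) => deriv (fun ζ => F ζ q.2) q.1) (ζ, p) (0, e)) W :=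
      fun p hp => ((hX p hp).deriv hW).congr fun ζ hζ => key p hp ζ hζ
    simp only [iteratedDeriv_succ']
    rw [ih h1 h2 hX']
    refine EventuallyEq.iteratedDeriv_eq k ?_
    filter_upwards [hW.mem_nhds hζ] with w hw using key p hp w hw

end Family

/-- The leading coefficients, at a fixed parameter, of a holomorphic family of solutions of a
linear system depending holomorphically on the parameter, are smooth and solve the system. -/
theorem lead_family {W : Set ℂ} {Ω : Set (ℝ × ℝ)} (hW : IsOpen W) (hΩ : IsOpen Ω)
    {F : ℂ → ℝ × ℝ → Fin 2 → ℂ} {X T : ℂ → ℝ × ℝ → Matrix (Fin 2) (Fin 2) ℂ}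
    (hF : ContDiffOn ℝ ∞ (fun q : ℂ × (ℝ × ℝ) => F q.1 q.2) (W ×ˢ Ω))
    (hol : ∀ p ∈ Ω, DifferentiableOn ℂ (fun ζ => F ζ p) W)
    (hX : ∀ p ∈ Ω, ∀ a b, DifferentiableOn ℂ (fun ζ => X ζ p a b) W)
    (hT : ∀ p ∈ Ω, ∀ a b, DifferentiableOn ℂ (fun ζ => T ζ p a b) W)
    (hsol : ∀ ζ ∈ W, ∀ p ∈ Ω,
      HasDerivAt (fun s : ℝ => F ζ (s, p.2)) ((X ζ p).mulVec (F ζ p)) p.1 ∧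
      HasDerivAt (fun s : ℝ => F ζ (p.1, s)) ((T ζ p).mulVec (F ζ p)) p.2)
    {z : ℂ} (hz : z ∈ W) {k : ℕ} {c : ℝ × ℝ → Fin 2 → ℂ}
    (hc : ∀ p ∈ Ω, HasLead k (fun ζ => F ζ p) z (c p)) :
    (∀ a, ContDiffOn ℝ ∞ (fun p => c p a) Ω) ∧ ∀ p ∈ Ω,
      HasDerivAt (fun s : ℝ => c (s, p.2)) ((X z p).mulVec (c p)) p.1 ∧
      HasDerivAt (fun s : ℝ => c (p.1, s)) ((T z p).mulVec (c p)) p.2 := by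
  have hFa : ∀ a, ContDiffOn ℝ ∞ (fun q : ℂ × (ℝ × ℝ) => F q.1 q.2 a) (W ×ˢ Ω) :=
    fun a => contDiffOn_pi.1 hF a
  have hola : ∀ a, ∀ p ∈ Ω, DifferentiableOn ℂ (fun ζ => F ζ p a) W :=
    fun a p hp => differentiableOn_pi.1 (hol p hp) a
  have hca : ∀ a, ∀ p ∈ Ω, c p a = (1 / (k.factorial : ℂ)) • iteratedDeriv k (fun ζ => F ζ p a) z :=
    fun a p hp => (taylorCoeff_eq_of_hasLead ((hc p hp).apply a)).symm
  have hG := fun a => family_iteratedDeriv hW hΩ (hFa a) (hola a) k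
  have hι : ContDiff ℝ ∞ fun p : ℝ × ℝ => ((z, p) : ℂ × (ℝ × ℝ)) := by fun_prop
  have hsm : ∀ a, ContDiffOn ℝ ∞ (fun p => c p a) Ω := by
    intro a
    have h := (hG a).comp hι.contDiffOn (t := W ×ˢ Ω) (s := Ω) fun p hp => ⟨hz, hp⟩
    exact (h.const_smul (1 / (k.factorial : ℂ))).congr fun p hp => hca a p hp
  refine ⟨hsm, ?_⟩
  -- The direction `e` and the matrix `Y` stand for either half of the linear system, so x and t are
  -- treated together.
  have main : ∀ (e : ℝ × ℝ) (Y : ℂ → ℝ × ℝ → Matrix (Fin 2) (Fin 2) ℂ),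
      (∀ p ∈ Ω, ∀ a b, DifferentiableOn ℂ (fun ζ => Y ζ p a b) W) →
      (∀ a, ∀ ζ ∈ W, ∀ p ∈ Ω, fderiv ℝ (fun q : ℂ × (ℝ × ℝ) => F q.1 q.2 a) (ζ, p) (0, e) =
        (Y ζ p).mulVec (F ζ p) a) →
      ∀ a, ∀ p ∈ Ω, fderiv ℝ (fun p => c p a) p e = (Y z p).mulVec (c p) a := by
    intro e Y hY hYF a p hp
    have hYd : ∀ p ∈ Ω, DifferentiableOn ℂ (fun ζ => (Y ζ p).mulVec (F ζ p) a) W := by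
      intro p hp
      simp only [Matrix.mulVec, dotProduct, Fin.sum_univ_two]
      exact ((hY p hp a 0).mul (hola 0 p hp)).add ((hY p hp a 1).mul (hola 1 p hp))
    have hXe : ∀ p ∈ Ω, DifferentiableOn ℂ
        (fun ζ => fderiv ℝ (fun q : ℂ × (ℝ × ℝ) => F q.1 q.2 a) (ζ, p) (0, e)) W :=
      fun p hp => (hYd p hp).congr fun ζ hζ => hYF a ζ hζ p hp
    have h1 := fderiv_iteratedDeriv_comm (F := fun ζ p => F ζ p a) hW hΩ (hFa a) (hola a) e hXe k
      hz hp
    have hd : DifferentiableAt ℝ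
        (fun q : ℂ × (ℝ × ℝ) => iteratedDeriv k (fun ζ => F ζ q.2 a) q.1) (z, p) :=
      differentiableAt_of_contDiffOn (hG a) (hW.prod hΩ) ⟨hz, hp⟩
    have hι' : HasFDerivAt (fun p : ℝ × ℝ => ((z, p) : ℂ × (ℝ × ℝ)))
        (ContinuousLinearMap.inr ℝ ℂ (ℝ × ℝ)) p := hasFDerivAt_prodMk_right z p
    have h2 := (HasFDerivAt.comp p hd.hasFDerivAt hι').const_smul (1 / (k.factorial : ℂ))
    have h3 : (fun p => c p a) =ᶠ[𝓝 p] fun p =>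
        (1 / (k.factorial : ℂ)) • iteratedDeriv k (fun ζ => F ζ p a) z := by
      filter_upwards [hΩ.mem_nhds hp] with q hq using hca a q hq
    have h4 := h2.congr_of_eventuallyEq h3
    rw [h4.fderiv]
    -- The derivative of `c` is the Taylor coefficient of order k of Y F. All lower coefficients of
    -- F vanish, so only the value of Y at z contributes.
    have h5 : HasLead k (fun ζ => (Y ζ p).mulVec (F ζ p)) z ((Y z p).mulVec (c p)) :=
      (hc p hp).mulVec fun a b => (hY p hp a b).analyticAt (hW.mem_nhds hz)
    rw [← taylorCoeff_eq_of_hasLead (h5.apply a), taylorCoeff]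
    change (1 / (k.factorial : ℂ)) • fderiv ℝ
      (fun q : ℂ × (ℝ × ℝ) => iteratedDeriv k (fun ζ => F ζ q.2 a) q.1) (z, p)
      ((0 : ℂ), e) = _
    rw [h1]
    congr 1
    refine EventuallyEq.iteratedDeriv_eq k ?_
    filter_upwards [hW.mem_nhds hz] with w hw using hYF a w hw p hp
  have hslice : ∀ a, ∀ ζ ∈ W, ∀ p ∈ Ω, HasFDerivAt (fun p => F ζ p a)
      ((fderiv ℝ (fun q : ℂ × (ℝ × ℝ) => F q.1 q.2 a) (ζ, p)).comp
        (ContinuousLinearMap.inr ℝ ℂ (ℝ × ℝ))) p := by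
    intro a ζ hζ p hp
    have hd : DifferentiableAt ℝ (fun q : ℂ × (ℝ × ℝ) => F q.1 q.2 a) (ζ, p) :=
      differentiableAt_of_contDiffOn (hFa a) (hW.prod hΩ) ⟨hζ, hp⟩
    exact HasFDerivAt.comp p hd.hasFDerivAt (hasFDerivAt_prodMk_right ζ p)
  have hx := main (1, 0) X hX fun a ζ hζ p hp =>
    (hasDerivAt_slice_fst (hslice a ζ hζ p hp)).unique (hasDerivAt_pi.1 (hsol ζ hζ p hp).1 a)
  have ht := main (0, 1) T hT fun a ζ hζ p hp =>
    (hasDerivAt_slice_snd (hslice a ζ hζ p hp)).unique (hasDerivAt_pi.1 (hsol ζ hζ p hp).2 a)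
  intro p hp
  refine ⟨hasDerivAt_pi.2 fun a => ?_, hasDerivAt_pi.2 fun a => ?_⟩
  · rw [← hx a p hp]
    exact hasDerivAt_slice_fst (differentiableAt_of_contDiffOn (hsm a) hΩ hp).hasFDerivAt
  · rw [← ht a p hp]
    exact hasDerivAt_slice_snd (differentiableAt_of_contDiffOn (hsm a) hΩ hp).hasFDerivAt

/-! ### One binary step as a Darboux transformation -/

/-- The flux in the conservation law `u_t = (u² v + i u_x)_x`. -/
def fluxU (u v : ℝ × ℝ → ℂ) (p : ℝ × ℝ) : ℂ := u p ^ 2 * v p + Complex.I * dX u p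

/-- The flux in the conservation law `v_t = (u v² - i v_x)_x`. -/
def fluxV (u v : ℝ × ℝ → ℂ) (p : ℝ × ℝ) : ℂ := u p * v p ^ 2 - Complex.I * dX v p

theorem laxU_eq (u v : ℝ × ℝ → ℂ) (ζ : ℂ) (p : ℝ × ℝ) :
    laxU u v ζ p = !![-Complex.I / ζ ^ 2, u p / ζ; v p / ζ, Complex.I / ζ ^ 2] := by
  ext i j
  fin_cases i <;> fin_cases j <;> simp [laxU, sigma3, offDiag] <;> ring

/-- The square of the off-diagonal matrix is the scalar uv, so its cube combines with the term
containing x-derivatives into the two fluxes. -/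
theorem laxV_eq (u v : ℝ × ℝ → ℂ) (ζ : ℂ) (p : ℝ × ℝ) :
    laxV u v ζ p =
      !![-2 * Complex.I / ζ ^ 4 - Complex.I * (u p * v p) / ζ ^ 2,
        2 * u p / ζ ^ 3 + fluxU u v p / ζ;
        2 * v p / ζ ^ 3 + fluxV u v p / ζ,
        2 * Complex.I / ζ ^ 4 + Complex.I * (u p * v p) / ζ ^ 2] := by
  ext i j
  fin_cases i <;> fin_cases j <;>
    simp [laxV, sigma3, offDiag, fluxU, fluxV, pow_succ] <;>
    ring

/-! ### Derivatives of the step coefficients along a curve. -/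

section Curve

variable {μ ν c : ℂ} {F G : ℝ → Fin 2 → ℂ} {F' G' : Fin 2 → ℂ} {s : ℝ}

theorem hasDerivAt_alphaInv (hF : HasDerivAt F (c • F') s) (hG : HasDerivAt G (c • G') s) :
    HasDerivAt (fun s => alphaInv μ ν (F s) (G s))
      (c * (ν * (G' 0 * F s 0 + G s 0 * F' 0) + μ * (G' 1 * F s 1 + G s 1 * F' 1))) s := by
  simp only [alphaInv_eq]
  have hF := hasDerivAt_pi.1 hF
  have hG := hasDerivAt_pi.1 hG
  refine ((((hG 0).const_mul ν).mul (hF 0)).add (((hG 1).const_mul μ).mul (hF 1))).congr_deriv ?_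
  simp only [Pi.smul_apply, smul_eq_mul]
  ring

theorem hasDerivAt_betaInv (hF : HasDerivAt F (c • F') s) (hG : HasDerivAt G (c • G') s) :
    HasDerivAt (fun s => betaInv μ ν (F s) (G s))
      (c * (μ * (G' 0 * F s 0 + G s 0 * F' 0) + ν * (G' 1 * F s 1 + G s 1 * F' 1))) s := by
  simp only [betaInv_eq]
  have hF := hasDerivAt_pi.1 hF
  have hG := hasDerivAt_pi.1 hG
  refine ((((hG 0).const_mul μ).mul (hF 0)).add (((hG 1).const_mul ν).mul (hF 1))).congr_deriv ?_
  simp only [Pi.smul_apply, smul_eq_mul]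
  ring

theorem hasDerivAt_A01 (hF : HasDerivAt F (c • F') s) (hG : HasDerivAt G (c • G') s)
    (h1 : alphaInv μ ν (F s) (G s) ≠ 0) :
    HasDerivAt (fun s => 2 * (binaryStep μ ν (F s) (G s)).A 0 1)
      (c * ((ν ^ 2 - μ ^ 2) * ((F' 0 * G s 1 + F s 0 * G' 1) * alphaInv μ ν (F s) (G s)
        - F s 0 * G s 1 * (ν * (G' 0 * F s 0 + G s 0 * F' 0) + μ * (G' 1 * F s 1 + G s 1 * F' 1)))
        / alphaInv μ ν (F s) (G s) ^ 2)) s := by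
  simp only [binaryStep_A01]
  refine ((((hasDerivAt_pi.1 hF 0).mul (hasDerivAt_pi.1 hG 1)).const_mul _).fun_div
    (hasDerivAt_alphaInv hF hG) h1).congr_deriv ?_
  simp only [Pi.mul_apply, Pi.smul_apply, smul_eq_mul]
  ring

/-- The value is arranged as in `hasDerivAt_A01` with the components 0 and 1 exchanged, so that the
same algebraic lemmas apply. -/
theorem hasDerivAt_A10 (hF : HasDerivAt F (c • F') s) (hG : HasDerivAt G (c • G') s)
    (h2 : betaInv μ ν (F s) (G s) ≠ 0) :
    HasDerivAt (fun s => 2 * (binaryStep μ ν (F s) (G s)).A 1 0)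
      (c * ((ν ^ 2 - μ ^ 2) * ((F' 1 * G s 0 + F s 1 * G' 0) * betaInv μ ν (F s) (G s)
        - F s 1 * G s 0 * (ν * (G' 1 * F s 1 + G s 1 * F' 1) + μ * (G' 0 * F s 0 + G s 0 * F' 0)))
        / betaInv μ ν (F s) (G s) ^ 2)) s := by
  simp only [binaryStep_A10]
  refine ((((hasDerivAt_pi.1 hF 1).mul (hasDerivAt_pi.1 hG 0)).const_mul _).fun_div
    (hasDerivAt_betaInv hF hG) h2).congr_deriv ?_
  simp only [Pi.mul_apply, Pi.smul_apply, smul_eq_mul]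
  ring

/-- Unlike `binaryStep_A01`, the closed form `binaryStep_A00` needs `alphaInv` to be nonzero, so
this is required near s and not only at s. -/
theorem hasDerivAt_A00 (hF : HasDerivAt F (c • F') s) (hG : HasDerivAt G (c • G') s)
    (h1 : ∀ᶠ t in 𝓝 s, alphaInv μ ν (F t) (G t) ≠ 0) :
    HasDerivAt (fun s => 2 * ν * (binaryStep μ ν (F s) (G s)).A 0 0 - ν ^ 2)
      (c * (-(μ * ν) * ((μ * (G' 0 * F s 0 + G s 0 * F' 0) + ν * (G' 1 * F s 1 + G s 1 * F' 1))
          * alphaInv μ ν (F s) (G s) - betaInv μ ν (F s) (G s) *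
          (ν * (G' 0 * F s 0 + G s 0 * F' 0) + μ * (G' 1 * F s 1 + G s 1 * F' 1)))
        / alphaInv μ ν (F s) (G s) ^ 2)) s := by
  have h := ((hasDerivAt_betaInv (μ := μ) (ν := ν) hF hG).const_mul (-(μ * ν))).fun_div
    (hasDerivAt_alphaInv hF hG) h1.self_of_nhds
  refine (h.congr_of_eventuallyEq ?_).congr_deriv (by ring)
  filter_upwards [h1] with t ht using binaryStep_A00 ht

theorem hasDerivAt_A11 (hF : HasDerivAt F (c • F') s) (hG : HasDerivAt G (c • G') s)
    (h2 : ∀ᶠ t in 𝓝 s, betaInv μ ν (F t) (G t) ≠ 0) :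
    HasDerivAt (fun s => 2 * ν * (binaryStep μ ν (F s) (G s)).A 1 1 - ν ^ 2)
      (c * (-(μ * ν) * ((μ * (G' 1 * F s 1 + G s 1 * F' 1) + ν * (G' 0 * F s 0 + G s 0 * F' 0))
          * betaInv μ ν (F s) (G s) - alphaInv μ ν (F s) (G s) *
          (ν * (G' 1 * F s 1 + G s 1 * F' 1) + μ * (G' 0 * F s 0 + G s 0 * F' 0)))
        / betaInv μ ν (F s) (G s) ^ 2)) s := by
  have h := ((hasDerivAt_alphaInv (μ := μ) (ν := ν) hF hG).const_mul (-(μ * ν))).fun_div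
    (hasDerivAt_betaInv hF hG) h2.self_of_nhds
  refine (h.congr_of_eventuallyEq ?_).congr_deriv (by ring)
  filter_upwards [h2] with t ht using binaryStep_A11 ht

end Curve

/-! #### Smoothness of the residues -/

section Smooth

variable {Ω : Set (ℝ × ℝ)} {μ ν : ℂ} {f g : ℝ × ℝ → Fin 2 → ℂ}

theorem contDiffOn_alphaInv (hf : ∀ a, ContDiffOn ℝ ∞ (fun p => f p a) Ω)
    (hg : ∀ a, ContDiffOn ℝ ∞ (fun p => g p a) Ω) :
    ContDiffOn ℝ ∞ (fun p => alphaInv μ ν (f p) (g p)) Ω := by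
  simp only [alphaInv_eq]
  exact ((contDiffOn_const.mul (hg 0)).mul (hf 0)).add ((contDiffOn_const.mul (hg 1)).mul (hf 1))

theorem contDiffOn_betaInv (hf : ∀ a, ContDiffOn ℝ ∞ (fun p => f p a) Ω)
    (hg : ∀ a, ContDiffOn ℝ ∞ (fun p => g p a) Ω) :
    ContDiffOn ℝ ∞ (fun p => betaInv μ ν (f p) (g p)) Ω := by
  simp only [betaInv_eq]
  exact ((contDiffOn_const.mul (hg 0)).mul (hf 0)).add ((contDiffOn_const.mul (hg 1)).mul (hf 1))

theorem contDiffOn_binaryStep (hf : ∀ a, ContDiffOn ℝ ∞ (fun p => f p a) Ω)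
    (hg : ∀ a, ContDiffOn ℝ ∞ (fun p => g p a) Ω)
    (h1 : ∀ p ∈ Ω, alphaInv μ ν (f p) (g p) ≠ 0) (h2 : ∀ p ∈ Ω, betaInv μ ν (f p) (g p) ≠ 0)
    (a b : Fin 2) :
    ContDiffOn ℝ ∞ (fun p => (binaryStep μ ν (f p) (g p)).A a b) Ω ∧
      ContDiffOn ℝ ∞ (fun p => (binaryStep μ ν (f p) (g p)).B a b) Ω := by
  have k1 := (contDiffOn_alphaInv (μ := μ) (ν := ν) hf hg).inv h1
  have k2 := (contDiffOn_betaInv (μ := μ) (ν := ν) hf hg).inv h2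
  have hfg : ∀ a b, ContDiffOn ℝ ∞ (fun p => f p a * g p b) Ω := fun a b => (hf a).mul (hg b)
  constructor
  · simp only [binaryStep, Matrix.smul_apply, Matrix.diagonal_mul, Matrix.vecMulVec_apply]
    refine ContDiffOn.const_smul _ (ContDiffOn.mul ?_ (hfg a b))
    fin_cases a
    · exact k1
    · exact k2
  · simp only [binaryStep, Matrix.smul_apply, Matrix.mul_diagonal, Matrix.vecMulVec_apply]
    refine ContDiffOn.const_smul _ (ContDiffOn.mul (hfg a b) ?_)
    fin_cases b
    · exact k2
    · exact k1

end Smooth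

/-! ### Comparison of powers of ζ in the Darboux equations. -/

section Pointwise

open Complex

variable {ζ u v u' v' β γ P R q r q' r' : ℂ}

/-- The hypotheses are the vanishing of the 1/ζ terms off the diagonal; what remains is the
x-derivative prescribed for the polynomial matrix. -/
theorem lax_x_mul_sub (hζ : ζ ≠ 0) (h1 : u' * R = u * P + 2 * I * β)
    (h2 : v' * P = v * R - 2 * I * γ) :
    !![-I / ζ ^ 2, u' / ζ; v' / ζ, I / ζ ^ 2] * !![ζ ^ 2 + P, ζ * β; ζ * γ, ζ ^ 2 + R] -
        !![ζ ^ 2 + P, ζ * β; ζ * γ, ζ ^ 2 + R] * !![-I / ζ ^ 2, u / ζ; v / ζ, I / ζ ^ 2] =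
      !![u' * γ - β * v, ζ * (u' - u); ζ * (v' - v), v' * β - γ * u] := by
  ext i j
  fin_cases i <;> fin_cases j <;> simp <;> field_simp
  · ring
  · linear_combination h1
  · linear_combination h2
  · ring

theorem lax_x_mul_sub_conj (hζ : ζ ≠ 0) (h1 : u' * R = u * P + 2 * I * β)
    (h2 : v' * P = v * R - 2 * I * γ) :
    !![-I / ζ ^ 2, u / ζ; v / ζ, I / ζ ^ 2] * !![ζ ^ 2 + R, -(ζ * β); -(ζ * γ), ζ ^ 2 + P] -
        !![ζ ^ 2 + R, -(ζ * β); -(ζ * γ), ζ ^ 2 + P] * !![-I / ζ ^ 2, u' / ζ; v' / ζ, I / ζ ^ 2] =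
      !![v' * β - γ * u, -(ζ * (u' - u)); -(ζ * (v' - v)), u' * γ - β * v] := by
  ext i j
  fin_cases i <;> fin_cases j <;> simp <;> field_simp
  · ring
  · linear_combination -h1
  · linear_combination -h2
  · ring

/-- Off the diagonal, `h1` and `h2` remove the ζ⁻³ terms and `h5`, `h6` the ζ⁻¹ terms; on the
diagonal `h3` and `h4` remove the ζ⁻² terms. -/
theorem lax_t_mul_sub (hζ : ζ ≠ 0) (h1 : u' * R = u * P + 2 * I * β)
    (h2 : v' * P = v * R - 2 * I * γ)
    (h3 : -I * (u' * v' - u * v) * P + 2 * u' * γ - 2 * v * β = 0)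
    (h4 : I * (u' * v' - u * v) * R + 2 * v' * β - 2 * u * γ = 0)
    (h5 : -I * (u * v + u' * v') * β + 2 * (u' - u) + q' * R - q * P = 0)
    (h6 : I * (u * v + u' * v') * γ + 2 * (v' - v) + r' * P - r * R = 0) :
    !![-2 * I / ζ ^ 4 - I * (u' * v') / ζ ^ 2, 2 * u' / ζ ^ 3 + q' / ζ;
          2 * v' / ζ ^ 3 + r' / ζ, 2 * I / ζ ^ 4 + I * (u' * v') / ζ ^ 2] *
          !![ζ ^ 2 + P, ζ * β; ζ * γ, ζ ^ 2 + R] -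
        !![ζ ^ 2 + P, ζ * β; ζ * γ, ζ ^ 2 + R] *
          !![-2 * I / ζ ^ 4 - I * (u * v) / ζ ^ 2, 2 * u / ζ ^ 3 + q / ζ;
            2 * v / ζ ^ 3 + r / ζ, 2 * I / ζ ^ 4 + I * (u * v) / ζ ^ 2] =
      !![-I * (u' * v' - u * v) + q' * γ - β * r, ζ * (q' - q);
        ζ * (r' - r), I * (u' * v' - u * v) + r' * β - γ * q] := by
  ext i j
  fin_cases i <;> fin_cases j <;> simp <;> field_simp
  · linear_combination ζ ^ 2 * h3
  · linear_combination 2 * h1 + ζ ^ 2 * h5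
  · linear_combination 2 * h2 + ζ ^ 2 * h6
  · linear_combination ζ ^ 2 * h4

theorem lax_t_mul_sub_conj (hζ : ζ ≠ 0) (h1 : u' * R = u * P + 2 * I * β)
    (h2 : v' * P = v * R - 2 * I * γ)
    (h3 : -I * (u' * v' - u * v) * P + 2 * u' * γ - 2 * v * β = 0)
    (h4 : I * (u' * v' - u * v) * R + 2 * v' * β - 2 * u * γ = 0)
    (h5 : -I * (u * v + u' * v') * β + 2 * (u' - u) + q' * R - q * P = 0)
    (h6 : I * (u * v + u' * v') * γ + 2 * (v' - v) + r' * P - r * R = 0) :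
    !![-2 * I / ζ ^ 4 - I * (u * v) / ζ ^ 2, 2 * u / ζ ^ 3 + q / ζ;
          2 * v / ζ ^ 3 + r / ζ, 2 * I / ζ ^ 4 + I * (u * v) / ζ ^ 2] *
          !![ζ ^ 2 + R, -(ζ * β); -(ζ * γ), ζ ^ 2 + P] -
        !![ζ ^ 2 + R, -(ζ * β); -(ζ * γ), ζ ^ 2 + P] *
          !![-2 * I / ζ ^ 4 - I * (u' * v') / ζ ^ 2, 2 * u' / ζ ^ 3 + q' / ζ;
            2 * v' / ζ ^ 3 + r' / ζ, 2 * I / ζ ^ 4 + I * (u' * v') / ζ ^ 2] =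
      !![I * (u' * v' - u * v) + r' * β - γ * q, -(ζ * (q' - q));
        -(ζ * (r' - r)), -I * (u' * v' - u * v) + q' * γ - β * r] := by
  ext i j
  fin_cases i <;> fin_cases j <;> simp <;> field_simp
  · linear_combination ζ ^ 2 * h4
  · linear_combination -2 * h1 - ζ ^ 2 * h5
  · linear_combination -2 * h2 - ζ ^ 2 * h6
  · linear_combination ζ ^ 2 * h3

end Pointwise

/-! ### From the coefficient relations to Darboux matrices. -/

section Darboux

/-- The relations between the coefficients `β, γ, P, R` of the polynomial matrix
`[[ζ² + P, ζ β], [ζ γ, ζ² + R]]` and the fields which make it a Darboux matrix. -/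
structure StepRelations (u v u' v' β γ P R : ℝ × ℝ → ℂ) (p : ℝ × ℝ) : Prop where
  β_x : HasDerivAt (fun s : ℝ => β (s, p.2)) (u' p - u p) p.1
  γ_x : HasDerivAt (fun s : ℝ => γ (s, p.2)) (v' p - v p) p.1
  P_x : HasDerivAt (fun s : ℝ => P (s, p.2)) (u' p * γ p - β p * v p) p.1
  R_x : HasDerivAt (fun s : ℝ => R (s, p.2)) (v' p * β p - γ p * u p) p.1
  β_t : HasDerivAt (fun s : ℝ => β (p.1, s)) (fluxU u' v' p - fluxU u v p) p.2
  γ_t : HasDerivAt (fun s : ℝ => γ (p.1, s)) (fluxV u' v' p - fluxV u v p) p.2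
  P_t : HasDerivAt (fun s : ℝ => P (p.1, s)) (-Complex.I * (u' p * v' p - u p * v p)
    + fluxU u' v' p * γ p - β p * fluxV u v p) p.2
  R_t : HasDerivAt (fun s : ℝ => R (p.1, s)) (Complex.I * (u' p * v' p - u p * v p)
    + fluxV u' v' p * β p - γ p * fluxU u v p) p.2
  rel_u : u' p * R p = u p * P p + 2 * Complex.I * β p
  rel_v : v' p * P p = v p * R p - 2 * Complex.I * γ p
  rel_P : -Complex.I * (u' p * v' p - u p * v p) * P p + 2 * u' p * γ p - 2 * v p * β p = 0
  rel_R : Complex.I * (u' p * v' p - u p * v p) * R p + 2 * v' p * β p - 2 * u p * γ p = 0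
  rel_fluxU : -Complex.I * (u p * v p + u' p * v' p) * β p + 2 * (u' p - u p)
    + fluxU u' v' p * R p - fluxU u v p * P p = 0
  rel_fluxV : Complex.I * (u p * v p + u' p * v' p) * γ p + 2 * (v' p - v p)
    + fluxV u' v' p * P p - fluxV u v p * R p = 0

variable {u v u' v' β γ P R : ℝ × ℝ → ℂ} {Ω : Set (ℝ × ℝ)} {ζ : ℂ}

theorem StepRelations.isDarboux (h : ∀ p ∈ Ω, StepRelations u v u' v' β γ P R p) (hζ : ζ ≠ 0)
    (c : ℂ) {D : ℝ × ℝ → Matrix (Fin 2) (Fin 2) ℂ}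
    (hD : ∀ p, D p = c • !![ζ ^ 2 + P p, ζ * β p; ζ * γ p, ζ ^ 2 + R p]) :
    IsDarboux u v u' v' Ω ζ D := by
  intro p hp a b
  obtain ⟨b1, b2, b3, b4, b5, b6, b7, b8, h1, h2, h3, h4, h5, h6⟩ := h p hp
  simp only [hD]
  rw [laxU_eq, laxU_eq, laxV_eq, laxV_eq, Matrix.mul_smul, Matrix.smul_mul, Matrix.mul_smul,
    Matrix.smul_mul, ← smul_sub, ← smul_sub, lax_x_mul_sub hζ h1 h2,
    lax_t_mul_sub hζ h1 h2 h3 h4 h5 h6]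
  fin_cases a <;> fin_cases b <;> simp only [Matrix.smul_apply]
  · exact ⟨(b3.const_add _).const_smul c, (b7.const_add _).const_smul c⟩
  · exact ⟨(b1.const_mul _).const_smul c, (b5.const_mul _).const_smul c⟩
  · exact ⟨(b2.const_mul _).const_smul c, (b6.const_mul _).const_smul c⟩
  · exact ⟨(b4.const_add _).const_smul c, (b8.const_add _).const_smul c⟩

theorem StepRelations.isConjDarboux (h : ∀ p ∈ Ω, StepRelations u v u' v' β γ P R p) (hζ : ζ ≠ 0)
    (c : ℂ) {E : ℝ × ℝ → Matrix (Fin 2) (Fin 2) ℂ}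
    (hE : ∀ p ∈ Ω, E p = c • !![ζ ^ 2 + R p, -(ζ * β p); -(ζ * γ p), ζ ^ 2 + P p])
    (hΩ : IsOpen Ω) :
    IsConjDarboux u v u' v' Ω ζ E := by
  intro p hp a b
  obtain ⟨b1, b2, b3, b4, b5, b6, b7, b8, h1, h2, h3, h4, h5, h6⟩ := h p hp
  -- The formula for `E` is given only on Ω, but the derivative depends only on nearby points of the
  -- slice, which lie in the open set Ω.
  have e1 : (fun s : ℝ => E (s, p.2) a b) =ᶠ[𝓝 p.1] fun s => (c • !![ζ ^ 2 + R (s, p.2),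
      -(ζ * β (s, p.2)); -(ζ * γ (s, p.2)), ζ ^ 2 + P (s, p.2)]) a b := by
    filter_upwards [eventually_slice_fst hΩ hp] with s hs
    rw [hE _ hs]
  have e2 : (fun s : ℝ => E (p.1, s) a b) =ᶠ[𝓝 p.2] fun s => (c • !![ζ ^ 2 + R (p.1, s),
      -(ζ * β (p.1, s)); -(ζ * γ (p.1, s)), ζ ^ 2 + P (p.1, s)]) a b := by
    filter_upwards [eventually_slice_snd hΩ hp] with s hs
    rw [hE _ hs]
  rw [e1.hasDerivAt_iff, e2.hasDerivAt_iff, hE p hp]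
  rw [laxU_eq, laxU_eq, laxV_eq, laxV_eq, Matrix.mul_smul, Matrix.smul_mul, Matrix.mul_smul,
    Matrix.smul_mul, ← smul_sub, ← smul_sub, lax_x_mul_sub_conj hζ h1 h2,
    lax_t_mul_sub_conj hζ h1 h2 h3 h4 h5 h6]
  fin_cases a <;> fin_cases b <;> simp only [Matrix.smul_apply]
  · exact ⟨(b4.const_add _).const_smul c, (b8.const_add _).const_smul c⟩
  · exact ⟨(b1.const_mul _).neg.const_smul c, (b5.const_mul _).neg.const_smul c⟩
  · exact ⟨(b2.const_mul _).neg.const_smul c, (b6.const_mul _).neg.const_smul c⟩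
  · exact ⟨(b3.const_add _).const_smul c, (b7.const_add _).const_smul c⟩

end Darboux

/-! ### The coefficient relations for one binary step. -/

section Relations

variable {Ω : Set (ℝ × ℝ)} {u v : ℝ × ℝ → ℂ} {μ ν : ℂ} {f g : ℝ × ℝ → Fin 2 → ℂ}

/-- Dividing the derivative by i and scaling the fields by -i gives the normalization without
imaginary unit used in the algebraic lemmas; the three companions below do the same for the t-part
and for rows. -/
theorem SolvesLax.deriv_x (hf : SolvesLax u v Ω μ f) {p : ℝ × ℝ} (hp : p ∈ Ω) :
    ∃ F : Fin 2 → ℂ, HasDerivAt (fun s : ℝ => f (s, p.2)) (Complex.I • F) p.1 ∧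
      F 0 = -f p 0 / μ ^ 2 + (-Complex.I * u p) * f p 1 / μ ∧
      F 1 = f p 1 / μ ^ 2 + (-Complex.I * v p) * f p 0 / μ := by
  have hI := Complex.I_mul_I
  refine ⟨-Complex.I • (laxU u v μ p).mulVec (f p), ?_, ?_, ?_⟩
  · rw [smul_smul, mul_neg, hI, neg_neg, one_smul]
    exact (hf p hp).1
  all_goals
    simp only [laxU_eq, Pi.smul_apply, Matrix.mulVec, dotProduct, Fin.sum_univ_two, smul_eq_mul,
      Matrix.of_apply, Matrix.cons_val_zero, Matrix.cons_val_one, Matrix.cons_val',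
      Matrix.cons_val_fin_one]
  · linear_combination (f p 0 / μ ^ 2) * hI
  · linear_combination -(f p 1 / μ ^ 2) * hI

theorem SolvesLax.deriv_t (hf : SolvesLax u v Ω μ f) {p : ℝ × ℝ} (hp : p ∈ Ω) :
    ∃ F : Fin 2 → ℂ, HasDerivAt (fun s : ℝ => f (p.1, s)) (Complex.I • F) p.2 ∧
      F 0 = (-2 / μ ^ 4 + (-Complex.I * u p) * (-Complex.I * v p) / μ ^ 2) * f p 0
        + (2 * (-Complex.I * u p) / μ ^ 3
          - ((-Complex.I * u p) ^ 2 * (-Complex.I * v p) + -dX u p) / μ) * f p 1 ∧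
      F 1 = -(-2 / μ ^ 4 + (-Complex.I * u p) * (-Complex.I * v p) / μ ^ 2) * f p 1
        + (2 * (-Complex.I * v p) / μ ^ 3
          - ((-Complex.I * u p) * (-Complex.I * v p) ^ 2 - -dX v p) / μ) * f p 0 := by
  have hI := Complex.I_mul_I
  refine ⟨-Complex.I • (laxV u v μ p).mulVec (f p), ?_, ?_, ?_⟩
  · rw [smul_smul, mul_neg, hI, neg_neg, one_smul]
    exact (hf p hp).2
  all_goals
    simp only [laxV_eq, Pi.smul_apply, Matrix.mulVec, dotProduct, Fin.sum_univ_two, smul_eq_mul,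
      Matrix.of_apply, Matrix.cons_val_zero, Matrix.cons_val_one, Matrix.cons_val',
      Matrix.cons_val_fin_one, fluxU, fluxV]
  · linear_combination (2 * f p 0 / μ ^ 4 - dX u p / μ * f p 1
      - Complex.I * u p ^ 2 * v p / μ * f p 1) * hI
  · linear_combination (-2 * f p 1 / μ ^ 4 + dX v p / μ * f p 0
      - Complex.I * u p * v p ^ 2 / μ * f p 0) * hI

theorem SolvesConjLax.deriv_x (hg : SolvesConjLax u v Ω ν g) {p : ℝ × ℝ} (hp : p ∈ Ω) :
    ∃ G : Fin 2 → ℂ, HasDerivAt (fun s : ℝ => g (s, p.2)) (Complex.I • G) p.1 ∧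
      G 0 = g p 0 / ν ^ 2 - (-Complex.I * v p) * g p 1 / ν ∧
      G 1 = -g p 1 / ν ^ 2 - (-Complex.I * u p) * g p 0 / ν := by
  have hI := Complex.I_mul_I
  refine ⟨-Complex.I • -Matrix.vecMul (g p) (laxU u v ν p), ?_, ?_, ?_⟩
  · rw [smul_smul, mul_neg, hI, neg_neg, one_smul]
    exact (hg p hp).1
  all_goals
    simp only [laxU_eq, Pi.smul_apply, Pi.neg_apply, Matrix.vecMul, dotProduct,
      Fin.sum_univ_two, smul_eq_mul,
      Matrix.of_apply, Matrix.cons_val_zero, Matrix.cons_val_one, Matrix.cons_val',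
      Matrix.cons_val_fin_one]
  · linear_combination -(g p 0 / ν ^ 2) * hI
  · linear_combination (g p 1 / ν ^ 2) * hI

theorem SolvesConjLax.deriv_t (hg : SolvesConjLax u v Ω ν g) {p : ℝ × ℝ} (hp : p ∈ Ω) :
    ∃ G : Fin 2 → ℂ, HasDerivAt (fun s : ℝ => g (p.1, s)) (Complex.I • G) p.2 ∧
      G 0 = -(-2 / ν ^ 4 + (-Complex.I * u p) * (-Complex.I * v p) / ν ^ 2) * g p 0
        - (2 * (-Complex.I * v p) / ν ^ 3
          - ((-Complex.I * u p) * (-Complex.I * v p) ^ 2 - -dX v p) / ν) * g p 1 ∧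
      G 1 = (-2 / ν ^ 4 + (-Complex.I * u p) * (-Complex.I * v p) / ν ^ 2) * g p 1
        - (2 * (-Complex.I * u p) / ν ^ 3
          - ((-Complex.I * u p) ^ 2 * (-Complex.I * v p) + -dX u p) / ν) * g p 0 := by
  have hI := Complex.I_mul_I
  refine ⟨-Complex.I • -Matrix.vecMul (g p) (laxV u v ν p), ?_, ?_, ?_⟩
  · rw [smul_smul, mul_neg, hI, neg_neg, one_smul]
    exact (hg p hp).2
  all_goals
    simp only [laxV_eq, Pi.smul_apply, Pi.neg_apply, Matrix.vecMul, dotProduct,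
      Fin.sum_univ_two, smul_eq_mul,
      Matrix.of_apply, Matrix.cons_val_zero, Matrix.cons_val_one, Matrix.cons_val',
      Matrix.cons_val_fin_one, fluxU, fluxV]
  · linear_combination (-2 * g p 0 / ν ^ 4 - dX v p / ν * g p 1
      + Complex.I * u p * v p ^ 2 / ν * g p 1) * hI
  · linear_combination (2 * g p 1 / ν ^ 4 + dX u p / ν * g p 0
      + Complex.I * u p ^ 2 * v p / ν * g p 0) * hI

theorem neg_I_mul_of_eq {a b : ℂ} (h : a = Complex.I * b) : -Complex.I * a = b := by
  rw [h, ← mul_assoc, neg_mul, Complex.I_mul_I, neg_neg, one_mul]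

theorem I_mul_of_eq {a b : ℂ} (h : a = -Complex.I * b) : Complex.I * a = b := by
  rw [h, ← mul_assoc, mul_neg, Complex.I_mul_I, neg_neg, one_mul]

theorem hasDerivAt_neg_smul_neg {E : Type*} [NormedAddCommGroup E] [NormedSpace ℝ E]
    [Module ℂ E] {F : ℝ → E} {F' : E} {s : ℝ} {c : ℂ} (h : HasDerivAt F (c • F') s) :
    HasDerivAt F (-c • -F') s := by
  simpa using h

/-- The fields produced by one binary step, and the coefficients of its Darboux matrix, satisfy
the relations of a Darboux matrix. -/
theorem binaryStep_relations (hΩ : IsOpen Ω) (hu : ContDiffOn ℝ ∞ u Ω) (hv : ContDiffOn ℝ ∞ v Ω)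
    (hμ : μ ≠ 0) (hν : ν ≠ 0)
    (hfs : ∀ a, ContDiffOn ℝ ∞ (fun p => f p a) Ω) (hgs : ∀ a, ContDiffOn ℝ ∞ (fun p => g p a) Ω)
    (hf : SolvesLax u v Ω μ f) (hg : SolvesConjLax u v Ω ν g)
    (h1 : ∀ p ∈ Ω, alphaInv μ ν (f p) (g p) ≠ 0) (h2 : ∀ p ∈ Ω, betaInv μ ν (f p) (g p) ≠ 0)
    {u' v' β γ P R : ℝ × ℝ → ℂ} (hu' : u' = fun p => u p + dX β p)
    (hv' : v' = fun p => v p + dX γ p)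
    (hβ : β = fun p => 2 * (binaryStep μ ν (f p) (g p)).A 0 1)
    (hγ : γ = fun p => 2 * (binaryStep μ ν (f p) (g p)).A 1 0)
    (hP : P = fun p => 2 * ν * (binaryStep μ ν (f p) (g p)).A 0 0 - ν ^ 2)
    (hR : R = fun p => 2 * ν * (binaryStep μ ν (f p) (g p)).A 1 1 - ν ^ 2) :
    ∀ p ∈ Ω, StepRelations u v u' v' β γ P R p := by
  have hI := Complex.I_mul_I
  have hA := fun a b => (contDiffOn_binaryStep hfs hgs h1 h2 a b).1
  have hβs : ContDiffOn ℝ ∞ β Ω := by rw [hβ]; exact contDiffOn_const.mul (hA 0 1)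
  have hγs : ContDiffOn ℝ ∞ γ Ω := by rw [hγ]; exact contDiffOn_const.mul (hA 1 0)
  have hu's : ContDiffOn ℝ ∞ u' Ω := by rw [hu']; exact hu.add (contDiffOn_dX hΩ hβs)
  have hv's : ContDiffOn ℝ ∞ v' Ω := by rw [hv']; exact hv.add (contDiffOn_dX hΩ hγs)
  have βx : ∀ p ∈ Ω, HasDerivAt (fun s : ℝ => β (s, p.2)) (u' p - u p) p.1 := by
    intro p hp
    refine (hasDerivAt_dX hΩ hβs hp).congr_deriv ?_
    rw [hu']; ring
  have γx : ∀ p ∈ Ω, HasDerivAt (fun s : ℝ => γ (s, p.2)) (v' p - v p) p.1 := by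
    intro p hp
    refine (hasDerivAt_dX hΩ hγs hp).congr_deriv ?_
    rw [hv']; ring
  have eβ : ∀ p, β p = (ν ^ 2 - μ ^ 2) * (f p 0 * g p 1) / alphaInv μ ν (f p) (g p) :=
    fun p => by rw [hβ]; exact binaryStep_A01
  have eγ : ∀ p, γ p = (ν ^ 2 - μ ^ 2) * (f p 1 * g p 0) / betaInv μ ν (f p) (g p) :=
    fun p => by rw [hγ]; exact binaryStep_A10
  have eP : ∀ p ∈ Ω, P p = -(μ * ν) * betaInv μ ν (f p) (g p) / alphaInv μ ν (f p) (g p) :=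
    fun p hp => by rw [hP]; exact binaryStep_A00 (h1 p hp)
  have eR : ∀ p ∈ Ω, R p = -(μ * ν) * alphaInv μ ν (f p) (g p) / betaInv μ ν (f p) (g p) :=
    fun p hp => by rw [hR]; exact binaryStep_A11 (h2 p hp)
  have eα : ∀ p, betaInv μ ν (f p) (g p) = ν * g p 1 * f p 1 + μ * g p 0 * f p 0 :=
    fun p => by rw [betaInv_eq]; ring
  have eα' : ∀ p, alphaInv μ ν (f p) (g p) = μ * g p 1 * f p 1 + ν * g p 0 * f p 0 :=
    fun p => by rw [alphaInv_eq]; ring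
  -- The new field is defined through β_x, yet after inserting the Lax equations it is an algebraic
  -- expression in the seeds and the old fields. This relation drives all the others.
  have rel_u : ∀ p ∈ Ω, u' p * R p = u p * P p + 2 * Complex.I * β p := by
    intro p hp
    obtain ⟨F, hF, hF0, hF1⟩ := hf.deriv_x hp
    obtain ⟨G, hG, hG0, hG1⟩ := hg.deriv_x hp
    have hd := neg_I_mul_of_eq ((βx p hp).unique (by
      rw [hβ]; exact hasDerivAt_A01 hF hG (h1 p hp)))
    have key := step_field_algebraic (u := -Complex.I * u p) (v := -Complex.I * v p) hμ hν
      (h1 p hp) (h2 p hp) (alphaInv_eq μ ν (f p) (g p)) (betaInv_eq μ ν (f p) (g p))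
      hF0 hF1 hG0 hG1 (eβ p) (eP p hp) (eR p hp) (u' := -Complex.I * u' p) (by
        rw [← sub_eq_iff_eq_add', ← mul_sub]; exact hd)
    linear_combination Complex.I * key + (u' p * R p - u p * P p) * hI
  -- The same algebra with the two components exchanged and i replaced by -i; α and β, and hence P
  -- and R, trade places.
  have rel_v : ∀ p ∈ Ω, v' p * P p = v p * R p - 2 * Complex.I * γ p := by
    intro p hp
    obtain ⟨F, hF, hF0, hF1⟩ := hf.deriv_x hp
    obtain ⟨G, hG, hG0, hG1⟩ := hg.deriv_x hp
    have hd := I_mul_of_eq ((γx p hp).unique (by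
      rw [hγ]
      exact hasDerivAt_A10 (hasDerivAt_neg_smul_neg hF) (hasDerivAt_neg_smul_neg hG) (h2 p hp)))
    have key := step_field_algebraic (u := Complex.I * v p) (v := Complex.I * u p) hμ hν
      (h2 p hp) (h1 p hp) (f1 := f p 1) (f2 := f p 0) (g1 := g p 1) (g2 := g p 0)
      (f1' := (-F) 1) (f2' := (-F) 0) (g1' := (-G) 1) (g2' := (-G) 0)
      (eα p) (eα' p)
      (by rw [Pi.neg_apply, hF1]; ring) (by rw [Pi.neg_apply, hF0]; ring)
      (by rw [Pi.neg_apply, hG1]; ring) (by rw [Pi.neg_apply, hG0]; ring)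
      (eγ p) (eR p hp) (eP p hp) (u' := Complex.I * v' p) (by
        rw [← sub_eq_iff_eq_add', ← mul_sub]; exact hd)
    linear_combination -Complex.I * key + (v' p * P p - v p * R p) * hI
  -- Elimination of R between `rel_u` and `rel_v`; eliminating P instead gives `rel_R`.
  have rel_P : ∀ p ∈ Ω,
      -Complex.I * (u' p * v' p - u p * v p) * P p + 2 * u' p * γ p - 2 * v p * β p = 0 := by
    intro p hp
    linear_combination -Complex.I * (u' p * rel_v p hp + v p * rel_u p hp)
      + (2 * u' p * γ p - 2 * v p * β p) * hI
  have rel_R : ∀ p ∈ Ω,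
      Complex.I * (u' p * v' p - u p * v p) * R p + 2 * v' p * β p - 2 * u p * γ p = 0 := by
    intro p hp
    linear_combination Complex.I * (v' p * rel_u p hp + u p * rel_v p hp)
      + (2 * v' p * β p - 2 * u p * γ p) * hI
  have scaled_u : ∀ p ∈ Ω, -Complex.I * u' p * R p = -Complex.I * u p * P p + 2 * β p := by
    intro p hp
    linear_combination -Complex.I * rel_u p hp - 2 * β p * hI
  have scaled_v : ∀ p ∈ Ω, Complex.I * v' p * P p = Complex.I * v p * R p + 2 * γ p := by
    intro p hp
    linear_combination Complex.I * rel_v p hp - 2 * γ p * hI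
  have hα_fst : ∀ p ∈ Ω, ∀ᶠ s in 𝓝 p.1, alphaInv μ ν (f (s, p.2)) (g (s, p.2)) ≠ 0 := by
    intro p hp
    filter_upwards [eventually_slice_fst hΩ hp] with s hs using h1 _ hs
  have hα_snd : ∀ p ∈ Ω, ∀ᶠ s in 𝓝 p.2, alphaInv μ ν (f (p.1, s)) (g (p.1, s)) ≠ 0 := by
    intro p hp
    filter_upwards [eventually_slice_snd hΩ hp] with s hs using h1 _ hs
  have hβ_fst : ∀ p ∈ Ω, ∀ᶠ s in 𝓝 p.1, betaInv μ ν (f (s, p.2)) (g (s, p.2)) ≠ 0 := by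
    intro p hp
    filter_upwards [eventually_slice_fst hΩ hp] with s hs using h2 _ hs
  have hβ_snd : ∀ p ∈ Ω, ∀ᶠ s in 𝓝 p.2, betaInv μ ν (f (p.1, s)) (g (p.1, s)) ≠ 0 := by
    intro p hp
    filter_upwards [eventually_slice_snd hΩ hp] with s hs using h2 _ hs
  have Px : ∀ p ∈ Ω, HasDerivAt (fun s : ℝ => P (s, p.2)) (u' p * γ p - β p * v p) p.1 := by
    intro p hp
    obtain ⟨F, hF, hF0, hF1⟩ := hf.deriv_x hp
    obtain ⟨G, hG, hG0, hG1⟩ := hg.deriv_x hp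
    have key := step_diag_x (u := -Complex.I * u p) (v := -Complex.I * v p) hμ hν
      (h1 p hp) (h2 p hp) (alphaInv_eq μ ν (f p) (g p)) (betaInv_eq μ ν (f p) (g p))
      hF0 hF1 hG0 hG1 (eβ p) (eγ p) (eP p hp) (eR p hp) (scaled_u p hp)
    rw [hP]
    refine (hasDerivAt_A00 hF hG (hα_fst p hp)).congr_deriv ((congrArg _ key).trans ?_)
    linear_combination (-u' p * γ p + β p * v p) * hI
  have Rx : ∀ p ∈ Ω, HasDerivAt (fun s : ℝ => R (s, p.2)) (v' p * β p - γ p * u p) p.1 := by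
    intro p hp
    obtain ⟨F, hF, hF0, hF1⟩ := hf.deriv_x hp
    obtain ⟨G, hG, hG0, hG1⟩ := hg.deriv_x hp
    have key := step_diag_x (u := Complex.I * v p) (v := Complex.I * u p) hμ hν
      (h2 p hp) (h1 p hp) (f1 := f p 1) (f2 := f p 0) (g1 := g p 1) (g2 := g p 0)
      (f1' := (-F) 1) (f2' := (-F) 0) (g1' := (-G) 1) (g2' := (-G) 0)
      (eα p) (eα' p)
      (by rw [Pi.neg_apply, hF1]; ring) (by rw [Pi.neg_apply, hF0]; ring)
      (by rw [Pi.neg_apply, hG1]; ring) (by rw [Pi.neg_apply, hG0]; ring)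
      (eγ p) (eβ p) (eR p hp) (eP p hp) (scaled_v p hp)
    rw [hR]
    refine (hasDerivAt_A11 (hasDerivAt_neg_smul_neg hF) (hasDerivAt_neg_smul_neg hG)
      (hβ_fst p hp)).congr_deriv ((congrArg _ key).trans ?_)
    linear_combination (-v' p * β p + γ p * u p) * hI
  -- The new flux contains u'_x. It is obtained by differentiating `rel_u` along x and inserting the
  -- derivatives of P, R and β already found.
  have rel_fluxU : ∀ p ∈ Ω, -Complex.I * (u p * v p + u' p * v' p) * β p + 2 * (u' p - u p)
      + fluxU u' v' p * R p - fluxU u v p * P p = 0 := by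
    intro p hp
    have hl := (hasDerivAt_dX hΩ hu's hp).mul (Rx p hp)
    have hr := ((hasDerivAt_dX hΩ hu hp).mul (Px p hp)).add ((βx p hp).const_mul (2 * Complex.I))
    have e : (fun s : ℝ => u' (s, p.2) * R (s, p.2)) =ᶠ[𝓝 p.1]
        fun s => u (s, p.2) * P (s, p.2) + 2 * Complex.I * β (s, p.2) := by
      filter_upwards [eventually_slice_fst hΩ hp] with s hs using rel_u _ hs
    have D : dX u' p * R p + u' p * (v' p * β p - γ p * u p) =
        dX u p * P p + u p * (u' p * γ p - β p * v p) + 2 * Complex.I * (u' p - u p) :=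
      hl.unique (hr.congr_of_eventuallyEq e)
    simp only [fluxU]
    linear_combination Complex.I * D + u' p * v' p * rel_u p hp + Complex.I * u p * rel_P p hp
      + (2 * (u' p - u p) + u p * (u' p * v' p - u p * v p) * P p) * hI
  have rel_fluxV : ∀ p ∈ Ω, Complex.I * (u p * v p + u' p * v' p) * γ p + 2 * (v' p - v p)
      + fluxV u' v' p * P p - fluxV u v p * R p = 0 := by
    intro p hp
    have hl := (hasDerivAt_dX hΩ hv's hp).mul (Px p hp)
    have hr := ((hasDerivAt_dX hΩ hv hp).mul (Rx p hp)).sub ((γx p hp).const_mul (2 * Complex.I))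
    have e : (fun s : ℝ => v' (s, p.2) * P (s, p.2)) =ᶠ[𝓝 p.1]
        fun s => v (s, p.2) * R (s, p.2) - 2 * Complex.I * γ (s, p.2) := by
      filter_upwards [eventually_slice_fst hΩ hp] with s hs using rel_v _ hs
    have D : dX v' p * P p + v' p * (u' p * γ p - β p * v p) =
        dX v p * R p + v p * (v' p * β p - γ p * u p) - 2 * Complex.I * (v' p - v p) :=
      hl.unique (hr.congr_of_eventuallyEq e)
    simp only [fluxV]
    linear_combination -Complex.I * D + u' p * v' p * rel_v p hp - Complex.I * v p * rel_R p hp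
      + (2 * (v' p - v p) + v p * (u' p * v' p - u p * v p) * R p) * hI
  intro p hp
  -- The relations are now put in scaled form: products of fields acquire -1, and the fluxes of u
  -- and v acquire i and -i, matching `w'` and `q'` in the time lemmas.
  have swU : ((-Complex.I * u' p) * (-Complex.I * v' p) - -Complex.I * u p * (-Complex.I * v p))
      * P p + 2 * (-Complex.I * u' p) * γ p - 2 * β p * (-Complex.I * v p) = 0 := by
    linear_combination -Complex.I * rel_P p hp
  have swV : ((-Complex.I * u' p) * (-Complex.I * v' p) - Complex.I * v p * (Complex.I * u p))
      * R p + 2 * (Complex.I * v' p) * β p - 2 * γ p * (Complex.I * u p) = 0 := by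
    linear_combination Complex.I * rel_R p hp
  have sqU : (-Complex.I * u p * (-Complex.I * v p) + (-Complex.I * u' p) * (-Complex.I * v' p))
      * β p + 2 * (-Complex.I * u' p - -Complex.I * u p) - Complex.I * fluxU u' v' p * R p
      + ((-Complex.I * u p) ^ 2 * (-Complex.I * v p) + -dX u p) * P p = 0 := by
    have := rel_fluxU p hp
    simp only [fluxU] at this ⊢
    linear_combination -Complex.I * this
      - (Complex.I * u p ^ 2 * v p + dX u p) * P p * hI
  have sqV : (Complex.I * v p * (Complex.I * u p) + (-Complex.I * u' p) * (-Complex.I * v' p))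
      * γ p + 2 * (Complex.I * v' p - Complex.I * v p) - -Complex.I * fluxV u' v' p * P p
      + ((Complex.I * v p) ^ 2 * (Complex.I * u p) + -dX v p) * R p = 0 := by
    have := rel_fluxV p hp
    simp only [fluxV] at this ⊢
    linear_combination Complex.I * this
      + (Complex.I * u p * v p ^ 2 - dX v p) * R p * hI
  obtain ⟨F, hF, hF0, hF1⟩ := hf.deriv_t hp
  obtain ⟨G, hG, hG0, hG1⟩ := hg.deriv_t hp
  have hF0' : (-F) 0 = -(-2 / μ ^ 4 + (Complex.I * v p) * (Complex.I * u p) / μ ^ 2) * f p 0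
        + (2 * (Complex.I * u p) / μ ^ 3
          - ((Complex.I * v p) * (Complex.I * u p) ^ 2 - -dX u p) / μ) * f p 1 := by
    rw [Pi.neg_apply, hF0]; ring
  have hF1' : (-F) 1 = (-2 / μ ^ 4 + (Complex.I * v p) * (Complex.I * u p) / μ ^ 2) * f p 1
        + (2 * (Complex.I * v p) / μ ^ 3
          - ((Complex.I * v p) ^ 2 * (Complex.I * u p) + -dX v p) / μ) * f p 0 := by
    rw [Pi.neg_apply, hF1]; ring
  have hG0' : (-G) 0 = (-2 / ν ^ 4 + (Complex.I * v p) * (Complex.I * u p) / ν ^ 2) * g p 0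
        - (2 * (Complex.I * v p) / ν ^ 3
          - ((Complex.I * v p) ^ 2 * (Complex.I * u p) + -dX v p) / ν) * g p 1 := by
    rw [Pi.neg_apply, hG0]; ring
  have hG1' : (-G) 1 = -(-2 / ν ^ 4 + (Complex.I * v p) * (Complex.I * u p) / ν ^ 2) * g p 1
        - (2 * (Complex.I * u p) / ν ^ 3
          - ((Complex.I * v p) * (Complex.I * u p) ^ 2 - -dX u p) / ν) * g p 0 := by
    rw [Pi.neg_apply, hG1]; ring
  have a1 := alphaInv_eq μ ν (f p) (g p)
  have a2 := betaInv_eq μ ν (f p) (g p)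
  refine ⟨βx p hp, γx p hp, Px p hp, Rx p hp, ?_, ?_, ?_, ?_, rel_u p hp, rel_v p hp, rel_P p hp,
    rel_R p hp, rel_fluxU p hp, rel_fluxV p hp⟩
  · have key := step_offDiag_t hμ hν (h1 p hp) (h2 p hp) a1 a2 hF0 hF1 hG0 hG1 (eβ p) (eγ p)
      (eP p hp) (eR p hp) (scaled_u p hp) swU sqU
    rw [hβ]
    refine (hasDerivAt_A01 hF hG (h1 p hp)).congr_deriv ((congrArg _ key).trans ?_)
    simp only [fluxU]
    linear_combination (-Complex.I * dX u' p - u' p ^ 2 * v' p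
      + u p ^ 2 * v p * (1 - Complex.I ^ 2)) * hI
  · have key := step_offDiag_t hμ hν (h2 p hp) (h1 p hp) (eα p) (eα' p) hF1' hF0' hG1' hG0'
      (eγ p) (eβ p) (eR p hp) (eP p hp) (scaled_v p hp) swV sqV
    rw [hγ]
    refine (hasDerivAt_A10 (hasDerivAt_neg_smul_neg hF) (hasDerivAt_neg_smul_neg hG)
      (h2 p hp)).congr_deriv ((congrArg _ key).trans ?_)
    simp only [fluxV]
    linear_combination (Complex.I * dX v' p - u' p * v' p ^ 2
      + v p ^ 2 * u p * (1 - Complex.I ^ 2)) * hI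
  · have key := step_diag_t hμ hν (h1 p hp) (h2 p hp) a1 a2 hF0 hF1 hG0 hG1 (eβ p) (eγ p)
      (eP p hp) (eR p hp) (scaled_u p hp) swU sqU
    rw [hP]
    refine (hasDerivAt_A00 hF hG (hα_snd p hp)).congr_deriv ((congrArg _ key).trans ?_)
    simp only [fluxU, fluxV]
    linear_combination (Complex.I * (u' p * v' p - u p * v p) - Complex.I * dX u' p * γ p
      - u' p ^ 2 * v' p * γ p + u p * v p ^ 2 * β p * (1 - Complex.I ^ 2)) * hI
  · have key := step_diag_t hμ hν (h2 p hp) (h1 p hp) (eα p) (eα' p) hF1' hF0' hG1' hG0'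
      (eγ p) (eβ p) (eR p hp) (eP p hp) (scaled_v p hp) swV sqV
    rw [hR]
    refine (hasDerivAt_A11 (hasDerivAt_neg_smul_neg hF) (hasDerivAt_neg_smul_neg hG)
      (hβ_snd p hp)).congr_deriv ((congrArg _ key).trans ?_)
    simp only [fluxU, fluxV]
    linear_combination (-Complex.I * (u' p * v' p - u p * v p) + Complex.I * dX v' p * β p
      - u' p * v' p ^ 2 * β p + v p * u p ^ 2 * γ p * (1 - Complex.I ^ 2)) * hI

end Relations

/-! ### Darboux matrices -/

section DarbouxBasic

variable {Ω : Set (ℝ × ℝ)} {u v u' v' u'' v'' : ℝ × ℝ → ℂ} {ζ : ℂ}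

theorem hasDerivAt_matrix_mul {D E : ℝ → Matrix (Fin 2) (Fin 2) ℂ}
    {D' E' : Matrix (Fin 2) (Fin 2) ℂ} {s : ℝ}
    (hD : ∀ a b, HasDerivAt (fun s => D s a b) (D' a b) s)
    (hE : ∀ a b, HasDerivAt (fun s => E s a b) (E' a b) s) (a b : Fin 2) :
    HasDerivAt (fun s => (D s * E s) a b) ((D' * E s + D s * E') a b) s := by
  simp only [Matrix.add_apply, Matrix.mul_apply, Fin.sum_univ_two]
  refine (((hD a 0).mul (hE 0 b)).add ((hD a 1).mul (hE 1 b))).congr_deriv ?_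
  ring

theorem hasDerivAt_matrix_mulVec {D : ℝ → Matrix (Fin 2) (Fin 2) ℂ} {f : ℝ → Fin 2 → ℂ}
    {D' : Matrix (Fin 2) (Fin 2) ℂ} {f' : Fin 2 → ℂ} {s : ℝ}
    (hD : ∀ a b, HasDerivAt (fun s => D s a b) (D' a b) s) (hf : HasDerivAt f f' s) :
    HasDerivAt (fun s => (D s).mulVec (f s)) (D'.mulVec (f s) + (D s).mulVec f') s := by
  refine hasDerivAt_pi.2 fun a => ?_
  have hf := hasDerivAt_pi.1 hf
  simp only [Pi.add_apply, Matrix.mulVec, dotProduct, Fin.sum_univ_two]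
  refine (((hD a 0).mul (hf 0)).add ((hD a 1).mul (hf 1))).congr_deriv ?_
  ring

theorem IsDarboux.mulVec {D : ℝ × ℝ → Matrix (Fin 2) (Fin 2) ℂ}
    (hD : IsDarboux u v u' v' Ω ζ D) {f : ℝ × ℝ → Fin 2 → ℂ} (hf : SolvesLax u v Ω ζ f) :
    SolvesLax u' v' Ω ζ fun p => (D p).mulVec (f p) := by
  intro p hp
  constructor
  · refine (hasDerivAt_matrix_mulVec (fun a b => (hD p hp a b).1) (hf p hp).1).congr_deriv ?_
    simp only [Matrix.sub_mulVec, Matrix.mulVec_mulVec, Prod.mk.eta]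
    abel
  · refine (hasDerivAt_matrix_mulVec (fun a b => (hD p hp a b).2) (hf p hp).2).congr_deriv ?_
    simp only [Matrix.sub_mulVec, Matrix.mulVec_mulVec, Prod.mk.eta]
    abel

theorem IsConjDarboux.vecMul {E : ℝ × ℝ → Matrix (Fin 2) (Fin 2) ℂ}
    (hE : IsConjDarboux u v u' v' Ω ζ E) {g : ℝ × ℝ → Fin 2 → ℂ} (hg : SolvesConjLax u v Ω ζ g) :
    SolvesConjLax u' v' Ω ζ fun p => Matrix.vecMul (g p) (E p) := by
  intro p hp
  simp only [← Matrix.mulVec_transpose]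
  constructor
  · refine (hasDerivAt_matrix_mulVec (D := fun s => (E (s, p.2)).transpose)
      (D' := (laxU u v ζ p * E p - E p * laxU u' v' ζ p).transpose)
      (fun a b => (hE p hp b a).1) (hg p hp).1).congr_deriv ?_
    simp only [Matrix.mulVec_transpose, Matrix.vecMul_sub, Matrix.vecMul_vecMul, Prod.mk.eta,
      Matrix.neg_vecMul]
    abel
  · refine (hasDerivAt_matrix_mulVec (D := fun s => (E (p.1, s)).transpose)
      (D' := (laxV u v ζ p * E p - E p * laxV u' v' ζ p).transpose)
      (fun a b => (hE p hp b a).2) (hg p hp).2).congr_deriv ?_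
    simp only [Matrix.mulVec_transpose, Matrix.vecMul_sub, Matrix.vecMul_vecMul, Prod.mk.eta,
      Matrix.neg_vecMul]
    abel

theorem IsDarboux.mul {D E : ℝ × ℝ → Matrix (Fin 2) (Fin 2) ℂ}
    (hE : IsDarboux u' v' u'' v'' Ω ζ E) (hD : IsDarboux u v u' v' Ω ζ D) :
    IsDarboux u v u'' v'' Ω ζ fun p => E p * D p := by
  intro p hp a b
  constructor
  · refine (hasDerivAt_matrix_mul (fun a b => (hE p hp a b).1) (fun a b => (hD p hp a b).1)
      a b).congr_deriv ?_
    simp only [Prod.mk.eta, Matrix.sub_mul, Matrix.mul_sub, Matrix.mul_assoc, sub_add_sub_cancel]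
  · refine (hasDerivAt_matrix_mul (fun a b => (hE p hp a b).2) (fun a b => (hD p hp a b).2)
      a b).congr_deriv ?_
    simp only [Prod.mk.eta, Matrix.sub_mul, Matrix.mul_sub, Matrix.mul_assoc, sub_add_sub_cancel]

theorem IsConjDarboux.mul {D E : ℝ × ℝ → Matrix (Fin 2) (Fin 2) ℂ}
    (hE : IsConjDarboux u v u' v' Ω ζ E) (hD : IsConjDarboux u' v' u'' v'' Ω ζ D) :
    IsConjDarboux u v u'' v'' Ω ζ fun p => E p * D p := by
  intro p hp a b
  constructor
  · refine (hasDerivAt_matrix_mul (fun a b => (hE p hp a b).1) (fun a b => (hD p hp a b).1)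
      a b).congr_deriv ?_
    simp only [Prod.mk.eta, Matrix.sub_mul, Matrix.mul_sub, Matrix.mul_assoc, sub_add_sub_cancel]
  · refine (hasDerivAt_matrix_mul (fun a b => (hE p hp a b).2) (fun a b => (hD p hp a b).2)
      a b).congr_deriv ?_
    simp only [Prod.mk.eta, Matrix.sub_mul, Matrix.mul_sub, Matrix.mul_assoc, sub_add_sub_cancel]

theorem laxU_congr {p : ℝ × ℝ} (hu : u p = u' p) (hv : v p = v' p) :
    laxU u v ζ p = laxU u' v' ζ p := by
  simp only [laxU, hu, hv]

theorem laxV_congr (hΩ : IsOpen Ω) (hu : ∀ p ∈ Ω, u p = u' p) (hv : ∀ p ∈ Ω, v p = v' p)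
    {p : ℝ × ℝ} (hp : p ∈ Ω) : laxV u v ζ p = laxV u' v' ζ p := by
  simp only [laxV, hu p hp, hv p hp, dX_congr hΩ hu hp, dX_congr hΩ hv hp]

theorem IsDarboux.congr (hΩ : IsOpen Ω) {D : ℝ × ℝ → Matrix (Fin 2) (Fin 2) ℂ}
    (hD : IsDarboux u v u' v' Ω ζ D) (hu : ∀ p ∈ Ω, u' p = u'' p) (hv : ∀ p ∈ Ω, v' p = v'' p) :
    IsDarboux u v u'' v'' Ω ζ D := by
  intro p hp a b
  rw [← laxU_congr (hu p hp) (hv p hp), ← laxV_congr hΩ hu hv hp]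
  exact hD p hp a b

theorem IsConjDarboux.congr (hΩ : IsOpen Ω) {D : ℝ × ℝ → Matrix (Fin 2) (Fin 2) ℂ}
    (hD : IsConjDarboux u v u' v' Ω ζ D) (hu : ∀ p ∈ Ω, u' p = u'' p)
    (hv : ∀ p ∈ Ω, v' p = v'' p) : IsConjDarboux u v u'' v'' Ω ζ D := by
  intro p hp a b
  rw [← laxU_congr (hu p hp) (hv p hp), ← laxV_congr hΩ hu hv hp]
  exact hD p hp a b

theorem fluxU_congr (hΩ : IsOpen Ω) (hu : ∀ p ∈ Ω, u p = u' p) (hv : ∀ p ∈ Ω, v p = v' p)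
    {p : ℝ × ℝ} (hp : p ∈ Ω) : fluxU u v p = fluxU u' v' p := by
  simp only [fluxU, hu p hp, hv p hp, dX_congr hΩ hu hp]

theorem fluxV_congr (hΩ : IsOpen Ω) (hu : ∀ p ∈ Ω, u p = u' p) (hv : ∀ p ∈ Ω, v p = v' p)
    {p : ℝ × ℝ} (hp : p ∈ Ω) : fluxV u v p = fluxV u' v' p := by
  simp only [fluxV, hu p hp, hv p hp, dX_congr hΩ hv hp]

theorem isDarboux_one : IsDarboux u v u v Ω ζ fun _ => 1 := by
  intro p _ a b
  simp only [mul_one, one_mul, sub_self]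
  exact ⟨hasDerivAt_const _ _, hasDerivAt_const _ _⟩

theorem isConjDarboux_one : IsConjDarboux u v u v Ω ζ fun _ => 1 := by
  intro p _ a b
  simp only [mul_one, one_mul, sub_self]
  exact ⟨hasDerivAt_const _ _, hasDerivAt_const _ _⟩

theorem differentiableOn_laxU {W : Set ℂ} (hW : ∀ ζ ∈ W, ζ ≠ 0) (p : ℝ × ℝ) (a b : Fin 2) :
    DifferentiableOn ℂ (fun ζ => laxU u v ζ p a b) W := by
  intro ζ hζ
  have := hW ζ hζ
  refine DifferentiableAt.differentiableWithinAt ?_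
  simp only [laxU_eq]
  fin_cases a <;> fin_cases b <;> simp <;> fun_prop (disch := simpa using this)

theorem differentiableOn_laxV {W : Set ℂ} (hW : ∀ ζ ∈ W, ζ ≠ 0) (p : ℝ × ℝ) (a b : Fin 2) :
    DifferentiableOn ℂ (fun ζ => laxV u v ζ p a b) W := by
  intro ζ hζ
  have := hW ζ hζ
  refine DifferentiableAt.differentiableWithinAt ?_
  simp only [laxV_eq]
  fin_cases a <;> fin_cases b <;> simp <;> fun_prop (disch := simpa using this)

end DarbouxBasic

/-- One binary step is a Darboux transformation. -/
theorem binaryStep_isDarboux {Ω : Set (ℝ × ℝ)} {u v : ℝ × ℝ → ℂ} {μ ν : ℂ}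
    {f g : ℝ × ℝ → Fin 2 → ℂ} (hΩ : IsOpen Ω) (hu : ContDiffOn ℝ ∞ u Ω) (hv : ContDiffOn ℝ ∞ v Ω)
    (hμ : μ ≠ 0) (hν : ν ≠ 0)
    (hfs : ∀ a, ContDiffOn ℝ ∞ (fun p => f p a) Ω) (hgs : ∀ a, ContDiffOn ℝ ∞ (fun p => g p a) Ω)
    (hf : SolvesLax u v Ω μ f) (hg : SolvesConjLax u v Ω ν g)
    (h1 : ∀ p ∈ Ω, alphaInv μ ν (f p) (g p) ≠ 0) (h2 : ∀ p ∈ Ω, betaInv μ ν (f p) (g p) ≠ 0)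
    {u' v' β γ : ℝ × ℝ → ℂ} (hu' : u' = fun p => u p + dX β p)
    (hv' : v' = fun p => v p + dX γ p)
    (hβ : β = fun p => 2 * (binaryStep μ ν (f p) (g p)).A 0 1)
    (hγ : γ = fun p => 2 * (binaryStep μ ν (f p) (g p)).A 1 0) :
    (∀ ζ, ζ ≠ 0 → ζ ^ 2 ≠ ν ^ 2 →
      IsDarboux u v u' v' Ω ζ fun p => (binaryStep μ ν (f p) (g p)).T ζ) ∧
    (∀ ζ, ζ ≠ 0 → ζ ^ 2 ≠ μ ^ 2 →
      IsConjDarboux u v u' v' Ω ζ fun p => (binaryStep μ ν (f p) (g p)).Tinv ζ) ∧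
    ∀ p ∈ Ω, dT β p = fluxU u' v' p - fluxU u v p ∧ dT γ p = fluxV u' v' p - fluxV u v p := by
  have h := binaryStep_relations hΩ hu hv hμ hν hfs hgs hf hg h1 h2 hu' hv' hβ hγ rfl rfl
  refine ⟨fun ζ h0 hζ => StepRelations.isDarboux h h0 (1 / (ζ ^ 2 - ν ^ 2)) fun p => ?_,
    fun ζ h0 hζ => StepRelations.isConjDarboux h h0 (1 / (ζ ^ 2 - μ ^ 2)) (fun p hp => ?_) hΩ,
    fun p hp => ⟨(h p hp).β_t.deriv, (h p hp).γ_t.deriv⟩⟩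
  · rw [hβ, hγ]
    exact Step.T_eq_numT _ hζ
  · rw [binaryStep_Tinv_eq (h1 p hp) (h2 p hp) hζ, Matrix.adjugate_fin_two, hβ, hγ]
    rfl

/-! ### The fields along the chain of binary steps -/

theorem dX_add {Ω : Set (ℝ × ℝ)} (hΩ : IsOpen Ω) {f g : ℝ × ℝ → ℂ} (hf : ContDiffOn ℝ ∞ f Ω)
    (hg : ContDiffOn ℝ ∞ g Ω) {p : ℝ × ℝ} (hp : p ∈ Ω) :
    dX (fun q => f q + g q) p = dX f p + dX g p :=
  ((hasDerivAt_dX hΩ hf hp).add (hasDerivAt_dX hΩ hg hp)).deriv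

theorem dT_add {Ω : Set (ℝ × ℝ)} (hΩ : IsOpen Ω) {f g : ℝ × ℝ → ℂ} (hf : ContDiffOn ℝ ∞ f Ω)
    (hg : ContDiffOn ℝ ∞ g Ω) {p : ℝ × ℝ} (hp : p ∈ Ω) :
    dT (fun q => f q + g q) p = dT f p + dT g p :=
  ((hasDerivAt_dT hΩ hf hp).add (hasDerivAt_dT hΩ hg hp)).deriv

theorem contDiffOn_matrix_mul {E : Type*} [NormedAddCommGroup E] [NormedSpace ℝ E] {s : Set E}
    {A B : E → Matrix (Fin 2) (Fin 2) ℂ} (hA : ∀ a b, ContDiffOn ℝ ∞ (fun x => A x a b) s)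
    (hB : ∀ a b, ContDiffOn ℝ ∞ (fun x => B x a b) s) (a b : Fin 2) :
    ContDiffOn ℝ ∞ (fun x => (A x * B x) a b) s := by
  simp only [Matrix.mul_apply, Fin.sum_univ_two]
  exact ((hA a 0).mul (hB 0 b)).add ((hA a 1).mul (hB 1 b))

theorem contDiffOn_one_div_fst_sub {W : Set ℂ} {Ω : Set (ℝ × ℝ)} {c : ℂ}
    (hW : ∀ ζ ∈ W, ζ - c ≠ 0) :
    ContDiffOn ℝ ∞ (fun q : ℂ × (ℝ × ℝ) => 1 / (q.1 - c)) (W ×ˢ Ω) := by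
  simp only [one_div]
  exact (contDiff_fst.sub contDiff_const).contDiffOn.inv fun q hq => hW q.1 hq.1

/-- Smoothness jointly in the spectral parameter and the point is what `lead_family` asks of the
transformed families. -/
theorem contDiffOn_residue_form {W : Set ℂ} {Ω : Set (ℝ × ℝ)} {c : ℂ}
    {C : ℝ × ℝ → Matrix (Fin 2) (Fin 2) ℂ} (hC : ∀ a b, ContDiffOn ℝ ∞ (fun p => C p a b) Ω)
    (hW : ∀ ζ ∈ W, ζ ^ 2 ≠ c ^ 2) (a b : Fin 2) :
    ContDiffOn ℝ ∞ (fun q : ℂ × (ℝ × ℝ) => (1 + (1 / (q.1 - c)) • C q.2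
      - (1 / (q.1 + c)) • (sigma3 * C q.2 * sigma3)) a b) (W ×ˢ Ω) := by
  have h1 : ContDiffOn ℝ ∞ (fun q : ℂ × (ℝ × ℝ) => 1 / (q.1 - c)) (W ×ˢ Ω) :=
    contDiffOn_one_div_fst_sub fun ζ hζ => (sub_add_ne_zero_of_sq_ne (hW ζ hζ)).1
  have h2 : ContDiffOn ℝ ∞ (fun q : ℂ × (ℝ × ℝ) => 1 / (q.1 + c)) (W ×ˢ Ω) := by
    simpa using contDiffOn_one_div_fst_sub (W := W) (Ω := Ω) (c := -c) fun ζ hζ => by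
      simpa using (sub_add_ne_zero_of_sq_ne (hW ζ hζ)).2
  have hC' : ∀ a b, ContDiffOn ℝ ∞ (fun q : ℂ × (ℝ × ℝ) => C q.2 a b) (W ×ˢ Ω) :=
    fun a b => (hC a b).comp contDiff_snd.contDiffOn fun q hq => hq.2
  have hS : ∀ a b, ContDiffOn ℝ ∞ (fun q : ℂ × (ℝ × ℝ) => (sigma3 * C q.2 * sigma3) a b)
      (W ×ˢ Ω) :=
    contDiffOn_matrix_mul (contDiffOn_matrix_mul (fun _ _ => contDiffOn_const) hC')
      fun _ _ => contDiffOn_const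
  simp only [Matrix.sub_apply, Matrix.add_apply, Matrix.smul_apply, smul_eq_mul]
  exact (contDiffOn_const.add (h1.mul (hC' a b))).sub (h2.mul (hS a b))

/-- The nonzero spectral parameters whose square differs from those of the `ν k`. -/
def awayFrom {n : ℕ} (ν : Fin n → ℂ) : Set ℂ := {ζ | ζ ≠ 0 ∧ ∀ k, ζ ^ 2 ≠ ν k ^ 2}

theorem isOpen_awayFrom {n : ℕ} (ν : Fin n → ℂ) : IsOpen (awayFrom ν) := by
  have h : awayFrom ν = {ζ | ζ ≠ 0} ∩ ⋂ k, {ζ | ζ ^ 2 ≠ ν k ^ 2} := by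
    ext; simp [awayFrom]
  rw [h]
  exact isOpen_ne.inter (isOpen_iInter_of_finite fun k =>
    isOpen_ne_fun (continuous_pow 2) continuous_const)

section Chain

variable {n : ℕ} (m : Fin n → ℕ) (μ ν : Fin n → ℂ) (Φ Ψ : Fin n → ℂ → ℝ × ℝ → Fin 2 → ℂ)

/-- The step of level `j` in block `i` as a function of the point. -/
def stepAt (i : Fin n) (j : ℕ) (p : ℝ × ℝ) : Step := gStep m μ ν (atPt Φ p) (atPt Ψ p) i j

/-- The sum of the entries `(a, b)` of the matrices `2 A` over the first `e k` steps of each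
block `k`. -/
def residueSum (a b : Fin 2) (e : Fin n → ℕ) (p : ℝ × ℝ) : ℂ :=
  ∑ k, ∑ l ∈ Finset.range (e k), 2 * (stepAt m μ ν Φ Ψ k l p).A a b

/-- The field `w` transformed by the first `e k` steps of each block `k`. -/
def chainField (a b : Fin 2) (w : ℝ × ℝ → ℂ) (e : Fin n → ℕ) (p : ℝ × ℝ) : ℂ :=
  w p + dX (residueSum m μ ν Φ Ψ a b e) p

/-- The product `L` of the first `e k` steps of each block `k` is a Darboux matrix. -/
structure ChainDarboux (u v : ℝ × ℝ → ℂ) (Ω : Set (ℝ × ℝ)) (L : ℝ × ℝ → List Step)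
    (e : Fin n → ℕ) : Prop where
  smooth : ∀ k, ∀ l < e k, ∀ a b,
    ContDiffOn ℝ ∞ (fun p => (stepAt m μ ν Φ Ψ k l p).A a b) Ω ∧
      ContDiffOn ℝ ∞ (fun p => (stepAt m μ ν Φ Ψ k l p).B a b) Ω
  darboux : ∀ ζ ∈ awayFrom ν, IsDarboux u v (chainField m μ ν Φ Ψ 0 1 u e)
    (chainField m μ ν Φ Ψ 1 0 v e) Ω ζ fun p => prodT (L p) ζ
  conjDarboux : ∀ ζ ∈ awayFrom μ, IsConjDarboux u v (chainField m μ ν Φ Ψ 0 1 u e)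
    (chainField m μ ν Φ Ψ 1 0 v e) Ω ζ fun p => prodTinv (L p) ζ
  smooth_prodT : ∀ a b, ContDiffOn ℝ ∞ (fun q : ℂ × (ℝ × ℝ) => prodT (L q.2) q.1 a b)
    (awayFrom ν ×ˢ Ω)
  smooth_prodTinv : ∀ a b, ContDiffOn ℝ ∞ (fun q : ℂ × (ℝ × ℝ) => prodTinv (L q.2) q.1 a b)
    (awayFrom μ ×ˢ Ω)
  -- The conservation laws integrated once in x: differentiating these equations in x gives the
  -- evolution of the new fields.
  flux : ∀ p ∈ Ω,
    dT (residueSum m μ ν Φ Ψ 0 1 e) p =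
      fluxU (chainField m μ ν Φ Ψ 0 1 u e) (chainField m μ ν Φ Ψ 1 0 v e) p - fluxU u v p ∧
    dT (residueSum m μ ν Φ Ψ 1 0 e) p =
      fluxV (chainField m μ ν Φ Ψ 0 1 u e) (chainField m μ ν Φ Ψ 1 0 v e) p - fluxV u v p

variable {m μ ν Φ Ψ} {u v : ℝ × ℝ → ℂ} {Ω : Set (ℝ × ℝ)}

theorem contDiffOn_residueSum {e : Fin n → ℕ} (h : ∀ k, ∀ l < e k, ∀ a b,
      ContDiffOn ℝ ∞ (fun p => (stepAt m μ ν Φ Ψ k l p).A a b) Ω) (a b : Fin 2) :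
    ContDiffOn ℝ ∞ (residueSum m μ ν Φ Ψ a b e) Ω := by
  unfold residueSum
  exact ContDiffOn.sum fun k _ => ContDiffOn.sum fun l hl =>
    contDiffOn_const.mul (h k l (Finset.mem_range.1 hl) a b)

theorem residueSum_add_single (a b : Fin 2) (e : Fin n → ℕ) (i : Fin n) :
    residueSum m μ ν Φ Ψ a b (e + Pi.single i 1) =
      fun p => residueSum m μ ν Φ Ψ a b e p + 2 * (stepAt m μ ν Φ Ψ i (e i) p).A a b := by
  funext p
  exact sum_range_add_single (fun k l => 2 * (stepAt m μ ν Φ Ψ k l p).A a b) e i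

theorem chainField_add_single (hΩ : IsOpen Ω) {e : Fin n → ℕ} {i : Fin n}
    (h : ∀ k, ∀ l < e k, ∀ a b, ContDiffOn ℝ ∞ (fun p => (stepAt m μ ν Φ Ψ k l p).A a b) Ω)
    (hi : ∀ a b, ContDiffOn ℝ ∞ (fun p => (stepAt m μ ν Φ Ψ i (e i) p).A a b) Ω)
    (a b : Fin 2) (w : ℝ × ℝ → ℂ) {p : ℝ × ℝ} (hp : p ∈ Ω) :
    chainField m μ ν Φ Ψ a b w e p + dX (fun p => 2 * (stepAt m μ ν Φ Ψ i (e i) p).A a b) p =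
      chainField m μ ν Φ Ψ a b w (e + Pi.single i 1) p := by
  rw [chainField, chainField, residueSum_add_single, dX_add hΩ (contDiffOn_residueSum h a b)
    (contDiffOn_const.mul (hi a b)) hp, add_assoc]

theorem contDiffOn_chainField (hΩ : IsOpen Ω) {e : Fin n → ℕ} (h : ∀ k, ∀ l < e k, ∀ a b,
      ContDiffOn ℝ ∞ (fun p => (stepAt m μ ν Φ Ψ k l p).A a b) Ω) (a b : Fin 2) {w : ℝ × ℝ → ℂ}
    (hw : ContDiffOn ℝ ∞ w Ω) : ContDiffOn ℝ ∞ (chainField m μ ν Φ Ψ a b w e) Ω :=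
  hw.add (contDiffOn_dX hΩ (contDiffOn_residueSum h a b))

theorem residueSum_zero (a b : Fin 2) : residueSum m μ ν Φ Ψ a b 0 = fun _ => 0 := by
  funext p; simp [residueSum]

theorem chainField_zero (a b : Fin 2) (w : ℝ × ℝ → ℂ) : chainField m μ ν Φ Ψ a b w 0 = w := by
  funext p
  simp [chainField, residueSum_zero, dX]

theorem chainDarboux_nil : ChainDarboux m μ ν Φ Ψ u v Ω (fun _ => []) 0 := by
  refine ⟨fun k l hl => absurd hl (by simp), ?_, ?_, ?_, ?_, ?_⟩
  · intro ζ _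
    rw [chainField_zero, chainField_zero]
    exact isDarboux_one
  · intro ζ _
    rw [chainField_zero, chainField_zero]
    exact isConjDarboux_one
  · intro a b
    exact contDiffOn_const (c := (1 : Matrix (Fin 2) (Fin 2) ℂ) a b)
  · intro a b
    exact contDiffOn_const (c := (1 : Matrix (Fin 2) (Fin 2) ℂ) a b)
  · intro p _
    simp [chainField_zero, residueSum_zero, dT]

theorem FamilyNear.analyticAt {S : ℂ → (ℝ × ℝ → Fin 2 → ℂ) → Prop} {z : ℂ}
    {F : ℂ → ℝ × ℝ → Fin 2 → ℂ} (h : FamilyNear S Ω z F) {p : ℝ × ℝ} (hp : p ∈ Ω) :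
    AnalyticAt ℂ (fun ζ => F ζ p) z := by
  obtain ⟨W, hW, hz, -, hol, -⟩ := h
  exact (hol p hp).analyticAt (hW.mem_nhds hz)

theorem contDiffOn_matrix_mulVec {E : Type*} [NormedAddCommGroup E] [NormedSpace ℝ E] {s : Set E}
    {A : E → Matrix (Fin 2) (Fin 2) ℂ} {f : E → Fin 2 → ℂ}
    (hA : ∀ a b, ContDiffOn ℝ ∞ (fun x => A x a b) s) (hf : ContDiffOn ℝ ∞ f s) :
    ContDiffOn ℝ ∞ (fun x => (A x).mulVec (f x)) s := by
  have hf := contDiffOn_pi.1 hf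
  refine contDiffOn_pi.2 fun a => ?_
  simp only [Matrix.mulVec, dotProduct, Fin.sum_univ_two]
  exact ((hA a 0).mul (hf 0)).add ((hA a 1).mul (hf 1))

theorem differentiableOn_matrix_mulVec {s : Set ℂ}
    {A : ℂ → Matrix (Fin 2) (Fin 2) ℂ} {f : ℂ → Fin 2 → ℂ}
    (hA : ∀ a b, DifferentiableOn ℂ (fun x => A x a b) s) (hf : DifferentiableOn ℂ f s) :
    DifferentiableOn ℂ (fun x => (A x).mulVec (f x)) s := by
  have hf := differentiableOn_pi.1 hf
  refine differentiableOn_pi.2 fun a => ?_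
  simp only [Matrix.mulVec, dotProduct, Fin.sum_univ_two]
  exact ((hA a 0).mul (hf 0)).add ((hA a 1).mul (hf 1))

/-- The Darboux matrix built so far maps the family near μ_i to solutions for the current fields,
and the seed is the leading coefficient of the resulting family, so `lead_family` applies.
Parameters are restricted to `awayFrom ν`, which contains μ_i. -/
theorem seedPhi_solvesLax (hΩ : IsOpen Ω) (hμ0 : ∀ i, μ i ≠ 0) (hμν : ∀ i k, μ i ^ 2 ≠ ν k ^ 2)
    (hΦ : ∀ i, IsLaxFamily u v Ω (μ i) (Φ i))
    (hnd : ∀ p ∈ Ω, NonDeg m μ ν (atPt Φ p) (atPt Ψ p)) {i : Fin n} {j : ℕ} (hj : j < m i)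
    (ih : ChainDarboux m μ ν Φ Ψ u v Ω (fun p => history m μ ν (atPt Φ p) (atPt Ψ p) i j)
      (levels m i j)) :
    (∀ a, ContDiffOn ℝ ∞ (fun p => seedPhi m μ ν (atPt Φ p) (atPt Ψ p) i j a) Ω) ∧
    SolvesLax (chainField m μ ν Φ Ψ 0 1 u (levels m i j))
      (chainField m μ ν Φ Ψ 1 0 v (levels m i j)) Ω (μ i)
      fun p => seedPhi m μ ν (atPt Φ p) (atPt Ψ p) i j := by
  obtain ⟨W, hW, hz, hs, hol, hsol⟩ := hΦ i
  have hW0 : ∀ ζ ∈ W ∩ awayFrom ν, ζ ≠ 0 := fun ζ hζ => hζ.2.1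
  have hsub : (W ∩ awayFrom ν) ×ˢ Ω ⊆ W ×ˢ Ω := prod_mono_left inter_subset_left
  have hsub' : (W ∩ awayFrom ν) ×ˢ Ω ⊆ awayFrom ν ×ˢ Ω := prod_mono_left inter_subset_right
  have hpar := fun p => (history_paramsIn (m := m) (μ := μ) (ν := ν) (φ := atPt Φ p)
    (ψ := atPt Ψ p)).1 i j hj.le
  exact lead_family (hW.inter (isOpen_awayFrom ν)) hΩ
    (F := fun ζ p => (prodT (history m μ ν (atPt Φ p) (atPt Ψ p) i j) ζ).mulVec (Φ i ζ p))
    (contDiffOn_matrix_mulVec (fun a b => (ih.smooth_prodT a b).mono hsub') (hs.mono hsub))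
    (fun p hp => differentiableOn_matrix_mulVec
      (fun a b ζ hζ => (analyticAt_prodT ((hpar p).sq_ne hζ.2.2) a
        b).differentiableAt.differentiableWithinAt)
      ((hol p hp).mono inter_subset_left))
    (fun p _ a b => differentiableOn_laxU hW0 p a b)
    (fun p _ a b => differentiableOn_laxV hW0 p a b)
    (fun ζ hζ => (ih.darboux ζ hζ.2).mulVec (hsol ζ hζ.1)) ⟨hz, hμ0 i, hμν i⟩
    fun p hp => hasLead_seedPhi hμν (fun k => (hΦ k).analyticAt hp) (hnd p hp) i hj

theorem seedPsi_solvesConjLax (hΩ : IsOpen Ω) (hν0 : ∀ i, ν i ≠ 0)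
    (hμν : ∀ i k, μ i ^ 2 ≠ ν k ^ 2) (hΨ : ∀ i, IsConjLaxFamily u v Ω (ν i) (Ψ i))
    (hnd : ∀ p ∈ Ω, NonDeg m μ ν (atPt Φ p) (atPt Ψ p)) {i : Fin n} {j : ℕ} (hj : j < m i)
    (ih : ChainDarboux m μ ν Φ Ψ u v Ω (fun p => history m μ ν (atPt Φ p) (atPt Ψ p) i j)
      (levels m i j)) :
    (∀ a, ContDiffOn ℝ ∞ (fun p => seedPsi m μ ν (atPt Φ p) (atPt Ψ p) i j a) Ω) ∧
    SolvesConjLax (chainField m μ ν Φ Ψ 0 1 u (levels m i j))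
      (chainField m μ ν Φ Ψ 1 0 v (levels m i j)) Ω (ν i)
      fun p => seedPsi m μ ν (atPt Φ p) (atPt Ψ p) i j := by
  obtain ⟨W, hW, hz, hs, hol, hsol⟩ := hΨ i
  have hW0 : ∀ ζ ∈ W ∩ awayFrom μ, ζ ≠ 0 := fun ζ hζ => hζ.2.1
  have hsub : (W ∩ awayFrom μ) ×ˢ Ω ⊆ W ×ˢ Ω := prod_mono_left inter_subset_left
  have hsub' : (W ∩ awayFrom μ) ×ˢ Ω ⊆ awayFrom μ ×ˢ Ω := prod_mono_left inter_subset_right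
  have hpar := fun p => (history_paramsIn (m := m) (μ := μ) (ν := ν) (φ := atPt Φ p)
    (ψ := atPt Ψ p)).1 i j hj.le
  have key := lead_family (hW.inter (isOpen_awayFrom μ)) hΩ
    (F := fun ζ p =>
      (prodTinv (history m μ ν (atPt Φ p) (atPt Ψ p) i j) ζ).transpose.mulVec (Ψ i ζ p))
    -- Rows are treated as columns of the linear system with matrices -Uᵀ and -Vᵀ.
    (X := fun ζ p => -(laxU (chainField m μ ν Φ Ψ 0 1 u (levels m i j))
      (chainField m μ ν Φ Ψ 1 0 v (levels m i j)) ζ p).transpose)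
    (T := fun ζ p => -(laxV (chainField m μ ν Φ Ψ 0 1 u (levels m i j))
      (chainField m μ ν Φ Ψ 1 0 v (levels m i j)) ζ p).transpose)
    (z := ν i) (k := j) (c := fun p => seedPsi m μ ν (atPt Φ p) (atPt Ψ p) i j)
    (contDiffOn_matrix_mulVec (fun a b => (ih.smooth_prodTinv b a).mono hsub') (hs.mono hsub))
    (fun p hp => ?_)
    (fun p _ a b => (differentiableOn_laxU hW0 p b a).neg)
    (fun p _ a b => (differentiableOn_laxV hW0 p b a).neg)
    (fun ζ hζ p hp => ?_) ⟨hz, hν0 i, fun k => (hμν k i).symm⟩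
    fun p hp => ?_
  · refine ⟨key.1, fun p hp => ?_⟩
    have := key.2 p hp
    simp only [Matrix.neg_mulVec, Matrix.mulVec_transpose] at this
    exact this
  · simp only [Matrix.mulVec_transpose, vecMul_prodTinv]
    exact differentiableOn_matrix_mulVec
      (fun a b ζ hζ => (analyticAt_prodT ((hpar p).swap.sq_ne hζ.2.2) a
        b).differentiableAt.differentiableWithinAt)
      ((hol p hp).mono inter_subset_left)
  · simp only [Matrix.neg_mulVec, Matrix.mulVec_transpose]
    exact (ih.conjDarboux ζ hζ.2).vecMul (hsol ζ hζ.1) p hp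
  · simp only [Matrix.mulVec_transpose]
    exact hasLead_seedPsi hμν (fun k => (hΨ k).analyticAt hp) (hnd p hp) i hj

/-- The seeds solve the two Lax pairs of the current chain fields, so a single binary step acts on
these fields; Darboux matrices compose, and the increments of the flux telescope. -/
theorem ChainDarboux.cons (hΩ : IsOpen Ω) (hu : ContDiffOn ℝ ∞ u Ω) (hv : ContDiffOn ℝ ∞ v Ω)
    (hμ0 : ∀ i, μ i ≠ 0) (hν0 : ∀ i, ν i ≠ 0) (hμν : ∀ i k, μ i ^ 2 ≠ ν k ^ 2)
    (hΦ : ∀ i, IsLaxFamily u v Ω (μ i) (Φ i)) (hΨ : ∀ i, IsConjLaxFamily u v Ω (ν i) (Ψ i))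
    (hnd : ∀ p ∈ Ω, NonDeg m μ ν (atPt Φ p) (atPt Ψ p)) {i : Fin n} {j : ℕ} (hj : j < m i)
    (ih : ChainDarboux m μ ν Φ Ψ u v Ω (fun p => history m μ ν (atPt Φ p) (atPt Ψ p) i j)
      (levels m i j)) :
    ChainDarboux m μ ν Φ Ψ u v Ω (fun p => history m μ ν (atPt Φ p) (atPt Ψ p) i (j + 1))
      (levels m i j + Pi.single i 1) := by
  obtain ⟨hfs, hf⟩ := seedPhi_solvesLax hΩ hμ0 hμν hΦ hnd hj ih
  obtain ⟨hgs, hg⟩ := seedPsi_solvesConjLax hΩ hν0 hμν hΨ hnd hj ih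
  have hself := levels_self m i j
  have h1 := fun p hp => (hnd p hp i j hj).1
  have h2 := fun p hp => (hnd p hp i j hj).2
  have hA := fun k l hl a b => (ih.smooth k l hl a b).1
  have hU := contDiffOn_chainField hΩ hA 0 1 hu
  have hV := contDiffOn_chainField hΩ hA 1 0 hv
  have hAB : ∀ a b, ContDiffOn ℝ ∞ (fun p => (stepAt m μ ν Φ Ψ i j p).A a b) Ω ∧
      ContDiffOn ℝ ∞ (fun p => (stepAt m μ ν Φ Ψ i j p).B a b) Ω :=
    contDiffOn_binaryStep hfs hgs h1 h2
  obtain ⟨d1, d2, d3⟩ := binaryStep_isDarboux hΩ hU hV (hμ0 i) (hν0 i) hfs hgs hf hg h1 h2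
    rfl rfl rfl rfl
  have eu : ∀ a b (w : ℝ × ℝ → ℂ), ∀ p ∈ Ω, chainField m μ ν Φ Ψ a b w (levels m i j) p +
      dX (fun p => 2 * (stepAt m μ ν Φ Ψ i j p).A a b) p =
      chainField m μ ν Φ Ψ a b w (levels m i j + Pi.single i 1) p := by
    intro a b w p hp
    have := chainField_add_single (i := i) hΩ hA (by rw [hself]; exact fun a b => (hAB a b).1)
      a b w hp
    rwa [hself] at this
  refine ⟨?_, ?_, ?_, ?_, ?_, ?_⟩
  · intro k l hl a b
    by_cases hk : k = i
    · subst hk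
      rcases eq_or_ne l j with rfl | hne
      · exact hAB a b
      · refine ih.smooth k l ?_ a b
        rw [Pi.add_apply, Pi.single_eq_same, hself] at hl
        rw [hself]; omega
    · refine ih.smooth k l ?_ a b
      rwa [Pi.add_apply, Pi.single_eq_of_ne hk, add_zero] at hl
  · intro ζ hζ
    simp only [history_succ, prodT_cons]
    exact ((d1 ζ hζ.1 (hζ.2 i)).mul (ih.darboux ζ hζ)).congr hΩ (eu 0 1 u) (eu 1 0 v)
  · intro ζ hζ
    simp only [history_succ, prodTinv_cons]
    exact ((ih.conjDarboux ζ hζ).mul (d2 ζ hζ.1 (hζ.2 i))).congr hΩ (eu 0 1 u) (eu 1 0 v)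
  · simp only [history_succ, prodT_cons]
    have hT : ∀ a b, ContDiffOn ℝ ∞ (fun q : ℂ × (ℝ × ℝ) => (stepAt m μ ν Φ Ψ i j q.2).T q.1 a b)
        (awayFrom ν ×ˢ Ω) :=
      contDiffOn_residue_form (c := ν i) (C := fun p => (stepAt m μ ν Φ Ψ i j p).A)
        (fun a b => (hAB a b).1) fun ζ hζ => hζ.2 i
    exact contDiffOn_matrix_mul (A := fun q : ℂ × (ℝ × ℝ) => (stepAt m μ ν Φ Ψ i j q.2).T q.1)
      hT ih.smooth_prodT
  · simp only [history_succ, prodTinv_cons]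
    have hT : ∀ a b, ContDiffOn ℝ ∞
        (fun q : ℂ × (ℝ × ℝ) => (stepAt m μ ν Φ Ψ i j q.2).Tinv q.1 a b) (awayFrom μ ×ˢ Ω) :=
      contDiffOn_residue_form (c := μ i) (C := fun p => (stepAt m μ ν Φ Ψ i j p).B)
        (fun a b => (hAB a b).2) fun ζ hζ => hζ.2 i
    exact contDiffOn_matrix_mul (B := fun q : ℂ × (ℝ × ℝ) => (stepAt m μ ν Φ Ψ i j q.2).Tinv q.1)
      ih.smooth_prodTinv hT
  · intro p hp
    rw [residueSum_add_single, residueSum_add_single, hself,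
      dT_add hΩ (contDiffOn_residueSum hA 0 1) (contDiffOn_const.mul (hAB 0 1).1) hp,
      dT_add hΩ (contDiffOn_residueSum hA 1 0) (contDiffOn_const.mul (hAB 1 0).1) hp,
      (ih.flux p hp).1, (ih.flux p hp).2]
    have e1 : dT (fun p => 2 * (stepAt m μ ν Φ Ψ i j p).A 0 1) p = _ :=
      (d3 p hp).1.trans (congrArg (· - _) (fluxU_congr hΩ (eu 0 1 u) (eu 1 0 v) hp))
    have e2 : dT (fun p => 2 * (stepAt m μ ν Φ Ψ i j p).A 1 0) p = _ :=
      (d3 p hp).2.trans (congrArg (· - _) (fluxV_congr hΩ (eu 0 1 u) (eu 1 0 v) hp))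
    rw [e1, e2]
    constructor <;> ring

theorem chainDarboux_blocks (hΩ : IsOpen Ω) (hu : ContDiffOn ℝ ∞ u Ω) (hv : ContDiffOn ℝ ∞ v Ω)
    (hμ0 : ∀ i, μ i ≠ 0) (hν0 : ∀ i, ν i ≠ 0) (hμν : ∀ i k, μ i ^ 2 ≠ ν k ^ 2)
    (hΦ : ∀ i, IsLaxFamily u v Ω (μ i) (Φ i)) (hΨ : ∀ i, IsConjLaxFamily u v Ω (ν i) (Ψ i))
    (hnd : ∀ p ∈ Ω, NonDeg m μ ν (atPt Φ p) (atPt Ψ p)) :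
    ChainDarboux m μ ν Φ Ψ u v Ω (fun p => blocks m μ ν (atPt Φ p) (atPt Ψ p) n) m :=
  -- The induction runs over histories as functions of the point, since differentiation needs
  -- neighbouring points.
  (levels_induction m (fun i p => blocks m μ ν (atPt Φ p) (atPt Ψ p) i)
    (fun i j p => history m μ ν (atPt Φ p) (atPt Ψ p) i j) (fun _ => rfl)
    (fun i => funext fun _ => blocks_succ i) (ChainDarboux m μ ν Φ Ψ u v Ω) chainDarboux_nil
    fun _ _ hj ih => ih.cons hΩ hu hv hμ0 hν0 hμν hΦ hΨ hnd hj).2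

end Chain

/-! ### The new fields -/

theorem dX_sum {Ω : Set (ℝ × ℝ)} (hΩ : IsOpen Ω) {ι : Type*} (s : Finset ι)
    {f : ι → ℝ × ℝ → ℂ} (hf : ∀ i ∈ s, ContDiffOn ℝ ∞ (f i) Ω) {p : ℝ × ℝ} (hp : p ∈ Ω) :
    dX (fun q => ∑ i ∈ s, f i q) p = ∑ i ∈ s, dX (f i) p :=
  (HasDerivAt.fun_sum fun i hi => hasDerivAt_dX hΩ (hf i hi) hp).deriv

theorem dX_const_mul {Ω : Set (ℝ × ℝ)} (hΩ : IsOpen Ω) (c : ℂ) {f : ℝ × ℝ → ℂ}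
    (hf : ContDiffOn ℝ ∞ f Ω) {p : ℝ × ℝ} (hp : p ∈ Ω) :
    dX (fun q => c * f q) p = c * dX f p :=
  ((hasDerivAt_dX hΩ hf hp).const_mul c).deriv

/-- Multiplication of the two equations by -i and i, respectively, puts them in conservation form.
-/
theorem solvesKN_iff {Ω : Set (ℝ × ℝ)} (hΩ : IsOpen Ω) {u v : ℝ × ℝ → ℂ}
    (hu : ContDiffOn ℝ ∞ u Ω) (hv : ContDiffOn ℝ ∞ v Ω) :
    SolvesKN u v Ω ↔ ∀ p ∈ Ω, dT u p = dX (fluxU u v) p ∧ dT v p = dX (fluxV u v) p := by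
  have hI := Complex.I_mul_I
  refine forall₂_congr fun p hp => ?_
  have h1 : ContDiffOn ℝ ∞ (fun q => u q ^ 2 * v q) Ω := (hu.pow 2).mul hv
  have h2 : ContDiffOn ℝ ∞ (fun q => u q * v q ^ 2) Ω := hu.mul (hv.pow 2)
  have e1 : dX (fluxU u v) p = dX (fun q => u q ^ 2 * v q) p + Complex.I * dX (dX u) p :=
    ((hasDerivAt_dX hΩ h1 hp).add
      ((hasDerivAt_dX hΩ (contDiffOn_dX hΩ hu) hp).const_mul Complex.I)).deriv
  have e2 : dX (fluxV u v) p = dX (fun q => u q * v q ^ 2) p - Complex.I * dX (dX v) p :=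
    ((hasDerivAt_dX hΩ h2 hp).sub
      ((hasDerivAt_dX hΩ (contDiffOn_dX hΩ hv) hp).const_mul Complex.I)).deriv
  rw [e1, e2]
  refine and_congr ⟨fun h => ?_, fun h => ?_⟩ ⟨fun h => ?_, fun h => ?_⟩
  · linear_combination -Complex.I * h + (dT u p - dX (fun q => u q ^ 2 * v q) p) * hI
  · linear_combination Complex.I * h + dX (dX u) p * hI
  · linear_combination Complex.I * h + (dT v p - dX (fun q => u q * v q ^ 2) p) * hI
  · linear_combination -Complex.I * h + dX (dX v) p * hI

section Main

variable {n : ℕ} {m : Fin n → ℕ} {μ ν : Fin n → ℂ} {Φ Ψ : Fin n → ℂ → ℝ × ℝ → Fin 2 → ℂ}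
  {u v : ℝ × ℝ → ℂ} {Ω : Set (ℝ × ℝ)}

theorem residueSum_eq_ratioP (hμν : ∀ i k, μ i ^ 2 ≠ ν k ^ 2) {p : ℝ × ℝ}
    (hφ : ∀ i, AnalyticAt ℂ (atPt Φ p i) (μ i)) (hψ : ∀ i, AnalyticAt ℂ (atPt Ψ p i) (ν i))
    (hnd : NonDeg m μ ν (atPt Φ p) (atPt Ψ p)) :
    residueSum m μ ν Φ Ψ 0 1 m p = -2 * ratioP m μ ν (atPt Φ p) (atPt Ψ p) := by
  rw [(det_matP_ne_zero_and_ratioP hμν hφ hψ hnd).2]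
  simp only [residueSum, ← Finset.mul_sum, stepAt]
  ring

theorem residueSum_eq_ratioQ (hμν : ∀ i k, μ i ^ 2 ≠ ν k ^ 2) {p : ℝ × ℝ}
    (hφ : ∀ i, AnalyticAt ℂ (atPt Φ p i) (μ i)) (hψ : ∀ i, AnalyticAt ℂ (atPt Ψ p i) (ν i))
    (hnd : NonDeg m μ ν (atPt Φ p) (atPt Ψ p)) :
    residueSum m μ ν Φ Ψ 1 0 m p = -2 * ratioQ m μ ν (atPt Φ p) (atPt Ψ p) := by
  rw [(det_matQ_ne_zero_and_ratioQ hμν hφ hψ hnd).2]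
  simp only [residueSum, ← Finset.mul_sum, stepAt]
  ring

theorem dX_residueSum (hΩ : IsOpen Ω) {a b : Fin 2} {e : Fin n → ℕ}
    (h : ∀ k, ∀ l < e k, ContDiffOn ℝ ∞ (fun p => (stepAt m μ ν Φ Ψ k l p).A a b) Ω) {p : ℝ × ℝ}
    (hp : p ∈ Ω) :
    dX (residueSum m μ ν Φ Ψ a b e) p =
      ∑ k, ∑ l ∈ Finset.range (e k), dX (fun q => 2 * (stepAt m μ ν Φ Ψ k l q).A a b) p := by
  have h' : ∀ k, ∀ l ∈ Finset.range (e k),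
      ContDiffOn ℝ ∞ (fun q => 2 * (stepAt m μ ν Φ Ψ k l q).A a b) Ω :=
    fun k l hl => contDiffOn_const.mul (h k l (Finset.mem_range.1 hl))
  unfold residueSum
  rw [dX_sum hΩ _ (fun k _ => ContDiffOn.sum (h' k)) hp]
  exact Finset.sum_congr rfl fun k _ => dX_sum hΩ _ (h' k) hp

/-- The chain of fields carries solutions of the system to solutions. -/
theorem ChainDarboux.solvesKN (hΩ : IsOpen Ω) (hu : ContDiffOn ℝ ∞ u Ω) (hv : ContDiffOn ℝ ∞ v Ω)
    (hKN : SolvesKN u v Ω) {L : ℝ × ℝ → List Step} {e : Fin n → ℕ}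
    (h : ChainDarboux m μ ν Φ Ψ u v Ω L e) :
    SolvesKN (chainField m μ ν Φ Ψ 0 1 u e) (chainField m μ ν Φ Ψ 1 0 v e) Ω := by
  have hA := fun k l hl a b => (h.smooth k l hl a b).1
  have hU := contDiffOn_chainField hΩ hA 0 1 hu
  have hV := contDiffOn_chainField hΩ hA 1 0 hv
  rw [solvesKN_iff hΩ hu hv] at hKN
  rw [solvesKN_iff hΩ hU hV]
  intro p hp
  have flux_smooth : ∀ {u v : ℝ × ℝ → ℂ}, ContDiffOn ℝ ∞ u Ω → ContDiffOn ℝ ∞ v Ω →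
      ContDiffOn ℝ ∞ (fluxU u v) Ω ∧ ContDiffOn ℝ ∞ (fluxV u v) Ω := fun hu hv =>
    ⟨((hu.pow 2).mul hv).add (contDiffOn_const.mul (contDiffOn_dX hΩ hu)),
      (hu.mul (hv.pow 2)).sub (contDiffOn_const.mul (contDiffOn_dX hΩ hv))⟩
  have dX_sub : ∀ {f g : ℝ × ℝ → ℂ}, ContDiffOn ℝ ∞ f Ω → ContDiffOn ℝ ∞ g Ω →
      dX (fun q => f q - g q) p = dX f p - dX g p := fun hf hg =>
    ((hasDerivAt_dX hΩ hf hp).sub (hasDerivAt_dX hΩ hg hp)).deriv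
  have h01 := contDiffOn_residueSum hA 0 1
  have h10 := contDiffOn_residueSum hA 1 0
  constructor
  · have e1 : dT (chainField m μ ν Φ Ψ 0 1 u e) p = _ := dT_add hΩ hu (contDiffOn_dX hΩ h01) hp
    -- With S the residue sum, S_xt = S_tx, and S_t is the increment of the flux. The old flux
    -- cancels against u_t, leaving the x-derivative of the new flux.
    rw [e1, dT_dX_comm hΩ h01 hp, dX_congr hΩ (fun q hq => (h.flux q hq).1) hp,
      dX_sub (flux_smooth hU hV).1 (flux_smooth hu hv).1, (hKN p hp).1]
    ring
  · have e1 : dT (chainField m μ ν Φ Ψ 1 0 v e) p = _ := dT_add hΩ hv (contDiffOn_dX hΩ h10) hp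
    rw [e1, dT_dX_comm hΩ h10 hp, dX_congr hΩ (fun q hq => (h.flux q hq).2) hp,
      dX_sub (flux_smooth hU hV).2 (flux_smooth hu hv).2, (hKN p hp).2]
    ring

theorem SolvesKN.congr (hΩ : IsOpen Ω) {u' v' : ℝ × ℝ → ℂ} (h : SolvesKN u v Ω)
    (hu : ∀ p ∈ Ω, u p = u' p) (hv : ∀ p ∈ Ω, v p = v' p) : SolvesKN u' v' Ω := by
  intro p hp
  have := h p hp
  rwa [dT_congr hΩ hu hp, dT_congr hΩ hv hp,
    dX_congr hΩ (fun q hq => dX_congr hΩ hu hq) hp, dX_congr hΩ (fun q hq => dX_congr hΩ hv hq) hp,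
    dX_congr hΩ (f := fun q => u q ^ 2 * v q) (g := fun q => u' q ^ 2 * v' q)
      (fun q hq => by rw [hu q hq, hv q hq]) hp,
    dX_congr hΩ (f := fun q => u q * v q ^ 2) (g := fun q => u' q * v' q ^ 2)
      (fun q hq => by rw [hu q hq, hv q hq]) hp] at this

end Main

end KaupNewell

end

/-! ### The main theorem. -/

open KaupNewell in
theorem theorem4 {n : ℕ} (m : Fin n → ℕ) (μ ν : Fin n → ℂ)
    (Ω : Set (ℝ × ℝ)) (hΩ : IsOpen Ω)
    (u v : ℝ × ℝ → ℂ) (hu : ContDiffOn ℝ ∞ u Ω) (hv : ContDiffOn ℝ ∞ v Ω)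
    (hKN : SolvesKN u v Ω)
    (hμ0 : ∀ i, μ i ≠ 0) (hν0 : ∀ i, ν i ≠ 0)
    (hμ : Function.Injective fun i => μ i ^ 2) (hν : Function.Injective fun i => ν i ^ 2)
    (hμν : ∀ i k, μ i ^ 2 ≠ ν k ^ 2)
    (Φ Ψ : Fin n → ℂ → ℝ × ℝ → Fin 2 → ℂ)
    (hΦ : ∀ i, IsLaxFamily u v Ω (μ i) (Φ i))
    (hΨ : ∀ i, IsConjLaxFamily u v Ω (ν i) (Ψ i))
    -- the coefficients `α_i^{[j]}` and `β_i^{[j]}` exist on `Ω`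
    (hnd : ∀ p ∈ Ω, ∀ i, ∀ j < m i,
      alphaInv (μ i) (ν i) (seedPhi m μ ν (atPt Φ p) (atPt Ψ p) i j)
        (seedPsi m μ ν (atPt Φ p) (atPt Ψ p) i j) ≠ 0 ∧
      betaInv (μ i) (ν i) (seedPhi m μ ν (atPt Φ p) (atPt Ψ p) i j)
        (seedPsi m μ ν (atPt Φ p) (atPt Ψ p) i j) ≠ 0) :
    -- the seeds are the limits of the transformed solutions
    (∀ p ∈ Ω, ∀ i, ∀ j < m i,
      Filter.Tendsto
        (fun δ : ℂ => (1 / δ ^ j) •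
          Matrix.mulVec (prodT (history m μ ν (atPt Φ p) (atPt Ψ p) i j) (μ i + δ)) (Φ i (μ i + δ) p))
        (nhdsWithin 0 {0}ᶜ) (nhds (seedPhi m μ ν (atPt Φ p) (atPt Ψ p) i j)) ∧
      Filter.Tendsto
        (fun δ : ℂ => (1 / δ ^ j) •
          Matrix.vecMul (Ψ i (ν i + δ) p) (prodTinv (history m μ ν (atPt Φ p) (atPt Ψ p) i j) (ν i + δ)))
        (nhdsWithin 0 {0}ᶜ) (nhds (seedPsi m μ ν (atPt Φ p) (atPt Ψ p) i j))) ∧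
    -- every factor has the stated inverse, and so has the product
    (∀ p ∈ Ω, ∀ i, ∀ j < m i, ∀ ζ : ℂ, ζ ^ 2 ≠ μ i ^ 2 → ζ ^ 2 ≠ ν i ^ 2 →
      (gStep m μ ν (atPt Φ p) (atPt Ψ p) i j).T ζ * (gStep m μ ν (atPt Φ p) (atPt Ψ p) i j).Tinv ζ = 1 ∧
      (gStep m μ ν (atPt Φ p) (atPt Ψ p) i j).Tinv ζ * (gStep m μ ν (atPt Φ p) (atPt Ψ p) i j).T ζ = 1) ∧
    (∀ p ∈ Ω, ∀ ζ : ℂ, (∀ i, ζ ^ 2 ≠ μ i ^ 2) → (∀ i, ζ ^ 2 ≠ ν i ^ 2) →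
      gdt m μ ν (atPt Φ p) (atPt Ψ p) ζ * gdtInv m μ ν (atPt Φ p) (atPt Ψ p) ζ = 1 ∧
      gdtInv m μ ν (atPt Φ p) (atPt Ψ p) ζ * gdt m μ ν (atPt Φ p) (atPt Ψ p) ζ = 1) ∧
    -- zeros of order `m i` at `±μ i`, and of the inverse at `±ν i`
    (∀ p ∈ Ω, ∀ ζ : ℂ, (∀ i, ζ ^ 2 ≠ ν i ^ 2) →
      (gdt m μ ν (atPt Φ p) (atPt Ψ p) ζ).det = ∏ i, ((ζ ^ 2 - μ i ^ 2) / (ζ ^ 2 - ν i ^ 2)) ^ m i) ∧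
    (∀ p ∈ Ω, ∀ ζ : ℂ, (∀ i, ζ ^ 2 ≠ μ i ^ 2) →
      (gdtInv m μ ν (atPt Φ p) (atPt Ψ p) ζ).det = ∏ i, ((ζ ^ 2 - ν i ^ 2) / (ζ ^ 2 - μ i ^ 2)) ^ m i) ∧
    (∀ p ∈ Ω, ∀ i,
      Asymptotics.IsBigO (nhds (μ i)) (fun ζ => Matrix.mulVec (gdt m μ ν (atPt Φ p) (atPt Ψ p) ζ) (Φ i ζ p))
        (fun ζ => (ζ - μ i) ^ m i) ∧
      Asymptotics.IsBigO (nhds (ν i)) (fun ζ => Matrix.vecMul (Ψ i ζ p) (gdtInv m μ ν (atPt Φ p) (atPt Ψ p) ζ))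
        (fun ζ => (ζ - ν i) ^ m i)) ∧
    -- the new fields are well defined and smooth, and solve the system
    (∀ p ∈ Ω, (matP m μ ν (atPt Φ p) (atPt Ψ p)).det ≠ 0 ∧ (matQ m μ ν (atPt Φ p) (atPt Ψ p)).det ≠ 0) ∧
    ContDiffOn ℝ ∞ (fun p => ratioP m μ ν (atPt Φ p) (atPt Ψ p)) Ω ∧
    ContDiffOn ℝ ∞ (fun p => ratioQ m μ ν (atPt Φ p) (atPt Ψ p)) Ω ∧
    SolvesKN (newU m μ ν Φ Ψ u) (newV m μ ν Φ Ψ v) Ω ∧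
    -- `T_N` and its inverse are Darboux matrices from the old fields to the new ones
    (∀ ζ : ℂ, ζ ≠ 0 → (∀ i, ζ ^ 2 ≠ ν i ^ 2) →
      IsDarboux u v (newU m μ ν Φ Ψ u) (newV m μ ν Φ Ψ v) Ω ζ
        (fun p => gdt m μ ν (atPt Φ p) (atPt Ψ p) ζ)) ∧
    (∀ ζ : ℂ, ζ ≠ 0 → (∀ i, ζ ^ 2 ≠ μ i ^ 2) →
      IsConjDarboux u v (newU m μ ν Φ Ψ u) (newV m μ ν Φ Ψ v) Ω ζ
        (fun p => gdtInv m μ ν (atPt Φ p) (atPt Ψ p) ζ)) ∧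
    -- the new fields through the residue matrices
    (∀ i, ∀ j < m i, ∀ a b : Fin 2,
      ContDiffOn ℝ ∞ (fun p => (gStep m μ ν (atPt Φ p) (atPt Ψ p) i j).A a b) Ω ∧
      ContDiffOn ℝ ∞ (fun p => (gStep m μ ν (atPt Φ p) (atPt Ψ p) i j).B a b) Ω) ∧
    (∀ p ∈ Ω,
      newU m μ ν Φ Ψ u p = u p + ∑ i, ∑ j ∈ Finset.range (m i),
        dX (fun q => ((gStep m μ ν (atPt Φ q) (atPt Ψ q) i j).A -
          sigma3 * (gStep m μ ν (atPt Φ q) (atPt Ψ q) i j).A * sigma3) 0 1) p ∧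
      newV m μ ν Φ Ψ v p = v p - ∑ i, ∑ j ∈ Finset.range (m i),
        dX (fun q => ((gStep m μ ν (atPt Φ q) (atPt Ψ q) i j).B -
          sigma3 * (gStep m μ ν (atPt Φ q) (atPt Ψ q) i j).B * sigma3) 1 0) p) := by
  have hφ : ∀ p ∈ Ω, ∀ i, AnalyticAt ℂ (atPt Φ p i) (μ i) := fun p hp i => (hΦ i).analyticAt hp
  have hψ : ∀ p ∈ Ω, ∀ i, AnalyticAt ℂ (atPt Ψ p i) (ν i) := fun p hp i => (hΨ i).analyticAt hp
  have hN : ∀ p ∈ Ω, NonDeg m μ ν (atPt Φ p) (atPt Ψ p) := hnd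
  have hC := chainDarboux_blocks hΩ hu hv hμ0 hν0 hμν hΦ hΨ hN
  have hA := fun k l hl a b => (hC.smooth k l hl a b).1
  have h01 := contDiffOn_residueSum hA 0 1
  have h10 := contDiffOn_residueSum hA 1 0
  have eP : ∀ p ∈ Ω, ratioP m μ ν (atPt Φ p) (atPt Ψ p) =
      -(1 / 2) * residueSum m μ ν Φ Ψ 0 1 m p := by
    intro p hp
    rw [residueSum_eq_ratioP hμν (hφ p hp) (hψ p hp) (hN p hp)]; ring
  have eQ : ∀ p ∈ Ω, ratioQ m μ ν (atPt Φ p) (atPt Ψ p) =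
      -(1 / 2) * residueSum m μ ν Φ Ψ 1 0 m p := by
    intro p hp
    rw [residueSum_eq_ratioQ hμν (hφ p hp) (hψ p hp) (hN p hp)]; ring
  -- The determinant ratio is -1/2 times the residue sum, so the factor -2 in `newU` restores the
  -- chain field.
  have eU : ∀ p ∈ Ω, chainField m μ ν Φ Ψ 0 1 u m p = newU m μ ν Φ Ψ u p := by
    intro p hp
    rw [newU, dX_congr hΩ eP hp, dX_const_mul hΩ _ h01 hp, chainField]; ring
  have eV : ∀ p ∈ Ω, chainField m μ ν Φ Ψ 1 0 v m p = newV m μ ν Φ Ψ v p := by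
    intro p hp
    rw [newV, dX_congr hΩ eQ hp, dX_const_mul hΩ _ h10 hp, chainField]; ring
  refine ⟨fun p hp i j hj => ⟨(hasLead_seedPhi hμν (hφ p hp) (hN p hp) i hj).tendsto,
      (hasLead_seedPsi hμν (hψ p hp) (hN p hp) i hj).tendsto⟩,
    fun p hp i j hj ζ h1 h2 => ?_, fun p hp ζ h1 h2 => ?_,
    fun p hp ζ h => det_prodT (hN p hp) h, fun p hp ζ h => det_prodTinv (hN p hp) h,
    fun p hp i => ?_,
    fun p hp => ⟨(det_matP_ne_zero_and_ratioP hμν (hφ p hp) (hψ p hp) (hN p hp)).1,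
      (det_matQ_ne_zero_and_ratioQ hμν (hφ p hp) (hψ p hp) (hN p hp)).1⟩,
    (contDiffOn_const.mul h01).congr eP, (contDiffOn_const.mul h10).congr eQ,
    (hC.solvesKN hΩ hu hv hKN).congr hΩ eU eV,
    fun ζ h0 h => (hC.darboux ζ ⟨h0, h⟩).congr hΩ eU eV,
    fun ζ h0 h => (hC.conjDarboux ζ ⟨h0, h⟩).congr hΩ eU eV,
    hC.smooth, fun p hp => ⟨?_, ?_⟩⟩
  · have h : (gStep m μ ν (atPt Φ p) (atPt Ψ p) i j).T ζ *
        (gStep m μ ν (atPt Φ p) (atPt Ψ p) i j).Tinv ζ = 1 :=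
      binaryStep_T_mul_Tinv (hnd p hp i j hj).1 (hnd p hp i j hj).2 h1 h2
    exact ⟨h, mul_eq_one_comm.1 h⟩
  · have h : gdt m μ ν (atPt Φ p) (atPt Ψ p) ζ * gdtInv m μ ν (atPt Φ p) (atPt Ψ p) ζ = 1 :=
      prodT_mul_prodTinv (hN p hp) h1 h2
    exact ⟨h, mul_eq_one_comm.1 h⟩
  · obtain ⟨c, hc⟩ := (hasLead_prodT hμν (hφ p hp) (hN p hp)).2 i
    obtain ⟨d, hd⟩ := (hasLead_prodTinv hμν (hψ p hp) (hN p hp)).2 i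
    exact ⟨hc.isBigO, hd.isBigO⟩
  · rw [← eU p hp, chainField, dX_residueSum hΩ (fun k l hl => hA k l hl 0 1) hp]
    congr 1
    refine Finset.sum_congr rfl fun i _ => Finset.sum_congr rfl fun j _ => ?_
    congr 1
    funext q
    -- Off the diagonal A - σ₃Aσ₃ is 2A, the summand of `residueSum`.
    rw [Matrix.sub_apply, sigma3_conj, stepAt]
    simp
    ring
  · rw [← eV p hp, chainField, dX_residueSum hΩ (fun k l hl => hA k l hl 1 0) hp, sub_eq_add_neg,
      ← Finset.sum_neg_distrib]
    congr 1
    refine Finset.sum_congr rfl fun i _ => ?_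
    rw [← Finset.sum_neg_distrib]
    refine Finset.sum_congr rfl fun j hj => ?_
    have hs := hA i j (Finset.mem_range.1 hj) 1 0
    have e : ∀ q ∈ Ω, ((gStep m μ ν (atPt Φ q) (atPt Ψ q) i j).B -
        sigma3 * (gStep m μ ν (atPt Φ q) (atPt Ψ q) i j).B * sigma3) 1 0 =
        -2 * (stepAt m μ ν Φ Ψ i j q).A 1 0 := by
      intro q _
      -- The formula for v[N] uses B, and B₂₁ = -A₂₁ accounts for its minus sign.
      have hB : (gStep m μ ν (atPt Φ q) (atPt Ψ q) i j).B 1 0 = -(stepAt m μ ν Φ Ψ i j q).A 1 0 :=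
        binaryStep_B10
      rw [Matrix.sub_apply, sigma3_conj]
      simp [hB]
      ring
    rw [dX_congr hΩ e hp, dX_const_mul hΩ _ hs hp, dX_const_mul hΩ _ hs hp]
    ring
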